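/- Let $\mathbf{k}$ be a field of characteristic zero and let $d,r\ge 2$ be integers with $\gcd(d,r)=1$. For integers $m\ge 2$, $n\ge 1$, $e\ge 0$ with $(n,e)\ne(1,0)$ and a polynomial $Q\in\mathbf{k}[X,S,T]$ put $$B_{(n,e,Q)}=\mathbf{k}[X,Y,Z,T]/\langle X^{n}Y-(Y^{m}-X^{e}Z)^{d}-T^{r}-X\,Q(X,Y^{m}-X^{e}Z,T)\rangle ,$$ and for $n\ge 1$ and $Q\in\mathbf{k}[X,S,T]$ let $$\mathbf{R}_{(n,S^{d}+T^{r}+XQ)}=\mathbf{k}[X,Y,S,T]/\langle X^{n}Y-S^{d}-T^{r}-X\,Q(X,S,T)\rangle$$ be the corresponding Russell domain. In each of these rings let $x$ denote the class of $X$. (A) Fix $m\ge 2$, and let $n_i\ge 1$, $e_i\ge 0$ with $(n_i,e_i)\ne(1,0)$ and $Q_i\in\mathbf{k}[X,S,T]$ for $i=1,2$. If $\Psi:B_{(n_1,e_1,Q_1)}\to B_{(n_2,e_2,Q_2)}$ is an isomorphism of $\mathbf{k}$-algebras, then (1) there exists $\lambda\in\mathbf{k}\setminus\{0\}$ such that $\Psi(x)=\lambda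 x$, and (2) $n_1+e_1=n_2+e_2$. (B) Let $n_1,n_2\ge 1$ and $Q_1,Q_2\in\mathbf{k}[X,S,T]$. If $\Psi:\mathbf{R}_{(n_1,S^{d}+T^{r}+XQ_1)}\to\mathbf{R}_{(n_2,S^{d}+T^{r}+XQ_2)}$ is an isomorphism of $\mathbf{k}$-algebras, then (1) if $(n_1,n_2)\ne(1,1)$, there exists $\lambda\in\mathbf{k}\setminus\{0\}$ such that $\Psi(x)=\lambda x$, and (2) $n_1=n_2$. -/

import Mathlib

namespace RussellExt

/-- The polynomial `S ^ d + T ^ r + X * Q(X, S, T)` of `k[X, S, T]`; the variables `X, S, T` are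
`X 0, X 1, X 2`. -/
noncomputable def baseF {k : Type*} [Field k] (d r : ℕ) (Q : MvPolynomial (Fin 3) k) :
    MvPolynomial (Fin 3) k :=
  MvPolynomial.X 1 ^ d + MvPolynomial.X 2 ^ r + MvPolynomial.X 0 * Q

/-- The polynomial `X ^ n * Y - F(X, S, T)` of `k[X, Y, S, T]`; the variables `X, Y, S, T` are
`X 0, X 1, X 2, X 3`. -/
noncomputable def russellPoly {k : Type*} [Field k] (n : ℕ) (F : MvPolynomial (Fin 3) k) :
    MvPolynomial (Fin 4) k :=
  MvPolynomial.X 0 ^ n * MvPolynomial.X 1 -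
    MvPolynomial.aeval ![MvPolynomial.X 0, MvPolynomial.X 2, MvPolynomial.X 3] F

/-- The Russell domain `R_(n,F) = k[X, Y, S, T] / (X ^ n * Y - F(X, S, T))`. -/
abbrev RussellDomain {k : Type*} [Field k] (n : ℕ) (F : MvPolynomial (Fin 3) k) : Type _ :=
  MvPolynomial (Fin 4) k ⧸ Ideal.span {russellPoly n F}

/-- The class `x` of `X` in `R_(n,F)`. -/
noncomputable def RussellDomain.x {k : Type*} [Field k] (n : ℕ) (F : MvPolynomial (Fin 3) k) :
    RussellDomain n F :=
  Ideal.Quotient.mk _ (MvPolynomial.X 0)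

/-- The polynomial
`X ^ n * Y - (Y ^ m - X ^ e * Z) ^ d - T ^ r - X * Q(X, Y ^ m - X ^ e * Z, T)` of `k[X, Y, Z, T]`;
the variables `X, Y, Z, T` are `X 0, X 1, X 2, X 3`. -/
noncomputable def bPoly {k : Type*} [Field k] (m d r n e : ℕ) (Q : MvPolynomial (Fin 3) k) :
    MvPolynomial (Fin 4) k :=
  MvPolynomial.X 0 ^ n * MvPolynomial.X 1
    - (MvPolynomial.X 1 ^ m - MvPolynomial.X 0 ^ e * MvPolynomial.X 2) ^ d
    - MvPolynomial.X 3 ^ r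
    - MvPolynomial.X 0 * MvPolynomial.aeval ![MvPolynomial.X 0,
        MvPolynomial.X 1 ^ m - MvPolynomial.X 0 ^ e * MvPolynomial.X 2, MvPolynomial.X 3] Q

/-- The ring `B_(n,e,Q)` (for fixed exponents `m, d, r`), the quotient of `k[X, Y, Z, T]` by the
ideal generated by `bPoly`. -/
abbrev BRing {k : Type*} [Field k] (m d r n e : ℕ) (Q : MvPolynomial (Fin 3) k) : Type _ :=
  MvPolynomial (Fin 4) k ⧸ Ideal.span {bPoly m d r n e Q}

/-- The class `x` of `X` in `B_(n,e,Q)`. -/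
noncomputable def BRing.x {k : Type*} [Field k] (m d r n e : ℕ) (Q : MvPolynomial (Fin 3) k) :
    BRing m d r n e Q :=
  Ideal.Quotient.mk _ (MvPolynomial.X 0)

end RussellExt

set_option linter.unusedSectionVars false

namespace RussellExt

open AddMonoidAlgebra (supported)

/-! ### Locally nilpotent derivations of a domain: degree, factorial closedness, proportionality. -/

section LocallyNilpotent

variable {k A : Type*} [Field k] [CharZero k] [CommRing A] [IsDomain A] [Algebra k A]

/-! Inverting `x` turns each of the rings into `k[x, 1/x, s, t]`, with `s = y ^ m - x ^ e * z`. So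
each ring is a subalgebra `Bsub` of the Laurent polynomials, generated by `x`, `t`, `y = (s ^ d + t
^ r + x * q) / x ^ n` and `z = (y ^ m - s) / x ^ e`. A Russell domain is the case `e = 0`, where `z`
only contributes `s`. An isomorphism amounts to two embeddings `φ₁`, `φ₂` of one ring, and these are
compared through locally nilpotent derivations (LNDs). Such a derivation extends to the Laurent
ring, where it is locally nilpotent only on the subalgebra `nil D`.

Two facts hold for every nonzero LND `D` when `(n, e) ≠ (1, 0)`.

The kernel of `D` lies in `k[x, s, t]` (`mem_polX_of_map_eq_zero`). The ring has an explicit basis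
modulo `k[x, s, t]` over `k[s, t]`, so an element with a pole along `x = 0` has a leading
coefficient divisible by `h = s ^ d + t ^ r` (`exists_leading`). If a kernel element has a pole, the
leading part `E` of `D` kills the leading form `zbar` of `z`. Then `E h ^ 2` is divisible by `h`;
this is where `(n, e) ≠ (1, 0)` enters (`sq_map_hh`). It follows that `E` kills neither `s` nor `t`.
By coprimality of `d` and `r`, `E` then kills no nonconstant quasi-homogeneous polynomial in `s, t`
(`map_vs_or_vt_eq_zero`). Hence its homogeneous kernel is spanned by monomials in `x` and the
leading forms of `y, z`, all killed by `h_t ∂_s - h_s ∂_t`. Proportionality of the two derivations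
forces `E x = 0`, then `E h = 0`, a contradiction.

`D` kills `x` (`map_vx_eq_zero_of_nil`). Otherwise the kernel embeds in `k[s, t]` by reduction
modulo `x`, and the leading part of `D` for `-deg_x` shows that it contains no two algebraically
independent elements. That is too small for the kernel of an LND in dimension 3.

The derivations `x ^ (n + e) ∂_s` and `x ^ (n + e) ∂_t` are LNDs. Their kernels contain `x`, `s` and
`t` between them, so both embeddings single out the same subalgebra `k[x, s, t]`; and as `x` is
killed by all LNDs, both single out the same `k[x]`. Thus the two elements `x` differ by an affine
substitution, whose constant term vanishes because `y` has a pole only along `x = 0`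
(`IsEmb.exists_smul`). Finally `n + e` is the least `N` for which `x ^ N ∂_s` preserves the ring, so
it is an invariant (`IsEmb.le_of_smul`).

For `(n, e) = (1, 0)` the derivation `flow` moves `x`, so only constants are killed by all LNDs;
this separates that ring from all the others (`IsEmb.not_one_zero`). -/

theorem iterate_leibniz (D : Derivation k A A) (N : ℕ) (f g : A) :
    D^[N] (f * g) = ∑ i ∈ Finset.range (N + 1), N.choose i • (D^[i] f * D^[N - i] g) := by
  induction N with
  | zero => simp
  | succ N ih =>
    rw [← Finset.Nat.sum_antidiagonal_eq_sum_range_succ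
      (f := fun i j => (N + 1).choose i • (D^[i] f * D^[j] g))]
    rw [← Finset.Nat.sum_antidiagonal_eq_sum_range_succ
      (f := fun i j => N.choose i • (D^[i] f * D^[j] g))] at ih
    rw [Finset.sum_antidiagonal_choose_succ_nsmul (fun i j => D^[i] f * D^[j] g),
      Function.iterate_succ_apply', ih, map_sum, ← Finset.sum_add_distrib]
    refine Finset.sum_congr rfl fun ij hij => ?_
    have h2 : N.choose ij.2 = N.choose ij.1 := by
      rw [Finset.HasAntidiagonal.mem_antidiagonal] at hij
      exact Nat.choose_symm_of_eq_add (by omega)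
    rw [h2, map_nsmul, Derivation.leibniz, nsmul_add, Function.iterate_succ_apply',
      Function.iterate_succ_apply']
    simp only [smul_eq_mul, mul_comm]

/-- The elements killed by some iterate of `D`. -/
def nil (D : Derivation k A A) : Subalgebra k A where
  carrier := {f | ∃ n, D^[n] f = 0}
  mul_mem' := by
    rintro f g ⟨a, ha⟩ ⟨b, hb⟩
    have key : ∀ {f : A} {a i : ℕ}, D^[a] f = 0 → a ≤ i → D^[i] f = 0 := by
      intro f a i ha hi
      obtain ⟨j, rfl⟩ := Nat.exists_eq_add_of_le hi
      rw [add_comm, Function.iterate_add_apply, ha, iterate_map_zero]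
    refine ⟨a + b, ?_⟩
    rw [iterate_leibniz]
    refine Finset.sum_eq_zero fun i _ => ?_
    rcases le_or_gt a i with h | h
    · rw [key ha h, zero_mul, smul_zero]
    · rw [key hb (by omega : b ≤ a + b - i), mul_zero, smul_zero]
  add_mem' := by
    rintro f g ⟨a, ha⟩ ⟨b, hb⟩
    refine ⟨a + b, ?_⟩
    rw [iterate_map_add, Function.iterate_add_apply D a b g, hb, iterate_map_zero, add_comm a b,
      Function.iterate_add_apply, ha, iterate_map_zero, add_zero]
  algebraMap_mem' c := ⟨1, by simp⟩

theorem mem_nil_of_map_mem {D : Derivation k A A} {f : A} (h : D f ∈ nil D) : f ∈ nil D := by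
  obtain ⟨n, hn⟩ := h
  exact ⟨n + 1, hn⟩

theorem map_mem_nil {D : Derivation k A A} {f : A} (h : f ∈ nil D) : D f ∈ nil D := by
  obtain ⟨n, hn⟩ := h
  refine ⟨n, ?_⟩
  rw [← Function.iterate_succ_apply, Function.iterate_succ_apply', hn, map_zero]

theorem mem_nil_of_map_eq_zero {D : Derivation k A A} {f : A} (h : D f = 0) : f ∈ nil D := ⟨1, h⟩

/-- `f` has degree exactly `a` with respect to `D`. -/
def HasDeg (D : Derivation k A A) (f : A) (a : ℕ) : Prop := D^[a] f ≠ 0 ∧ D^[a + 1] f = 0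

theorem iterate_eq_zero_of_le {D : Derivation k A A} {f : A} {a i : ℕ} (h : D^[a] f = 0)
    (hi : a ≤ i) : D^[i] f = 0 := by
  obtain ⟨j, rfl⟩ := Nat.exists_eq_add_of_le hi
  rw [add_comm, Function.iterate_add_apply, h, iterate_map_zero]

theorem exists_hasDeg {D : Derivation k A A} {f : A} (h : f ∈ nil D) (h0 : f ≠ 0) :
    ∃ a, HasDeg D f a := by
  classical
  have hp : Nat.find h ≠ 0 := by
    intro h1
    have := Nat.find_spec h
    rw [h1] at this
    exact h0 this
  refine ⟨Nat.find h - 1, Nat.find_min h (by omega), ?_⟩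
  have : Nat.find h - 1 + 1 = Nat.find h := by omega
  rw [this]
  exact Nat.find_spec h

theorem HasDeg.ne_zero {D : Derivation k A A} {f : A} {a : ℕ} (h : HasDeg D f a) : f ≠ 0 := by
  rintro rfl
  exact h.1 (iterate_map_zero _ _)

theorem HasDeg.unique {D : Derivation k A A} {f : A} {a b : ℕ} (ha : HasDeg D f a)
    (hb : HasDeg D f b) : a = b := by
  by_contra hne
  rcases lt_or_gt_of_ne hne with h | h
  · exact hb.1 (iterate_eq_zero_of_le ha.2 h)
  · exact ha.1 (iterate_eq_zero_of_le hb.2 h)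

/-- Only the term `i = a` of the Leibniz expansion of `D^[a + b] (f * g)` survives. Its binomial
coefficient is nonzero in characteristic zero, and the product is nonzero in a domain. -/
theorem HasDeg.mul {D : Derivation k A A} {f g : A} {a b : ℕ} (hf : HasDeg D f a)
    (hg : HasDeg D g b) : HasDeg D (f * g) (a + b) := by
  have : CharZero A := charZero_of_injective_algebraMap (algebraMap k A).injective
  constructor
  · rw [iterate_leibniz, Finset.sum_eq_single a]
    · rw [Nat.add_sub_cancel_left, nsmul_eq_mul]
      have : ((a + b).choose a : A) ≠ 0 :=
        Nat.cast_ne_zero.2 (Nat.choose_pos (by omega)).ne'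
      exact mul_ne_zero this (mul_ne_zero hf.1 hg.1)
    · intro i hi hia
      rcases lt_or_gt_of_ne hia with h | h
      · rw [iterate_eq_zero_of_le hg.2 (by omega : b + 1 ≤ a + b - i), mul_zero, smul_zero]
      · rw [iterate_eq_zero_of_le hf.2 h, zero_mul, smul_zero]
    · intro h
      exact absurd (Finset.mem_range.2 (by omega)) h
  · rw [iterate_leibniz]
    refine Finset.sum_eq_zero fun i hi => ?_
    rw [Finset.mem_range] at hi
    rcases le_or_gt i a with h | h
    · rw [iterate_eq_zero_of_le hg.2 (by omega : b + 1 ≤ a + b + 1 - i), mul_zero, smul_zero]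
    · rw [iterate_eq_zero_of_le hf.2 h, zero_mul, smul_zero]

theorem hasDeg_zero_iff {D : Derivation k A A} {f : A} : HasDeg D f 0 ↔ f ≠ 0 ∧ D f = 0 := Iff.rfl

theorem HasDeg.pow {D : Derivation k A A} {f : A} {a : ℕ} (hf : HasDeg D f a) (N : ℕ) :
    HasDeg D (f ^ N) (N * a) := by
  induction N with
  | zero => simp [hasDeg_zero_iff]
  | succ N ih =>
    rw [pow_succ, Nat.succ_mul]
    exact ih.mul hf

theorem HasDeg.map_iff {D : Derivation k A A} {f : A} {a : ℕ} (hf : HasDeg D (D f) a) :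
    HasDeg D f (a + 1) := hf

theorem HasDeg.add_of_map_eq_zero {D : Derivation k A A} {f c : A} {a : ℕ}
    (hf : HasDeg D f (a + 1)) (hc : D c = 0) : HasDeg D (f + c) (a + 1) := by
  apply HasDeg.map_iff
  rw [map_add, hc, add_zero]
  exact hf

theorem hasDeg_algebraMap_mul {D : Derivation k A A} {f c : A} {a : ℕ}
    (hf : HasDeg D f a) (hc : D c = 0) (h0 : c ≠ 0) : HasDeg D (c * f) a := by
  have := (hasDeg_zero_iff.2 ⟨h0, hc⟩).mul hf
  rwa [zero_add] at this

/-- Factorial closedness of the kernel: two natural degrees with sum `0` both vanish. Most later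
arguments show that a product is killed and then split it. -/
theorem map_eq_zero_of_mul {D : Derivation k A A} {f g : A} (hf : f ∈ nil D) (hg : g ∈ nil D)
    (h0 : f * g ≠ 0) (h : D (f * g) = 0) : D f = 0 ∧ D g = 0 := by
  obtain ⟨a, ha⟩ := exists_hasDeg hf (left_ne_zero_of_mul h0)
  obtain ⟨b, hb⟩ := exists_hasDeg hg (right_ne_zero_of_mul h0)
  have := (ha.mul hb).unique (hasDeg_zero_iff.2 ⟨h0, h⟩)
  obtain ⟨rfl, rfl⟩ : a = 0 ∧ b = 0 := by omega
  exact ⟨ha.2, hb.2⟩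

theorem map_eq_zero_of_pow {D : Derivation k A A} {f : A} {N : ℕ} (hf : f ∈ nil D)
    (hN : N ≠ 0) (h : D (f ^ N) = 0) : D f = 0 := by
  by_cases h0 : f = 0
  · rw [h0, map_zero]
  obtain ⟨N, rfl⟩ := Nat.exists_eq_succ_of_ne_zero hN
  rw [Nat.succ_eq_add_one, pow_succ'] at h
  exact (map_eq_zero_of_mul hf (pow_mem hf N) (mul_ne_zero h0 (pow_ne_zero _ h0)) h).1

theorem map_pow_eq_zero {D : Derivation k A A} {f : A} (h : D f = 0) (N : ℕ) : D (f ^ N) = 0 := by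
  rw [Derivation.leibniz_pow, h, smul_zero, smul_zero]

theorem map_mul_eq_zero {D : Derivation k A A} {f g : A} (hf : D f = 0) (hg : D g = 0) :
    D (f * g) = 0 := by
  rw [Derivation.leibniz, hf, hg, smul_zero, smul_zero, add_zero]

theorem iterate_mul_of_map_eq_zero {D : Derivation k A A} {c : A} (hc : D c = 0) (f : A) (N : ℕ) :
    D^[N] (c * f) = c * D^[N] f := by
  induction N generalizing f with
  | zero => rfl
  | succ N ih =>
    rw [Function.iterate_succ_apply, Derivation.leibniz, hc, smul_zero, add_zero, smul_eq_mul, ih,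
      Function.iterate_succ_apply]

theorem mem_nil_of_mul_mem {D : Derivation k A A} {c f : A} (hc : D c = 0) (h0 : c ≠ 0)
    (h : c * f ∈ nil D) : f ∈ nil D := by
  obtain ⟨N, hN⟩ := h
  rw [iterate_mul_of_map_eq_zero hc] at hN
  exact ⟨N, (mul_eq_zero.1 hN).resolve_left h0⟩

/-- A locally nilpotent derivation killing `c` and squaring into the ideal of
`h = u ^ N + c` has to kill `u`. -/
theorem map_eq_zero_of_pow_add {D : Derivation k A A} {u c q : A} {N : ℕ} (hN : 2 ≤ N)
    (hu : u ∈ nil D) (hc : D c = 0) (hc0 : c ≠ 0) (hq : q ∈ nil D)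
    (h : D (u ^ N + c) ^ 2 = (u ^ N + c) * q) : D u = 0 := by
  have : CharZero A := charZero_of_injective_algebraMap (algebraMap k A).injective
  by_contra hDu
  set g := u ^ N + c with hg
  obtain ⟨b, hb⟩ := exists_hasDeg (map_mem_nil hu) hDu
  have hub := hb.map_iff
  have hgb : HasDeg D g (N * (b + 1)) := by
    have h1 : N * (b + 1) = (N * (b + 1) - 1) + 1 := by
      have : 0 < N * (b + 1) := by positivity
      omega
    rw [h1]
    apply HasDeg.add_of_map_eq_zero _ hc
    rw [← h1]
    exact hub.pow N
  have hDg : u * D g = N * u ^ N * D u := by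
    rw [hg, map_add, hc, add_zero, Derivation.leibniz_pow, nsmul_eq_mul, smul_eq_mul]
    obtain ⟨M, rfl⟩ : ∃ M, N = M + 1 := ⟨N - 1, by omega⟩
    rw [Nat.add_sub_cancel]
    ring
  -- Modulo `g` one has `u ^ N = -c`, so `u * D g` is `-N * c * D u`; squaring and using that `g`
  -- divides `D g ^ 2` shows that `g` divides `(N * c * D u) ^ 2`.
  have key : (N * c) ^ 2 * D u ^ 2 = g * (u ^ 2 * q - N ^ 2 * (g - 2 * c) * D u ^ 2) := by
    have h2 : u ^ N = g - c := by rw [hg]; ring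
    have h3 : u ^ 2 * D g ^ 2 = (N * (g - c) * D u) ^ 2 := by
      rw [← h2, ← hDg]; ring
    rw [h] at h3
    linear_combination (-1 : A) * h3
  have hNc : (N * c : A) ≠ 0 := mul_ne_zero (Nat.cast_ne_zero.2 (by omega)) hc0
  have hDNc : D (N * c : A) = 0 := by
    rw [Derivation.leibniz, hc, Derivation.map_natCast, smul_zero, smul_zero, add_zero]
  have hl : HasDeg D ((N * c) ^ 2 * D u ^ 2) (2 * b) :=
    hasDeg_algebraMap_mul (hb.pow 2) (map_pow_eq_zero hDNc 2) (pow_ne_zero _ hNc)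
  have hg' : g ∈ nil D := ⟨_, hgb.2⟩
  have hc' : c ∈ nil D := mem_nil_of_map_eq_zero hc
  have hq' : u ^ 2 * q - N ^ 2 * (g - 2 * c) * D u ^ 2 ∈ nil D := by
    have h2 : (2 : A) ∈ nil D := natCast_mem _ 2
    exact sub_mem (mul_mem (pow_mem hu 2) hq) (mul_mem (mul_mem (pow_mem (natCast_mem _ N) 2)
      (sub_mem hg' (mul_mem h2 hc'))) (pow_mem (map_mem_nil hu) 2))
  rw [key] at hl
  obtain ⟨e, he⟩ := exists_hasDeg hq' (right_ne_zero_of_mul hl.ne_zero)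
  -- Comparing degrees gives `N * (b + 1) + e = 2 * b`, impossible for `N ≥ 2`.
  have := (hgb.mul he).unique hl
  nlinarith

/-- If a derivation `T` kills the homogeneous elements of the kernel of a homogeneous locally
nilpotent derivation `D`, then `T` is proportional to `D`. -/
theorem proportional_of_kills_kernel {Γ : Type*} [AddCommGroup Γ] (L : Γ → Submodule k A)
    (h1 : (1 : A) ∈ L 0) (hmul : ∀ {γ γ' u v}, u ∈ L γ → v ∈ L γ' → u * v ∈ L (γ + γ'))
    (D T : Derivation k A A) (δ : Γ) (hD : ∀ {γ u}, u ∈ L γ → D u ∈ L (γ + δ))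
    (hnil : ∀ {γ u}, u ∈ L γ → u ∈ nil D)
    (hT : ∀ {γ u}, u ∈ L γ → D u = 0 → T u = 0)
    {γ γ' : Γ} {u v : A} (hu : u ∈ L γ) (hv : v ∈ L γ') : T u * D v = T v * D u := by
  have : CharZero A := charZero_of_injective_algebraMap (algebraMap k A).injective
  have hpow : ∀ {γ u}, u ∈ L γ → ∀ N : ℕ, u ^ N ∈ L (N • γ) := by
    intro γ u hu N
    induction N with
    | zero => simpa using h1
    | succ N ih => rw [pow_succ, succ_nsmul]; exact hmul ih hu
  have hiter : ∀ {γ u}, u ∈ L γ → ∀ N : ℕ, D^[N] u ∈ L (γ + N • δ) := by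
    intro γ u hu N
    induction N with
    | zero => simpa using hu
    | succ N ih =>
      rw [Function.iterate_succ_apply', succ_nsmul, ← add_assoc]
      exact hD ih
  -- Such an `r` is a homogeneous local slice. If there is none, `D` vanishes on every homogeneous
  -- element: otherwise an iterate of `D` would produce a slice.
  by_cases hex : ∃ ρ r, r ∈ L ρ ∧ D r ≠ 0 ∧ D (D r) = 0
  · obtain ⟨ρ, r, hr, hDr, hDDr⟩ := hex
    have key : ∀ (a : ℕ) {γ : Γ} {u : A}, u ∈ L γ → D^[a] u = 0 → D r * T u = T r * D u := by
      intro a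
      induction a with
      | zero =>
        intro γ u _ h
        have h : u = 0 := h
        rw [h, map_zero, map_zero, mul_zero, mul_zero]
      | succ a ih =>
        intro γ u hu h
        rcases Nat.eq_zero_or_pos a with rfl | ha
        · have h : D u = 0 := h
          rw [h, hT hu h, mul_zero, mul_zero]
        obtain ⟨c, rfl⟩ : ∃ c, a = c + 1 := ⟨a - 1, by omega⟩
        set p := D r with hp
        set q := D^[c + 1] u with hq
        have hDq : D q = 0 := by rw [hq, ← Function.iterate_succ_apply' D]; exact h
        have hTq : T q = 0 := hT (hiter hu _) hDq
        have hTp : T p = 0 := hT (hD hr) hDDr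
        have hfact : ((c + 1).factorial : A) ≠ 0 := Nat.cast_ne_zero.2 (Nat.factorial_ne_zero _)
        have hiterr : ∀ N : ℕ, D^[N] (r ^ N) = N.factorial * p ^ N := by
          intro N
          induction N with
          | zero => simp
          | succ N ihN =>
            rw [Function.iterate_succ_apply, Derivation.leibniz_pow, Nat.add_sub_cancel,
              smul_eq_mul, mul_comm (r ^ N), ← hp, ← Nat.cast_smul_eq_nsmul A, smul_eq_mul,
              ← mul_assoc, iterate_mul_of_map_eq_zero, ihN, Nat.factorial_succ]
            · push_cast; ring
            · rw [Derivation.leibniz, hDDr, Derivation.map_natCast, smul_zero, smul_zero, add_zero]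
        -- The top term of `u`, as a polynomial in the slice `r`, is removed after clearing
        -- denominators. The difference is homogeneous and has smaller degree, so the induction
        -- hypothesis applies to it.
        let v := (c + 1).factorial * p ^ (c + 1) * u - q * r ^ (c + 1)
        have hvL : v ∈ L ((c + 1) • (ρ + δ) + γ) := by
          apply Submodule.sub_mem
          · rw [mul_assoc, ← nsmul_eq_mul]
            exact nsmul_mem (hmul (hpow (hD hr) _) hu) _
          · have := hmul (hiter hu (c + 1)) (hpow hr (c + 1))
            convert this using 1
            rw [smul_add, add_comm ((c + 1) • ρ), add_right_comm, add_comm _ γ]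
        have hDp : D ((c + 1).factorial * p ^ (c + 1)) = 0 := by
          rw [Derivation.leibniz, map_pow_eq_zero hDDr, Derivation.map_natCast, smul_zero,
            smul_zero, add_zero]
        have hTp' : T ((c + 1).factorial * p ^ (c + 1)) = 0 := by
          rw [Derivation.leibniz, map_pow_eq_zero hTp, Derivation.map_natCast, smul_zero,
            smul_zero, add_zero]
        have hDv : D^[c + 1] v = 0 := by
          rw [iterate_map_sub, iterate_mul_of_map_eq_zero hDp, iterate_mul_of_map_eq_zero hDq,
            hiterr, ← hq]
          ring
        have hv := ih hvL hDv
        simp only [v, map_sub, Derivation.leibniz, hDp, hTp', hDq, hTq,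
          Derivation.leibniz_pow, Nat.add_sub_cancel, smul_eq_mul, nsmul_eq_mul, ← hp] at hv
        have h3 : ((c + 1).factorial * p ^ (c + 1)) * (p * T u) =
            ((c + 1).factorial * p ^ (c + 1)) * (T r * D u) := by
          linear_combination hv
        exact mul_left_cancel₀ (mul_ne_zero hfact (pow_ne_zero _ hDr)) h3
    obtain ⟨a, ha⟩ := hnil hu
    obtain ⟨b, hb⟩ := hnil hv
    have e1 := key a hu ha
    have e2 := key b hv hb
    apply mul_left_cancel₀ hDr
    linear_combination D v * e1 - D u * e2
  · have hz : ∀ {γ u}, u ∈ L γ → D u = 0 := by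
      intro γ u hu
      by_contra h
      obtain ⟨a, ha⟩ := exists_hasDeg (map_mem_nil (hnil hu)) h
      refine hex ⟨_, D^[a] u, hiter hu a, ?_, ?_⟩
      · rw [← Function.iterate_succ_apply' D, Function.iterate_succ_apply]; exact ha.1
      · rw [← Function.iterate_succ_apply' D, ← Function.iterate_succ_apply' D,
          Function.iterate_succ_apply]
        exact ha.2
    rw [hz hu, hz hv, mul_zero, mul_zero]

end LocallyNilpotent

/-- In characteristic zero a derivation vanishes on the elements algebraic over its kernel. -/
theorem derivation_eq_zero_of_isAlgebraic {k R A : Type*} [Field k] [CharZero k] [CommRing R]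
    [IsDomain R] [Algebra k R] [AddCommGroup A] [Module k A] [Module R A]
    [IsScalarTower k R A]
    (hA : ∀ (c : R) (a : A), c • a = 0 → c = 0 ∨ a = 0)
    (D : Derivation k R A) (K : Subalgebra k R)
    (hK : ∀ c ∈ K, D c = 0) {g : R} (hg : IsAlgebraic K g) : D g = 0 := by
  have hcz : CharZero R := charZero_of_injective_algebraMap (algebraMap k R).injective
  have hderiv : ∀ p : Polynomial K,
      D (Polynomial.aeval g p) = Polynomial.aeval g (Polynomial.derivative p) • D g := by
    intro p
    induction p using Polynomial.induction_on' with
    | add p q hp hq => rw [map_add, map_add, hp, hq, map_add, map_add, add_smul]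
    | monomial N c =>
      have hc : D (algebraMap K R c) = 0 := hK _ c.2
      rw [Polynomial.aeval_monomial, Derivation.leibniz, hc, smul_zero, add_zero,
        Derivation.leibniz_pow, Polynomial.derivative_monomial, Polynomial.aeval_monomial]
      simp only [map_mul, map_natCast, ← Nat.cast_smul_eq_nsmul R, smul_smul]
      congr 1
      ring
  classical
  obtain ⟨p, hp0, hp⟩ := hg
  by_contra hD
  -- If `D g ≠ 0`, applying `D` to `p(g) = 0` gives `p'(g) = 0`. By induction on the degree `p' =
  -- 0`, so `p` is constant in characteristic zero, hence zero.
  have main : ∀ (N : ℕ) (p : Polynomial K), p.natDegree ≤ N → Polynomial.aeval g p = 0 → p = 0 := by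
    intro N
    induction N with
    | zero =>
      intro p hN hp
      rw [Polynomial.eq_C_of_natDegree_le_zero hN] at hp ⊢
      rw [Polynomial.aeval_C] at hp
      rw [(FaithfulSMul.algebraMap_eq_zero_iff K R).1 hp, map_zero]
    | succ N ih =>
      intro p hN hp
      have h1 := hderiv p
      rw [hp, map_zero] at h1
      have h2 := (hA _ _ h1.symm).resolve_right hD
      have h3 := ih _ ((Polynomial.natDegree_derivative_le p).trans (by omega)) h2
      have h4 := Polynomial.derivative_eq_zero.1 h3
      rw [Polynomial.eq_C_of_natDegree_le_zero h4.le] at hp ⊢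
      rw [Polynomial.aeval_C] at hp
      rw [(FaithfulSMul.algebraMap_eq_zero_iff K R).1 hp, map_zero]
  exact hp0 (main _ p le_rfl hp)

/-! ### Weights, homogeneous components and leading forms in a monoid algebra. -/

section Weights

variable {k M Γ : Type*} [Field k] [AddCommGroup M] [AddCommGroup Γ] [LinearOrder Γ]
  [IsOrderedAddMonoid Γ]

theorem mem_supported_iff {S : Set M} {f : AddMonoidAlgebra k M} :
    f ∈ supported k k S ↔ ∀ m, f.coeff m ≠ 0 → m ∈ S := by
  rw [AddMonoidAlgebra.mem_supported]
  simp only [Set.subset_def, SetLike.mem_coe, Finsupp.mem_support_iff]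

theorem supported_induction {S : Set M} {p : AddMonoidAlgebra k M → Prop} (h0 : p 0)
    (hadd : ∀ f g, p f → p g → p (f + g)) (hs : ∀ m ∈ S, ∀ c, p (AddMonoidAlgebra.single m c))
    {f : AddMonoidAlgebra k M} (hf : f ∈ supported k k S) : p f := by
  rw [mem_supported_iff] at hf
  rw [← AddMonoidAlgebra.sum_coeff_single f, Finsupp.sum]
  refine Finset.sum_induction _ p hadd h0 fun m hm => hs m (hf m (Finsupp.mem_support_iff.1 hm)) _

theorem single_mem_supported {S : Set M} {m : M} (hm : m ∈ S) (c : k) :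
    AddMonoidAlgebra.single m c ∈ supported k k S := by
  classical
  rw [mem_supported_iff]
  intro m' h
  rw [AddMonoidAlgebra.coeff_single, Finsupp.single_apply] at h
  split_ifs at h with h1
  · exact h1 ▸ hm
  · exact absurd rfl h

theorem mul_mem_supported {S S' S'' : Set M} (h : ∀ a ∈ S, ∀ b ∈ S', a + b ∈ S'')
    {f g : AddMonoidAlgebra k M} (hf : f ∈ supported k k S) (hg : g ∈ supported k k S') :
    f * g ∈ supported k k S'' := by
  refine supported_induction (p := fun f => f * g ∈ supported k k S'') ?_ ?_ ?_ hf
  · rw [zero_mul]; exact zero_mem _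
  · intro f f' h1 h2
    rw [add_mul]; exact add_mem h1 h2
  · intro m hm c
    refine supported_induction (p := fun g => AddMonoidAlgebra.single m c * g ∈ supported k k S'')
      ?_ ?_ ?_ hg
    · rw [mul_zero]; exact zero_mem _
    · intro f f' h1 h2
      rw [mul_add]; exact add_mem h1 h2
    · intro m' hm' c'
      rw [AddMonoidAlgebra.single_mul_single]
      exact single_mem_supported (h _ hm _ hm') _

/-- The elements all of whose monomials have weight at most `γ`. -/
noncomputable def wle (k : Type*) [Field k] (w : M →+ Γ) (γ : Γ) :
    Submodule k (AddMonoidAlgebra k M) :=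
  supported k k {m | w m ≤ γ}

/-- The elements that are homogeneous of weight `γ`. -/
noncomputable def whom (k : Type*) [Field k] (w : M →+ Γ) (γ : Γ) :
    Submodule k (AddMonoidAlgebra k M) :=
  supported k k {m | w m = γ}

theorem mem_wle {w : M →+ Γ} {γ : Γ} {f : AddMonoidAlgebra k M} :
    f ∈ wle k w γ ↔ ∀ m, f.coeff m ≠ 0 → w m ≤ γ := mem_supported_iff

theorem mem_whom {w : M →+ Γ} {γ : Γ} {f : AddMonoidAlgebra k M} :
    f ∈ whom k w γ ↔ ∀ m, f.coeff m ≠ 0 → w m = γ := mem_supported_iff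

theorem single_mem_whom (w : M →+ Γ) (m : M) (c : k) :
    AddMonoidAlgebra.single m c ∈ whom k w (w m) :=
  single_mem_supported (S := {m' | w m' = w m}) rfl c

theorem mul_mem_wle {w : M →+ Γ} {γ γ' : Γ} {f g : AddMonoidAlgebra k M} (hf : f ∈ wle k w γ)
    (hg : g ∈ wle k w γ') : f * g ∈ wle k w (γ + γ') :=
  mul_mem_supported (fun a ha b hb => by
    change w (a + b) ≤ _
    rw [map_add]; exact add_le_add ha hb) hf hg

theorem mul_mem_whom {w : M →+ Γ} {γ γ' : Γ} {f g : AddMonoidAlgebra k M} (hf : f ∈ whom k w γ)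
    (hg : g ∈ whom k w γ') : f * g ∈ whom k w (γ + γ') :=
  mul_mem_supported (fun a ha b hb => by
    change w a = _ at ha
    change w b = _ at hb
    change w (a + b) = _
    rw [map_add, ha, hb]) hf hg

theorem wle_mono {w : M →+ Γ} {γ γ' : Γ} (h : γ ≤ γ') {f : AddMonoidAlgebra k M}
    (hf : f ∈ wle k w γ) : f ∈ wle k w γ' :=
  mem_wle.2 fun m hm => (mem_wle.1 hf m hm).trans h

theorem whom_le_wle {w : M →+ Γ} {γ : Γ} {f : AddMonoidAlgebra k M}
    (hf : f ∈ whom k w γ) : f ∈ wle k w γ :=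
  mem_wle.2 fun m hm => (mem_whom.1 hf m hm).le

theorem one_mem_whom {w : M →+ Γ} : (1 : AddMonoidAlgebra k M) ∈ whom k w 0 := by
  rw [AddMonoidAlgebra.one_def]
  exact single_mem_supported (by simp) _

theorem pow_mem_whom {w : M →+ Γ} {γ : Γ} {f : AddMonoidAlgebra k M} (hf : f ∈ whom k w γ)
    (N : ℕ) : f ^ N ∈ whom k w (N • γ) := by
  induction N with
  | zero => rw [pow_zero, zero_smul]; exact one_mem_whom
  | succ N ih => rw [pow_succ, succ_nsmul]; exact mul_mem_whom ih hf

theorem pow_mem_wle {w : M →+ Γ} {γ : Γ} {f : AddMonoidAlgebra k M} (hf : f ∈ wle k w γ)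
    (N : ℕ) : f ^ N ∈ wle k w (N • γ) := by
  induction N with
  | zero => rw [pow_zero, zero_smul]; exact whom_le_wle one_mem_whom
  | succ N ih => rw [pow_succ, succ_nsmul]; exact mul_mem_wle ih hf

/-- The homogeneous component of weight `γ`. -/
noncomputable def proj (w : M →+ Γ) (γ : Γ) : AddMonoidAlgebra k M →ₗ[k] AddMonoidAlgebra k M where
  toFun f := .ofCoeff (f.coeff.filter fun m => w m = γ)
  map_add' f g := by rw [AddMonoidAlgebra.coeff_add, Finsupp.filter_add]; rfl
  map_smul' c f := by
    rw [AddMonoidAlgebra.coeff_smul, Finsupp.filter_smul]; rfl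

theorem coeff_proj (w : M →+ Γ) (γ : Γ) (f : AddMonoidAlgebra k M) (m : M) :
    (proj w γ f).coeff m = if w m = γ then f.coeff m else 0 := by
  change (f.coeff.filter fun m => w m = γ) m = _
  rw [Finsupp.filter_apply]

theorem proj_mem_whom (w : M →+ Γ) (γ : Γ) (f : AddMonoidAlgebra k M) :
    proj w γ f ∈ whom k w γ := by
  rw [mem_whom]
  intro m hm
  rw [coeff_proj] at hm
  by_contra h
  exact hm (if_neg h)

theorem proj_of_mem_whom {w : M →+ Γ} {γ : Γ} {f : AddMonoidAlgebra k M} (hf : f ∈ whom k w γ) :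
    proj w γ f = f := by
  ext m
  rw [coeff_proj]
  split_ifs with h
  · rfl
  · by_contra h1
    exact h (mem_whom.1 hf m (Ne.symm h1))

theorem proj_of_mem_whom_ne {w : M →+ Γ} {γ γ' : Γ} {f : AddMonoidAlgebra k M}
    (hf : f ∈ whom k w γ') (hne : γ' ≠ γ) : proj w γ f = 0 := by
  ext m
  rw [coeff_proj]
  split_ifs with h
  · by_contra h1
    exact hne ((mem_whom.1 hf m h1).symm.trans h)
  · rfl

theorem proj_of_mem_wle_lt {w : M →+ Γ} {γ γ' : Γ} {f : AddMonoidAlgebra k M}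
    (hf : f ∈ wle k w γ') (hne : γ' < γ) : proj w γ f = 0 := by
  ext m
  rw [coeff_proj]
  split_ifs with h
  · by_contra h1
    exact absurd ((mem_wle.1 hf m h1)) (by rw [h]; exact not_le.2 hne)
  · rfl

theorem coeff_proj_ne_zero {w : M →+ Γ} {γ : Γ} {f : AddMonoidAlgebra k M} {m : M}
    (h : (proj w γ f).coeff m ≠ 0) : f.coeff m ≠ 0 := by
  rw [coeff_proj] at h
  split_ifs at h with h1
  · exact h
  · exact absurd rfl h

theorem proj_whom_mul {w : M →+ Γ} {γ γ' : Γ} {u : AddMonoidAlgebra k M} (hu : u ∈ whom k w γ)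
    (f : AddMonoidAlgebra k M) : proj w (γ + γ') (u * f) = u * proj w γ' f := by
  induction f using AddMonoidAlgebra.induction_linear with
  | zero => simp
  | add f g hf hg => rw [mul_add, map_add, hf, hg, map_add, mul_add]
  | single m c =>
    have hs : AddMonoidAlgebra.single m c ∈ whom k w (w m) := single_mem_whom w m c
    have := mul_mem_whom hu hs
    by_cases h : w m = γ'
    · rw [← h, proj_of_mem_whom this, proj_of_mem_whom hs]
    · rw [proj_of_mem_whom_ne this (fun h' => h (add_left_cancel h')), proj_of_mem_whom_ne hs h,
        mul_zero]

theorem proj_mul {w : M →+ Γ} {γ γ' : Γ} {f g : AddMonoidAlgebra k M} (hf : f ∈ wle k w γ)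
    (hg : g ∈ wle k w γ') : proj w (γ + γ') (f * g) = proj w γ f * proj w γ' g := by
  refine supported_induction
    (p := fun f => proj w (γ + γ') (f * g) = proj w γ f * proj w γ' g) ?_ ?_ ?_ hf
  · simp
  · intro f f' h1 h2
    rw [add_mul, map_add, h1, h2, map_add, add_mul]
  · intro m hm c
    have hs : AddMonoidAlgebra.single m c ∈ whom k w (w m) := single_mem_whom w m c
    rcases eq_or_lt_of_le (show w m ≤ γ from hm) with h | h
    · rw [h] at hs
      rw [proj_whom_mul hs, proj_of_mem_whom hs]
    · rw [proj_of_mem_whom_ne hs h.ne, zero_mul]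
      exact proj_of_mem_wle_lt (mul_mem_wle (whom_le_wle hs) hg) (add_lt_add_left h γ')

theorem proj_pow {w : M →+ Γ} {γ : Γ} {f : AddMonoidAlgebra k M} (hf : f ∈ wle k w γ) (N : ℕ) :
    proj w (N • γ) (f ^ N) = proj w γ f ^ N := by
  induction N with
  | zero => rw [pow_zero, pow_zero, zero_smul, proj_of_mem_whom one_mem_whom]
  | succ N ih => rw [pow_succ, pow_succ, succ_nsmul, proj_mul (pow_mem_wle hf N) hf, ih]

theorem exists_top {w : M →+ Γ} {f : AddMonoidAlgebra k M} (hf : f ≠ 0) :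
    ∃ γ, f ∈ wle k w γ ∧ proj w γ f ≠ 0 := by
  classical
  have hne : (f.coeff.support.image w).Nonempty := by
    rw [Finset.image_nonempty, Finsupp.support_nonempty_iff]
    exact fun h => hf (AddMonoidAlgebra.coeff_eq_zero.1 h)
  obtain ⟨m, hm, hmax⟩ := Finset.mem_image.1 (Finset.max'_mem _ hne)
  refine ⟨w m, mem_wle.2 fun m' hm' => ?_, fun h => ?_⟩
  · rw [hmax]
    exact Finset.le_max' _ _ (Finset.mem_image_of_mem _ (Finsupp.mem_support_iff.2 hm'))
  · have := coeff_proj w (w m) f m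
    rw [h, if_pos rfl] at this
    exact Finsupp.mem_support_iff.1 hm this.symm

/-- The Euler derivation attached to an additive character. -/
noncomputable def euler (χ : M →+ k) :
    Derivation k (AddMonoidAlgebra k M) (AddMonoidAlgebra k M) :=
  let l : AddMonoidAlgebra k M →ₗ[k] AddMonoidAlgebra k M :=
    { toFun := fun f => .ofCoeff (Finsupp.onFinset f.coeff.support (fun m => χ m * f.coeff m)
        fun m hm => Finsupp.mem_support_iff.2 (right_ne_zero_of_mul hm))
      map_add' := fun f g => by
        ext m
        exact mul_add (χ m) (f.coeff m) (g.coeff m)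
      map_smul' := fun c f => by
        ext m
        exact mul_left_comm (χ m) c (f.coeff m) }
  have hl : ∀ m c, l (AddMonoidAlgebra.single m c) = χ m • AddMonoidAlgebra.single m c := by
    classical
    intro m c
    ext m'
    change χ m' * (AddMonoidAlgebra.single m c).coeff m' =
      χ m * (AddMonoidAlgebra.single m c).coeff m'
    rw [AddMonoidAlgebra.coeff_single, Finsupp.single_apply]
    split_ifs with h
    · rw [h]
    · rw [mul_zero, mul_zero]
  Derivation.mk' l <| by
    intro f g
    induction f using AddMonoidAlgebra.induction_linear with
    | zero => simp
    | add f f' h1 h2 =>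
      rw [add_mul, map_add, h1, h2, map_add, add_smul, smul_add]
      abel
    | single m c =>
      induction g using AddMonoidAlgebra.induction_linear with
      | zero => simp
      | add f f' h1 h2 =>
        rw [mul_add, map_add, h1, h2, map_add, add_smul, smul_add]
        abel
      | single m' c' =>
        rw [AddMonoidAlgebra.single_mul_single, hl, hl, hl, map_add, smul_eq_mul, smul_eq_mul,
          mul_smul_comm, mul_smul_comm, AddMonoidAlgebra.single_mul_single,
          AddMonoidAlgebra.single_mul_single, add_smul, add_comm m' m, mul_comm c' c, add_comm]

theorem coeff_euler (χ : M →+ k) (f : AddMonoidAlgebra k M) (m : M) :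
    (euler χ f).coeff m = χ m * f.coeff m := rfl

theorem euler_single (χ : M →+ k) (m : M) (c : k) :
    euler χ (AddMonoidAlgebra.single m c) = χ m • AddMonoidAlgebra.single m c := by
  classical
  ext m'
  rw [coeff_euler, AddMonoidAlgebra.coeff_smul, AddMonoidAlgebra.coeff_single, Finsupp.smul_apply,
    Finsupp.single_apply, smul_eq_mul]
  split_ifs with h
  · rw [h]
  · rw [mul_zero, mul_zero]

theorem euler_mem_supported (χ : M →+ k) {S : Set M} {f : AddMonoidAlgebra k M}
    (hf : f ∈ supported k k S) : euler χ f ∈ supported k k S := by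
  rw [mem_supported_iff] at *
  exact fun m hm => hf m (right_ne_zero_of_mul hm)

theorem proj_euler (w : M →+ Γ) (γ : Γ) (χ : M →+ k) (f : AddMonoidAlgebra k M) :
    proj w γ (euler χ f) = euler χ (proj w γ f) := by
  ext m
  rw [coeff_proj, coeff_euler, coeff_euler, coeff_proj, mul_ite, mul_zero]

end Weights

/-! ### Derivations of the Laurent ring and their leading parts. -/

section Laurent

variable (k : Type*) [Field k]

/-- The ring of Laurent polynomials in `x, s, t`. -/
abbrev Lau : Type _ := AddMonoidAlgebra k (ℤ × ℤ × ℤ)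

variable {k}

/-- The monomial with exponent vector `m`. -/
noncomputable def mon (m : ℤ × ℤ × ℤ) : Lau k := AddMonoidAlgebra.single m 1

theorem mon_mul (m m' : ℤ × ℤ × ℤ) : (mon m * mon m' : Lau k) = mon (m + m') := by
  rw [mon, mon, AddMonoidAlgebra.single_mul_single, one_mul]; rfl

theorem mon_zero : (mon 0 : Lau k) = 1 := rfl

theorem mon_mul_neg (m : ℤ × ℤ × ℤ) : (mon m * mon (-m) : Lau k) = 1 := by
  rw [mon_mul, add_neg_cancel, mon_zero]

theorem mon_ne_zero (m : ℤ × ℤ × ℤ) : (mon m : Lau k) ≠ 0 :=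
  left_ne_zero_of_mul (a := mon m) (b := mon (-m)) (by rw [mon_mul_neg]; exact one_ne_zero)

theorem mon_pow (m : ℤ × ℤ × ℤ) (N : ℕ) : (mon m ^ N : Lau k) = mon (N • m) := by
  rw [mon, AddMonoidAlgebra.single_pow, one_pow]; rfl

theorem single_eq_smul_mon (m : ℤ × ℤ × ℤ) (c : k) :
    AddMonoidAlgebra.single m c = c • (mon m : Lau k) := by
  rw [mon, AddMonoidAlgebra.smul_single, smul_eq_mul, mul_one]

theorem coeff_mon_mul (m m' : ℤ × ℤ × ℤ) (f : Lau k) :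
    (mon m * f).coeff m' = f.coeff (m' - m) := by
  classical
  induction f using AddMonoidAlgebra.induction_linear with
  | zero => simp
  | add f g hf hg => rw [mul_add, AddMonoidAlgebra.coeff_add, AddMonoidAlgebra.coeff_add,
      Finsupp.add_apply, hf, hg, Finsupp.add_apply]
  | single n c =>
    rw [mon, AddMonoidAlgebra.single_mul_single, one_mul, AddMonoidAlgebra.coeff_single,
      AddMonoidAlgebra.coeff_single, Finsupp.single_apply, Finsupp.single_apply]
    congr 1
    rw [eq_sub_iff_add_eq', eq_iff_iff]

theorem coeff_mon (m m' : ℤ × ℤ × ℤ) : (mon m : Lau k).coeff m' = if m = m' then 1 else 0 := by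
  rw [mon, AddMonoidAlgebra.coeff_single, Finsupp.single_apply]

/-- The exponent of `x`, as an additive character. -/
def chi1 (k : Type*) [Field k] : ℤ × ℤ × ℤ →+ k :=
  (Int.castAddHom k).comp (AddMonoidHom.fst ℤ (ℤ × ℤ))

/-- The exponent of `s`, as an additive character. -/
def chi2 (k : Type*) [Field k] : ℤ × ℤ × ℤ →+ k :=
  (Int.castAddHom k).comp ((AddMonoidHom.fst ℤ ℤ).comp (AddMonoidHom.snd ℤ (ℤ × ℤ)))

/-- The exponent of `t`, as an additive character. -/
def chi3 (k : Type*) [Field k] : ℤ × ℤ × ℤ →+ k :=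
  (Int.castAddHom k).comp ((AddMonoidHom.snd ℤ ℤ).comp (AddMonoidHom.snd ℤ (ℤ × ℤ)))

@[simp] theorem chi1_apply (m : ℤ × ℤ × ℤ) : chi1 k m = (m.1 : k) := rfl
@[simp] theorem chi2_apply (m : ℤ × ℤ × ℤ) : chi2 k m = (m.2.1 : k) := rfl
@[simp] theorem chi3_apply (m : ℤ × ℤ × ℤ) : chi3 k m = (m.2.2 : k) := rfl

theorem euler_mon (χ : ℤ × ℤ × ℤ →+ k) (m : ℤ × ℤ × ℤ) :
    euler χ (mon m : Lau k) = χ m • mon m := euler_single χ m 1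

/-- The variable `x`. -/
noncomputable def vx (k : Type*) [Field k] : Lau k := mon (1, 0, 0)

/-- The variable `s`. -/
noncomputable def vs (k : Type*) [Field k] : Lau k := mon (0, 1, 0)

/-- The variable `t`. -/
noncomputable def vt (k : Type*) [Field k] : Lau k := mon (0, 0, 1)

theorem vx_ne_zero : vx k ≠ 0 := mon_ne_zero _
theorem vs_ne_zero : vs k ≠ 0 := mon_ne_zero _
theorem vt_ne_zero : vt k ≠ 0 := mon_ne_zero _

theorem vx_pow (N : ℕ) : vx k ^ N = mon ((N : ℤ), 0, 0) := by
  rw [vx, mon_pow]; congr 1; ext <;> simp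
theorem vs_pow (N : ℕ) : vs k ^ N = mon (0, (N : ℤ), 0) := by
  rw [vs, mon_pow]; congr 1; ext <;> simp
theorem vt_pow (N : ℕ) : vt k ^ N = mon (0, 0, (N : ℤ)) := by
  rw [vt, mon_pow]; congr 1; ext <;> simp

/-- For a derivation `E` the logarithmic derivative `m ↦ mon (-m) * E (mon m)` is additive in the
exponent, so it vanishes once it does on the three basis vectors. -/
theorem derivation_ext {D D' : Derivation k (Lau k) (Lau k)} (hx : D (vx k) = D' (vx k))
    (hs : D (vs k) = D' (vs k)) (ht : D (vt k) = D' (vt k)) : D = D' := by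
  let E := D - D'
  have hE : ∀ f, E f = D f - D' f := fun f => rfl
  let φ : ℤ × ℤ × ℤ →+ Lau k := AddMonoidHom.mk' (fun m => mon (-m) * E (mon m)) <| by
    intro m m'
    rw [← mon_mul, Derivation.leibniz, smul_eq_mul, smul_eq_mul, neg_add, ← mon_mul]
    linear_combination (mon (-m') * E (mon m') : Lau k) * mon_mul_neg (k := k) m +
      (mon (-m) * E (mon m) : Lau k) * mon_mul_neg (k := k) m'
  have hφ : φ = 0 := by
    have h1 : φ (1, 0, 0) = 0 := by
      change mon _ * E (vx k) = 0
      rw [hE, hx, sub_self, mul_zero]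
    have h2 : φ (0, 1, 0) = 0 := by
      change mon _ * E (vs k) = 0
      rw [hE, hs, sub_self, mul_zero]
    have h3 : φ (0, 0, 1) = 0 := by
      change mon _ * E (vt k) = 0
      rw [hE, ht, sub_self, mul_zero]
    ext1 ⟨a, b, c⟩
    have : ((a, b, c) : ℤ × ℤ × ℤ) = a • (1, 0, 0) + b • (0, 1, 0) + c • (0, 0, 1) := by
      ext <;> simp
    rw [this, map_add, map_add, map_zsmul, map_zsmul, map_zsmul, h1, h2, h3]
    simp
  have hm : ∀ m, E (mon m) = 0 := by
    intro m
    have h1 : mon (-m) * E (mon m) = 0 := DFunLike.congr_fun hφ m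
    exact (mul_eq_zero.1 h1).resolve_left (mon_ne_zero _)
  ext1 f
  rw [← sub_eq_zero, ← hE]
  induction f using AddMonoidAlgebra.induction_linear with
  | zero => exact map_zero _
  | add f g hf hg => rw [map_add, hf, hg, add_zero]
  | single m c => rw [single_eq_smul_mon, Derivation.map_smul, hm, smul_zero]

/-- The derivation of `Lau k` with prescribed logarithmic derivatives of the variables. -/
noncomputable def logDer (a b c : Lau k) : Derivation k (Lau k) (Lau k) :=
  a • euler (chi1 k) + b • euler (chi2 k) + c • euler (chi3 k)

theorem logDer_apply (a b c f : Lau k) : logDer a b c f =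
    a * euler (chi1 k) f + b * euler (chi2 k) f + c * euler (chi3 k) f := rfl

theorem logDer_vx (a b c : Lau k) : logDer a b c (vx k) = a * vx k := by
  simp [logDer_apply, vx, euler_mon]

theorem logDer_vs (a b c : Lau k) : logDer a b c (vs k) = b * vs k := by
  simp [logDer_apply, vs, euler_mon]

theorem logDer_vt (a b c : Lau k) : logDer a b c (vt k) = c * vt k := by
  simp [logDer_apply, vt, euler_mon]

theorem eq_logDer (D : Derivation k (Lau k) (Lau k)) : D = logDer
    (D (vx k) * mon (-(1, 0, 0))) (D (vs k) * mon (-(0, 1, 0))) (D (vt k) * mon (-(0, 0, 1))) := by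
  refine derivation_ext ?_ ?_ ?_
  · rw [logDer_vx, mul_assoc, mul_comm (mon _), vx, mon_mul_neg, mul_one]
  · rw [logDer_vs, mul_assoc, mul_comm (mon _), vs, mon_mul_neg, mul_one]
  · rw [logDer_vt, mul_assoc, mul_comm (mon _), vt, mon_mul_neg, mul_one]

/-- `D'` is the leading homogeneous part, of weight `δ`, of the derivation `D`. -/
def IsLeading {Γ : Type*} [AddCommGroup Γ] [LinearOrder Γ] (w : ℤ × ℤ × ℤ →+ Γ)
    (D D' : Derivation k (Lau k) (Lau k)) (δ : Γ) : Prop :=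
  ∀ {γ f}, f ∈ wle k w γ → D f ∈ wle k w (γ + δ) ∧ proj w (γ + δ) (D f) = D' (proj w γ f)

/-- Euler derivations preserve weights. So the leading part of `logDer a b c` is obtained by keeping
in `a, b, c` the components of the largest weight `δ` that occurs. -/
theorem exists_isLeading {Γ : Type*} [AddCommGroup Γ] [LinearOrder Γ] [IsOrderedAddMonoid Γ]
    (w : ℤ × ℤ × ℤ →+ Γ) {D : Derivation k (Lau k) (Lau k)} (hD : D ≠ 0) :
    ∃ D' δ, D' ≠ 0 ∧ IsLeading w D D' δ := by
  obtain ⟨a, b, c, rfl⟩ : ∃ a b c, D = logDer a b c := ⟨_, _, _, eq_logDer D⟩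
  obtain ⟨δ, ha, hb, hc, h⟩ : ∃ δ, a ∈ wle k w δ ∧ b ∈ wle k w δ ∧ c ∈ wle k w δ ∧
      (proj w δ a ≠ 0 ∨ proj w δ b ≠ 0 ∨ proj w δ c ≠ 0) := by
    classical
    have key : ∀ f : Lau k, f = 0 ∨ ∃ γ, f ∈ wle k w γ ∧ proj w γ f ≠ 0 := fun f =>
      (eq_or_ne f 0).imp_right exists_top
    -- One step in forming the maximum of the weights of `a, b, c`, where zero coefficients have no
    -- weight: `Z` says that all earlier ones vanish, `P γ` that they have weight at most `γ`, `Q γ`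
    -- that one of them attains `γ`.
    have join : ∀ (Z : Prop) (P Q : Γ → Prop) (f : Lau k), (∀ γ γ', γ ≤ γ' → P γ → P γ') →
        ((Z ∧ ∀ γ, P γ) ∨ ∃ γ, P γ ∧ Q γ) → (((Z ∧ f = 0) ∧ ∀ γ, P γ ∧ f ∈ wle k w γ) ∨
          ∃ γ, (P γ ∧ f ∈ wle k w γ) ∧ (Q γ ∨ proj w γ f ≠ 0)) := by
      intro Z P Q f hP h
      rcases h with h | ⟨γ, h1, h2⟩ <;> rcases key f with rfl | ⟨γ', h3, h4⟩
      · exact Or.inl ⟨⟨h.1, rfl⟩, fun γ => ⟨h.2 γ, zero_mem _⟩⟩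
      · exact Or.inr ⟨γ', ⟨h.2 _, h3⟩, Or.inr h4⟩
      · exact Or.inr ⟨γ, ⟨h1, zero_mem _⟩, Or.inl h2⟩
      · rcases le_total γ γ' with h | h
        · exact Or.inr ⟨γ', ⟨hP _ _ h h1, h3⟩, Or.inr h4⟩
        · exact Or.inr ⟨γ, ⟨h1, wle_mono h h3⟩, Or.inl h2⟩
    have h1 := join True (fun _ => True) (fun _ => False) a (fun _ _ _ _ => trivial)
      (Or.inl ⟨trivial, fun _ => trivial⟩)
    have h2 := join _ _ _ b (fun _ _ h h' => ⟨trivial, wle_mono h h'.2⟩) h1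
    have h3 := join _ _ _ c (fun _ _ h h' => ⟨⟨trivial, wle_mono h h'.1.2⟩, wle_mono h h'.2⟩) h2
    rcases h3 with ⟨⟨⟨⟨-, rfl⟩, rfl⟩, rfl⟩, -⟩ | ⟨γ, ⟨⟨⟨-, h4⟩, h5⟩, h6⟩, h7⟩
    · exfalso
      apply hD
      ext1 f
      simp [logDer_apply]
    · exact ⟨γ, h4, h5, h6, by tauto⟩
  refine ⟨logDer (proj w δ a) (proj w δ b) (proj w δ c), δ, ?_, ?_⟩
  · intro h0
    rcases h with h | h | h
    · have := logDer_vx (proj w δ a) (proj w δ b) (proj w δ c)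
      rw [h0] at this
      exact mul_ne_zero h vx_ne_zero this.symm
    · have := logDer_vs (proj w δ a) (proj w δ b) (proj w δ c)
      rw [h0] at this
      exact mul_ne_zero h vs_ne_zero this.symm
    · have := logDer_vt (proj w δ a) (proj w δ b) (proj w δ c)
      rw [h0] at this
      exact mul_ne_zero h vt_ne_zero this.symm
  · intro γ f hf
    have hf' : ∀ χ : ℤ × ℤ × ℤ →+ k, euler χ f ∈ wle k w γ := fun χ => euler_mem_supported χ hf
    rw [logDer_apply, logDer_apply, add_comm γ δ]
    refine ⟨add_mem (add_mem (mul_mem_wle ha (hf' _)) (mul_mem_wle hb (hf' _)))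
      (mul_mem_wle hc (hf' _)), ?_⟩
    rw [map_add, map_add, proj_mul ha (hf' _), proj_mul hb (hf' _), proj_mul hc (hf' _),
      proj_euler, proj_euler, proj_euler]

variable [CharZero k]

/-- Local nilpotency passes to the leading part, because `D'` applied to a leading form is the
corresponding component of `D f`, possibly zero. -/
theorem IsLeading.proj_mem_nil {Γ : Type*} [AddCommGroup Γ] [LinearOrder Γ]
    {w : ℤ × ℤ × ℤ →+ Γ} {D D' : Derivation k (Lau k) (Lau k)} {δ : Γ} (h : IsLeading w D D' δ)
    {f : Lau k} {γ : Γ} (hf : f ∈ wle k w γ) (hn : f ∈ nil D) : proj w γ f ∈ nil D' := by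
  obtain ⟨N, hN⟩ := hn
  refine ⟨N, ?_⟩
  induction N generalizing f γ with
  | zero =>
    have hN : f = 0 := hN
    rw [hN, map_zero]; rfl
  | succ N ih =>
    rw [Function.iterate_succ_apply, ← (h hf).2]
    exact ih (h hf).1 hN

end Laurent

/-! ### The polynomial rings `k[x, s, t]` and `k[s, t]` inside the Laurent ring. -/

section Subrings

variable {k : Type*} [Field k]

/-- The subalgebra of elements supported on a submonoid of the exponents. -/
noncomputable def suppAlg (k : Type*) [Field k] (S : AddSubmonoid (ℤ × ℤ × ℤ)) :
    Subalgebra k (Lau k) where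
  carrier := supported k k (S : Set (ℤ × ℤ × ℤ))
  mul_mem' hf hg := mul_mem_supported (fun _ ha _ hb => S.add_mem ha hb) hf hg
  add_mem' hf hg := add_mem hf hg
  algebraMap_mem' c := by
    rw [AddMonoidAlgebra.coe_algebraMap]
    exact single_mem_supported S.zero_mem _

/-- Exponents of the monomials of `k[x, s, t]`. -/
def posX : AddSubmonoid (ℤ × ℤ × ℤ) where
  carrier := {m | 0 ≤ m.1 ∧ 0 ≤ m.2.1 ∧ 0 ≤ m.2.2}
  add_mem' ha hb := ⟨add_nonneg ha.1 hb.1, add_nonneg ha.2.1 hb.2.1, add_nonneg ha.2.2 hb.2.2⟩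
  zero_mem' := ⟨le_rfl, le_rfl, le_rfl⟩

/-- Exponents of the monomials of `k[s, t]`. -/
def posST : AddSubmonoid (ℤ × ℤ × ℤ) where
  carrier := {m | m.1 = 0 ∧ 0 ≤ m.2.1 ∧ 0 ≤ m.2.2}
  add_mem' {a b} ha hb :=
    ⟨show a.1 + b.1 = 0 by rw [ha.1, hb.1, add_zero], add_nonneg ha.2.1 hb.2.1,
      add_nonneg ha.2.2 hb.2.2⟩
  zero_mem' := ⟨rfl, le_rfl, le_rfl⟩

/-- The polynomial ring `k[x, s, t]`. -/
noncomputable def polX (k : Type*) [Field k] : Subalgebra k (Lau k) := suppAlg k posX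

/-- The polynomial ring `k[s, t]`. -/
noncomputable def polST (k : Type*) [Field k] : Subalgebra k (Lau k) := suppAlg k posST

theorem mem_polX {f : Lau k} :
    f ∈ polX k ↔ ∀ m, f.coeff m ≠ 0 → 0 ≤ m.1 ∧ 0 ≤ m.2.1 ∧ 0 ≤ m.2.2 :=
  mem_supported_iff (S := (posX : Set (ℤ × ℤ × ℤ)))

theorem mem_polST {f : Lau k} :
    f ∈ polST k ↔ ∀ m, f.coeff m ≠ 0 → m.1 = 0 ∧ 0 ≤ m.2.1 ∧ 0 ≤ m.2.2 :=
  mem_supported_iff (S := (posST : Set (ℤ × ℤ × ℤ)))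

theorem mon_mem_polX {m : ℤ × ℤ × ℤ} (h : 0 ≤ m.1 ∧ 0 ≤ m.2.1 ∧ 0 ≤ m.2.2) :
    mon m ∈ polX k := single_mem_supported (S := (posX : Set (ℤ × ℤ × ℤ))) h 1

theorem mon_mem_polST {m : ℤ × ℤ × ℤ} (h : m.1 = 0 ∧ 0 ≤ m.2.1 ∧ 0 ≤ m.2.2) :
    mon m ∈ polST k := single_mem_supported (S := (posST : Set (ℤ × ℤ × ℤ))) h 1

theorem vx_mem_polX : vx k ∈ polX k := mon_mem_polX (by simp)
theorem vs_mem_polST : vs k ∈ polST k := mon_mem_polST (by simp)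
theorem vt_mem_polST : vt k ∈ polST k := mon_mem_polST (by simp)

theorem polST_le_polX : polST k ≤ polX k := fun _ hf =>
  mem_polX.2 fun m hm => ⟨(mem_polST.1 hf m hm).1.ge, (mem_polST.1 hf m hm).2⟩

theorem vs_mem_polX : vs k ∈ polX k := polST_le_polX vs_mem_polST
theorem vt_mem_polX : vt k ∈ polX k := polST_le_polX vt_mem_polST

theorem mon_eq (i j l : ℕ) : (mon ((i : ℤ), (j : ℤ), (l : ℤ)) : Lau k) =
    vx k ^ i * (vs k ^ j * vt k ^ l) := by
  rw [vx_pow, vs_pow, vt_pow, mon_mul, mon_mul]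
  congr 1
  ext <;> simp

theorem polX_le {K : Subalgebra k (Lau k)} (hx : vx k ∈ K) (hs : vs k ∈ K) (ht : vt k ∈ K) :
    polX k ≤ K := by
  intro f hf
  refine supported_induction (S := (posX : Set (ℤ × ℤ × ℤ))) (p := fun f => f ∈ K) (zero_mem _)
    (fun _ _ => add_mem) ?_ hf
  rintro ⟨a, b, c⟩ ⟨ha, hb, hc⟩ z
  lift a to ℕ using ha
  lift b to ℕ using hb
  lift c to ℕ using hc
  rw [single_eq_smul_mon, mon_eq]
  exact K.smul_mem (mul_mem (pow_mem hx _) (mul_mem (pow_mem hs _) (pow_mem ht _))) _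

theorem polST_le {K : Subalgebra k (Lau k)} (hs : vs k ∈ K) (ht : vt k ∈ K) :
    polST k ≤ K := by
  intro f hf
  refine supported_induction (S := (posST : Set (ℤ × ℤ × ℤ))) (p := fun f => f ∈ K) (zero_mem _)
    (fun _ _ => add_mem) ?_ hf
  rintro ⟨a, b, c⟩ ⟨ha, hb, hc⟩ z
  lift b to ℕ using hb
  lift c to ℕ using hc
  obtain rfl : a = ((0 : ℕ) : ℤ) := ha
  rw [single_eq_smul_mon, mon_eq, pow_zero, one_mul]
  exact K.smul_mem (mul_mem (pow_mem hs _) (pow_mem ht _)) _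

/-- The weight `-deg_x`. -/
def wx : ℤ × ℤ × ℤ →+ ℤ := -AddMonoidHom.fst ℤ (ℤ × ℤ)

@[simp] theorem wx_apply (m : ℤ × ℤ × ℤ) : wx m = -m.1 := rfl

theorem polST_whom {f : Lau k} (hf : f ∈ polST k) : f ∈ whom k wx 0 :=
  mem_whom.2 fun m hm => by rw [wx_apply, (mem_polST.1 hf m hm).1, neg_zero]

theorem polX_wle {f : Lau k} (hf : f ∈ polX k) : f ∈ wle k wx 0 :=
  mem_wle.2 fun m hm => by rw [wx_apply]; exact neg_nonpos.2 (mem_polX.1 hf m hm).1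

theorem mon_whom {Γ : Type*} [AddCommGroup Γ] [LinearOrder Γ] [IsOrderedAddMonoid Γ]
    (w : ℤ × ℤ × ℤ →+ Γ) (m : ℤ × ℤ × ℤ) : (mon m : Lau k) ∈ whom k w (w m) :=
  single_mem_whom w m 1

end Subrings

/-! ### The ring as a subalgebra, and its elements by pole order along `x = 0`. -/

section TheRing

variable {k : Type*} [Field k]

/-- The polynomial `s ^ d + t ^ r`. -/
noncomputable def hh (k : Type*) [Field k] (d r : ℕ) : Lau k := vs k ^ d + vt k ^ r

/-- The element `y = (s ^ d + t ^ r + x * q) / x ^ n`. -/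
noncomputable def yy (d r n : ℕ) (q : Lau k) : Lau k :=
  mon (-(n : ℤ), 0, 0) * (hh k d r + vx k * q)

/-- The element `z = (y ^ m - s) / x ^ e`. -/
noncomputable def zz (d r m n e : ℕ) (q : Lau k) : Lau k :=
  mon (-(e : ℤ), 0, 0) * (yy d r n q ^ m - vs k)

/-- The subalgebra generated by `x, y, z, t`. -/
noncomputable def Bsub (d r m n e : ℕ) (q : Lau k) : Subalgebra k (Lau k) :=
  Algebra.adjoin k {vx k, yy d r n q, zz d r m n e q, vt k}

variable {d r m n e : ℕ} {q : Lau k}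

theorem pow_mul_mon_neg (N : ℕ) : (vx k ^ N * mon (-(N : ℤ), 0, 0) : Lau k) = 1 := by
  rw [vx_pow, mon_mul, ← mon_zero]
  congr 1
  ext <;> simp

theorem vx_pow_mul_yy : vx k ^ n * yy d r n q = hh k d r + vx k * q := by
  rw [yy, ← mul_assoc, pow_mul_mon_neg, one_mul]

theorem vx_pow_mul_zz : vx k ^ e * zz d r m n e q = yy d r n q ^ m - vs k := by
  rw [zz, ← mul_assoc, pow_mul_mon_neg, one_mul]

theorem vx_mem : vx k ∈ Bsub d r m n e q := Algebra.subset_adjoin (by simp)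
theorem yy_mem : yy d r n q ∈ Bsub d r m n e q := Algebra.subset_adjoin (by simp)
theorem zz_mem : zz d r m n e q ∈ Bsub d r m n e q := Algebra.subset_adjoin (by simp)
theorem vt_mem : vt k ∈ Bsub d r m n e q := Algebra.subset_adjoin (by simp)

theorem vs_mem : vs k ∈ Bsub d r m n e q := by
  have h : vs k = yy d r n q ^ m - vx k ^ e * zz d r m n e q := by
    rw [vx_pow_mul_zz, sub_sub_cancel]
  rw [h]
  exact sub_mem (pow_mem yy_mem _) (mul_mem (pow_mem vx_mem _) zz_mem)

theorem polX_le_Bsub : polX k ≤ Bsub d r m n e q := polX_le vx_mem vs_mem vt_mem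

theorem hh_mem_polST : hh k d r ∈ polST k :=
  add_mem (pow_mem vs_mem_polST _) (pow_mem vt_mem_polST _)

theorem Bsub_le {K : Subalgebra k (Lau k)} (hx : vx k ∈ K) (hy : yy d r n q ∈ K)
    (hz : zz d r m n e q ∈ K) (ht : vt k ∈ K) : Bsub d r m n e q ≤ K := by
  refine Algebra.adjoin_le ?_
  rintro _ (rfl | rfl | rfl | rfl) <;> assumption

/-- Every element of the ring becomes polynomial after multiplication by a power of `x`. -/
theorem exists_pow_mul_mem (hq : q ∈ polX k) {b : Lau k} (hb : b ∈ Bsub d r m n e q) :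
    ∃ N : ℕ, vx k ^ N * b ∈ polX k := by
  have hmul : ∀ {f g : Lau k}, (∃ N : ℕ, vx k ^ N * f ∈ polX k) →
      (∃ N : ℕ, vx k ^ N * g ∈ polX k) → ∃ N : ℕ, vx k ^ N * (f * g) ∈ polX k := by
    rintro f g ⟨N, h1⟩ ⟨N', h2⟩
    refine ⟨N + N', ?_⟩
    rw [pow_add, mul_mul_mul_comm]
    exact mul_mem h1 h2
  have hadd : ∀ {f g : Lau k}, (∃ N : ℕ, vx k ^ N * f ∈ polX k) →
      (∃ N : ℕ, vx k ^ N * g ∈ polX k) → ∃ N : ℕ, vx k ^ N * (f + g) ∈ polX k := by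
    rintro f g ⟨N, h1⟩ ⟨N', h2⟩
    refine ⟨N + N', ?_⟩
    have : vx k ^ (N + N') * (f + g) = vx k ^ N' * (vx k ^ N * f) + vx k ^ N * (vx k ^ N' * g) := by
      ring
    rw [this]
    exact add_mem (mul_mem (pow_mem vx_mem_polX _) h1) (mul_mem (pow_mem vx_mem_polX _) h2)
  let K : Subalgebra k (Lau k) :=
    { carrier := {f | ∃ N : ℕ, vx k ^ N * f ∈ polX k}
      mul_mem' := hmul
      add_mem' := hadd
      algebraMap_mem' := fun c => ⟨0, by rw [pow_zero, one_mul]; exact (polX k).algebraMap_mem c⟩ }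
  have hpol : ∀ {f}, f ∈ polX k → f ∈ K := fun hf => ⟨0, by rwa [pow_zero, one_mul]⟩
  have hyK : yy d r n q ∈ K := ⟨n, by
    rw [vx_pow_mul_yy]
    exact add_mem (polST_le_polX hh_mem_polST) (mul_mem vx_mem_polX hq)⟩
  have hzK : zz d r m n e q ∈ K := by
    obtain ⟨N, hN⟩ : yy d r n q ^ m - vs k ∈ K := sub_mem (pow_mem hyK m) (hpol vs_mem_polX)
    rw [← vx_pow_mul_zz (e := e), ← mul_assoc, ← pow_add] at hN
    exact ⟨_, hN⟩
  exact Bsub_le (K := K) (hpol vx_mem_polX) hyK hzK (hpol vt_mem_polX) hb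

/-- The monomials `y ^ b * z ^ c` with `b < m`. -/
noncomputable def vv (d r m n e : ℕ) (q : Lau k) (a : ℕ) : Lau k :=
  yy d r n q ^ (a % m) * zz d r m n e q ^ (a / m)

/-- The pole order of `vv a` along `x = 0`. -/
def wt (m n e a : ℕ) : ℕ := n * a + e * (a / m)

theorem wt_strictMono (hn : 1 ≤ n) : StrictMono (wt m n e) := by
  refine strictMono_nat_of_lt_succ fun a => ?_
  have h1 : a / m ≤ (a + 1) / m := Nat.div_le_div_right (by omega)
  have h2 : e * (a / m) ≤ e * ((a + 1) / m) := Nat.mul_le_mul_left _ h1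
  have h3 : n * (a + 1) = n * a + n := by ring
  unfold wt
  omega

theorem wt_zero : wt m n e 0 = 0 := by simp [wt]

theorem exists_le_wt (hn : 1 ≤ n) (j : ℕ) : ∃ a, j ≤ wt m n e a :=
  ⟨j, (wt_strictMono hn).le_apply⟩

open Classical in
/-- The element of pole order `j` in the basis of the ring over `k[s, t]`. -/
noncomputable def bas (d r m : ℕ) {n : ℕ} (e : ℕ) (hn : 1 ≤ n) (q : Lau k) (j : ℕ) : Lau k :=
  vx k ^ (wt m n e (Nat.find (exists_le_wt (m := m) (e := e) hn j)) - j) *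
    vv d r m n e q (Nat.find (exists_le_wt (m := m) (e := e) hn j))

theorem bas_eq (hn : 1 ≤ n) {a j : ℕ} (h1 : wt m n e a < j) (h2 : j ≤ wt m n e (a + 1)) :
    bas d r m e hn q j = vx k ^ (wt m n e (a + 1) - j) * vv d r m n e q (a + 1) := by
  classical
  have : Nat.find (exists_le_wt (m := m) (e := e) hn j) = a + 1 := by
    rw [Nat.find_eq_iff]
    refine ⟨h2, fun c hc => ?_⟩
    rw [not_le]
    exact ((wt_strictMono hn).monotone (Nat.lt_succ_iff.1 hc)).trans_lt h1
  unfold bas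
  convert rfl using 4 <;> rw [← this]

theorem exists_bas_eq (hn : 1 ≤ n) (j : ℕ) :
    ∃ a α, wt m n e a = α + j ∧ bas d r m e hn q j = vx k ^ α * vv d r m n e q a := by
  classical
  refine ⟨_, _, (Nat.sub_add_cancel (Nat.find_spec (exists_le_wt (m := m) (e := e) hn j))).symm, ?_⟩
  unfold bas
  congr!

/-- The elements of pole order at most `J` spanned by the basis. -/
noncomputable def fil (d r m : ℕ) {n : ℕ} (e : ℕ) (hn : 1 ≤ n) (q : Lau k) :
    ℕ → Submodule k (Lau k)
  | 0 => Subalgebra.toSubmodule (polX k)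
  | J + 1 => fil d r m e hn q J ⊔
      (Subalgebra.toSubmodule (polST k)).map (LinearMap.mulLeft k (bas d r m e hn q (J + 1)))

theorem fil_mono (hn : 1 ≤ n) : Monotone (fil d r m e hn q) :=
  monotone_nat_of_le_succ fun _ => le_sup_left

theorem mul_mem_fil (hn : 1 ≤ n) {g f : Lau k} (hg : g ∈ polST k) {J : ℕ}
    (hf : f ∈ fil d r m e hn q J) : g * f ∈ fil d r m e hn q J := by
  induction J generalizing f with
  | zero => exact (polX k).mul_mem (polST_le_polX hg) hf
  | succ J ih =>
    obtain ⟨f1, h1, f2, h2, rfl⟩ := Submodule.mem_sup.1 hf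
    obtain ⟨u, hu, rfl⟩ := Submodule.mem_map.1 h2
    rw [mul_add]
    refine Submodule.add_mem_sup (ih h1) (Submodule.mem_map.2 ⟨g * u, (polST k).mul_mem hg hu, ?_⟩)
    simp only [LinearMap.mulLeft_apply]
    ring

/-- The union of the `fil J`. -/
noncomputable def filUnion (d r m : ℕ) {n : ℕ} (e : ℕ) (hn : 1 ≤ n) (q : Lau k) :
    Submodule k (Lau k) := ⨆ J, fil d r m e hn q J

theorem mem_filUnion (hn : 1 ≤ n) {f : Lau k} :
    f ∈ filUnion d r m e hn q ↔ ∃ J, f ∈ fil d r m e hn q J :=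
  Submodule.mem_iSup_of_directed _ (fil_mono hn).directed_le

theorem mul_mem_filUnion (hn : 1 ≤ n) {g f : Lau k} (hg : g ∈ polST k)
    (hf : f ∈ filUnion d r m e hn q) : g * f ∈ filUnion d r m e hn q := by
  rw [mem_filUnion] at *
  exact hf.imp fun J hJ => mul_mem_fil hn hg hJ

theorem vv_eq {b c : ℕ} (hb : b < m) :
    vv d r m n e q (m * c + b) = yy d r n q ^ b * zz d r m n e q ^ c := by
  rw [vv, Nat.mul_add_mod, Nat.mod_eq_of_lt hb, Nat.mul_add_div (by omega), Nat.div_eq_of_lt hb,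
    add_zero]

theorem wt_eq {b c : ℕ} (hb : b < m) :
    wt m n e (m * c + b) = n * (m * c + b) + e * c := by
  rw [wt, Nat.mul_add_div (by omega), Nat.div_eq_of_lt hb, add_zero]

theorem polX_mul_mem_filUnion_of (hn : 1 ≤ n) {f : Lau k}
    (h : ∀ α : ℕ, vx k ^ α * f ∈ filUnion d r m e hn q) {p : Lau k} (hp : p ∈ polX k) :
    p * f ∈ filUnion d r m e hn q := by
  refine supported_induction (S := (posX : Set (ℤ × ℤ × ℤ)))
    (p := fun p => p * f ∈ filUnion d r m e hn q) ?_ ?_ ?_ hp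
  · rw [zero_mul]; exact zero_mem _
  · intro p p' h1 h2
    rw [add_mul]; exact add_mem h1 h2
  · rintro ⟨a, b, c⟩ ⟨ha, hb, hc⟩ z
    lift a to ℕ using ha
    lift b to ℕ using hb
    lift c to ℕ using hc
    rw [single_eq_smul_mon, smul_mul_assoc, mon_eq, mul_right_comm, mul_comm]
    exact Submodule.smul_mem _ _ (mul_mem_filUnion hn
      (mul_mem (pow_mem vs_mem_polST _) (pow_mem vt_mem_polST _)) (h a))

/-- The products `x ^ α * vv a` reduce to the chosen basis by means of `x ^ n * y ∈ k[x, s, t]` and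
`x ^ e * z = y ^ m - s`. -/
theorem vx_pow_mul_vv_mem (hm : 1 ≤ m) (hn : 1 ≤ n) (hq : q ∈ polX k) (a α : ℕ) :
    vx k ^ α * vv d r m n e q a ∈ filUnion d r m e hn q := by
  have hF : hh k d r + vx k * q ∈ polX k :=
    add_mem (polST_le_polX hh_mem_polST) (mul_mem vx_mem_polX hq)
  induction a using Nat.strong_induction_on generalizing α with
  | _ a ih =>
    rcases Nat.eq_zero_or_pos a with rfl | ha
    · rw [mem_filUnion]
      refine ⟨0, ?_⟩
      have : vv d r m n e q 0 = 1 := by simp [vv]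
      rw [this, mul_one]
      exact pow_mem vx_mem_polX α
    obtain ⟨a, rfl⟩ : ∃ a', a = a' + 1 := ⟨a - 1, by omega⟩
    have ih' : ∀ a' < a + 1, ∀ p ∈ polX k, p * vv d r m n e q a' ∈ filUnion d r m e hn q :=
      fun a' h p hp => polX_mul_mem_filUnion_of hn (ih a' h) hp
    -- If `α` is less than the gap between consecutive pole orders, the product is itself a basis
    -- element. Otherwise `α` is at least the gap, which is `n`, or `n + e` when `m` divides `a +
    -- 1`, and one factor `y` or `z` can be traded for smaller indices.
    by_cases hα : α + wt m n e a < wt m n e (a + 1)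
    · rw [mem_filUnion]
      obtain ⟨J, hJ⟩ : ∃ J, wt m n e (a + 1) - α = J + 1 := ⟨wt m n e (a + 1) - α - 1, by omega⟩
      refine ⟨J + 1, Submodule.mem_sup_right (Submodule.mem_map.2 ⟨1, one_mem (polST k), ?_⟩)⟩
      rw [LinearMap.mulLeft_apply, mul_one, bas_eq hn (by omega : wt m n e a < J + 1) (by omega)]
      congr 2
      omega
    have hb := Nat.mod_lt a hm
    have hac := Nat.div_add_mod a m
    set b := a % m
    set c := a / m
    by_cases hbm : b + 1 < m
    · have h1 : a + 1 = m * c + (b + 1) := by omega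
      rw [h1, wt_eq hbm, ← hac, wt_eq hb] at hα
      have hαn : n ≤ α := by
        have : n * (m * c + (b + 1)) = n * (m * c + b) + n := by ring
        omega
      obtain ⟨β, rfl⟩ := Nat.exists_eq_add_of_le hαn
      have h2 : vx k ^ (n + β) * vv d r m n e q (a + 1) =
          (vx k ^ β * (hh k d r + vx k * q)) * vv d r m n e q a := by
        rw [h1, ← hac, vv_eq hbm, vv_eq hb, ← vx_pow_mul_yy (n := n)]
        ring
      rw [h2]
      exact ih' a (by omega) _ (mul_mem (pow_mem vx_mem_polX _) hF)
    · have hbm' : b + 1 = m := by omega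
      have hc1 : m * (c + 1) = m * c + m := by ring
      have h1 : a + 1 = m * (c + 1) + 0 := by omega
      rw [h1, wt_eq hm, ← hac, wt_eq hb] at hα
      have hαn : n + e ≤ α := by
        have e1 : n * (m * (c + 1) + 0) = n * (m * c + b) + n := by rw [hc1, ← hbm']; ring
        have e2 : e * (c + 1) = e * c + e := by ring
        omega
      obtain ⟨β, rfl⟩ := Nat.exists_eq_add_of_le hαn
      have h2 : vx k ^ (n + e + β) * vv d r m n e q (a + 1) =
          (vx k ^ β * (hh k d r + vx k * q)) * vv d r m n e q a -
            (vx k ^ (n + β) * vs k) * vv d r m n e q (m * c + 0) := by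
        rw [h1, ← hac, vv_eq hm, vv_eq hm, vv_eq hb, ← vx_pow_mul_yy (n := n)]
        have h3 : yy d r n q * yy d r n q ^ b = vx k ^ e * zz d r m n e q + vs k := by
          rw [vx_pow_mul_zz, sub_add_cancel, ← pow_succ', hbm']
        linear_combination (-(vx k ^ β * vx k ^ n * zz d r m n e q ^ c)) * h3
      rw [h2]
      exact sub_mem (ih' a (by omega) _ (mul_mem (pow_mem vx_mem_polX _) hF))
        (ih' _ (by omega) _ (mul_mem (pow_mem vx_mem_polX _) vs_mem_polX))

/-- The span of the `p * vv a` with `p` in `k[x, s, t]` contains `1` and is stable under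
multiplication by the four generators, since `y ^ m` can be replaced by `x ^ e * z + s`. -/
theorem Bsub_le_filUnion (hm : 1 ≤ m) (hn : 1 ≤ n) (hq : q ∈ polX k) {b : Lau k}
    (hb : b ∈ Bsub d r m n e q) : b ∈ filUnion d r m e hn q := by
  let T : Submodule k (Lau k) :=
    Submodule.span k {f | ∃ p ∈ polX k, ∃ a, f = p * vv d r m n e q a}
  have hTS : T ≤ filUnion d r m e hn q := by
    refine Submodule.span_le.2 ?_
    rintro _ ⟨p, hp, a, rfl⟩
    exact polX_mul_mem_filUnion_of hn (vx_pow_mul_vv_mem hm hn hq a) hp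
  have hgen : ∀ c : Lau k, (∀ p ∈ polX k, ∀ a, c * (p * vv d r m n e q a) ∈ T) →
      ∀ f ∈ T, c * f ∈ T := by
    intro c hc f hf
    refine Submodule.span_induction (p := fun f _ => c * f ∈ T) ?_ ?_ ?_ ?_ hf
    · rintro _ ⟨p, hp, a, rfl⟩
      exact hc p hp a
    · rw [mul_zero]; exact zero_mem _
    · intro f g _ _ h1 h2
      rw [mul_add]; exact add_mem h1 h2
    · intro z f _ h
      rw [mul_smul_comm]; exact Submodule.smul_mem _ _ h
  have hmem : ∀ {p}, p ∈ polX k → ∀ a, p * vv d r m n e q a ∈ T := fun hp a =>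
    Submodule.subset_span ⟨_, hp, a, rfl⟩
  let K : Subalgebra k (Lau k) :=
    { carrier := {c | ∀ f ∈ T, c * f ∈ T}
      mul_mem' := fun h1 h2 f hf => by rw [mul_assoc]; exact h1 _ (h2 f hf)
      add_mem' := fun h1 h2 f hf => by rw [add_mul]; exact add_mem (h1 f hf) (h2 f hf)
      algebraMap_mem' := fun c f hf => by
        rw [← Algebra.smul_def]; exact Submodule.smul_mem _ _ hf }
  have hpol : ∀ {c}, c ∈ polX k → c ∈ K := fun {c} hc => hgen c fun p hp a => by
    rw [← mul_assoc]; exact hmem (mul_mem hc hp) a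
  have hb' : b ∈ K := by
    refine Bsub_le (K := K) (hpol vx_mem_polX) (hgen _ fun p hp a => ?_) (hgen _ fun p hp a => ?_)
      (hpol vt_mem_polX) hb
    · have hb := Nat.mod_lt a hm
      have hac := Nat.div_add_mod a m
      set b := a % m
      set c := a / m
      by_cases hbm : b + 1 < m
      · have h2 : yy d r n q * (p * vv d r m n e q a) = p * vv d r m n e q (m * c + (b + 1)) := by
          rw [← hac, vv_eq hbm, vv_eq hb]; ring
        rw [h2]
        exact hmem hp _
      · have hbm' : b + 1 = m := by omega
        have h2 : yy d r n q * (p * vv d r m n e q a) =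
            (p * vx k ^ e) * vv d r m n e q (m * (c + 1) + 0) +
              (p * vs k) * vv d r m n e q (m * c + 0) := by
          rw [← hac, vv_eq hm, vv_eq hm, vv_eq hb]
          have h3 : yy d r n q * yy d r n q ^ b = vx k ^ e * zz d r m n e q + vs k := by
            rw [vx_pow_mul_zz, sub_add_cancel, ← pow_succ', hbm']
          linear_combination (p * zz d r m n e q ^ c) * h3
        rw [h2]
        exact add_mem (hmem (mul_mem hp (pow_mem vx_mem_polX _)) _)
          (hmem (mul_mem hp vs_mem_polX) _)
    · have hb := Nat.mod_lt a hm
      have hac := Nat.div_add_mod a m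
      have h2 : zz d r m n e q * (p * vv d r m n e q a) =
          p * vv d r m n e q (m * (a / m + 1) + a % m) := by
        conv_lhs => rw [← hac]
        rw [vv_eq hb, vv_eq hb]; ring
      rw [h2]
      exact hmem hp _
  have h1 : (1 : Lau k) ∈ T := by
    have := hmem (one_mem (polX k)) 0
    rwa [one_mul, show vv d r m n e q 0 = 1 by simp [vv]] at this
  have := hb' 1 h1
  rw [mul_one] at this
  exact hTS this

section Leading

variable {Γ : Type*} [AddCommGroup Γ] [LinearOrder Γ] [IsOrderedAddMonoid Γ]
  {w : ℤ × ℤ × ℤ →+ Γ} {η : Γ}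

/-- The leading form of `y`. -/
noncomputable def ybar (k : Type*) [Field k] (d r n : ℕ) : Lau k :=
  mon (-(n : ℤ), 0, 0) * hh k d r

/-- The leading form of `z`. -/
noncomputable def zbar (k : Type*) [Field k] (d r m n e : ℕ) : Lau k :=
  mon (-(e : ℤ), 0, 0) * ybar k d r n ^ m

theorem yy_leading (hh0 : hh k d r ∈ whom k w η) (hq : vx k * q ∈ wle k w η)
    (hq0 : proj w η (vx k * q) = 0) :
    yy d r n q ∈ wle k w (w (-(n : ℤ), 0, 0) + η) ∧
      proj w (w (-(n : ℤ), 0, 0) + η) (yy d r n q) = ybar k d r n := by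
  refine ⟨mul_mem_wle (whom_le_wle (mon_whom w _)) (add_mem (whom_le_wle hh0) hq), ?_⟩
  rw [yy, proj_whom_mul (mon_whom w _), map_add, hq0, add_zero, proj_of_mem_whom hh0, ybar]

/-- The hypothesis `hs` puts `s` strictly below `y ^ m`, so it does not affect the leading form of
`y ^ m - s`. -/
theorem zz_leading (hh0 : hh k d r ∈ whom k w η) (hq : vx k * q ∈ wle k w η)
    (hq0 : proj w η (vx k * q) = 0) (hs : w (0, 1, 0) < m • (w (-(n : ℤ), 0, 0) + η)) :
    zz d r m n e q ∈ wle k w (w (-(e : ℤ), 0, 0) + m • (w (-(n : ℤ), 0, 0) + η)) ∧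
      proj w (w (-(e : ℤ), 0, 0) + m • (w (-(n : ℤ), 0, 0) + η)) (zz d r m n e q) =
        zbar k d r m n e := by
  obtain ⟨h1, h2⟩ := yy_leading (n := n) hh0 hq hq0
  have hs' : vs k ∈ whom k w (w (0, 1, 0)) := mon_whom w _
  refine ⟨mul_mem_wle (whom_le_wle (mon_whom w _)) (sub_mem (pow_mem_wle h1 m)
    (wle_mono hs.le (whom_le_wle hs'))), ?_⟩
  rw [zz, proj_whom_mul (mon_whom w _), map_sub, proj_of_mem_whom_ne hs' hs.ne, sub_zero,
    proj_pow h1, h2, zbar]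

end Leading

theorem wx_hyp (hq : q ∈ polX k) : hh k d r ∈ whom k wx 0 ∧ vx k * q ∈ wle k wx 0 ∧
    proj wx 0 (vx k * q) = 0 := by
  have h1 : vx k * q ∈ wle k wx (-1) := by
    have := mul_mem_wle (whom_le_wle (mon_whom (k := k) wx (1, 0, 0))) (polX_wle hq)
    simpa [vx] using this
  exact ⟨polST_whom hh_mem_polST, wle_mono (by norm_num) h1, proj_of_mem_wle_lt h1 (by norm_num)⟩

theorem ybar_pow_mul_zbar_pow (b c : ℕ) : ybar k d r n ^ b * zbar k d r m n e ^ c =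
    mon (-((n * (m * c + b) + e * c : ℕ) : ℤ), 0, 0) * hh k d r ^ (m * c + b) := by
  rw [zbar, mul_pow, ← pow_mul, mul_left_comm, ← pow_add, ybar, mul_pow, mon_pow, mon_pow,
    ← mul_assoc, mon_mul, add_comm b]
  congr 2
  ext <;> simp
  ring

/-- Each `y` contributes one factor `hh` and each `z` contributes `m`, so the index `a` is exactly
the exponent of `hh`. This is the reason for indexing the monomials `y ^ b * z ^ c` by `a = m * c +
b`. -/
theorem vv_leading (hm : 1 ≤ m) (hn : 1 ≤ n) (hq : q ∈ polX k) (a : ℕ) :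
    vv d r m n e q a ∈ wle k wx (wt m n e a : ℤ) ∧
      proj wx (wt m n e a : ℤ) (vv d r m n e q a) =
        mon (-(wt m n e a : ℤ), 0, 0) * hh k d r ^ a := by
  obtain ⟨h1, h2, h3⟩ := wx_hyp (d := d) (r := r) hq
  obtain ⟨h4, h5⟩ := yy_leading (n := n) h1 h2 h3
  have hs : wx (0, 1, 0) < m • (wx (-(n : ℤ), 0, 0) + 0) := by
    simp only [wx_apply, neg_zero, neg_neg, add_zero, nsmul_eq_mul]
    positivity
  obtain ⟨h6, h7⟩ := zz_leading (e := e) h1 h2 h3 hs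
  have hb := Nat.mod_lt a hm
  have hac := Nat.div_add_mod a m
  set b := a % m
  set c := a / m
  have h8 := proj_mul (pow_mem_wle h4 b) (pow_mem_wle h6 c)
  have h9 := mul_mem_wle (pow_mem_wle h4 b) (pow_mem_wle h6 c)
  rw [proj_pow h4, proj_pow h6, h5, h7, ybar_pow_mul_zbar_pow] at h8
  rw [← hac, vv_eq hb, wt_eq hb]
  have : b • (wx (-(n : ℤ), 0, 0) + 0) + c • (wx (-(e : ℤ), 0, 0) + m • (wx (-(n : ℤ), 0, 0) + 0)) =
      ((n * (m * c + b) + e * c : ℕ) : ℤ) := by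
    simp only [wx_apply, neg_neg, add_zero, nsmul_eq_mul]
    push_cast
    ring
  rw [this] at h8 h9
  exact ⟨h9, h8⟩

theorem mon_mul_mem_polST {f : Lau k} {j : ℤ} (hf : f ∈ polX k) (hj : f ∈ whom k wx j) :
    mon (j, 0, 0) * f ∈ polST k := by
  rw [mem_polST]
  intro m hm
  rw [coeff_mon_mul] at hm
  have h1 := mem_polX.1 hf _ hm
  have h2 := mem_whom.1 hj _ hm
  simp only [wx_apply, Prod.fst_sub, Prod.snd_sub, sub_zero] at h1 h2
  exact ⟨by omega, h1.2⟩

theorem proj_mem_polX {Γ : Type*} [AddCommGroup Γ] [LinearOrder Γ] [IsOrderedAddMonoid Γ]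
    (w : ℤ × ℤ × ℤ →+ Γ) (γ : Γ) {f : Lau k} (hf : f ∈ polX k) : proj w γ f ∈ polX k :=
  mem_polX.2 fun m hm => mem_polX.1 hf m (coeff_proj_ne_zero hm)

theorem proj_mem_polST {Γ : Type*} [AddCommGroup Γ] [LinearOrder Γ] [IsOrderedAddMonoid Γ]
    (w : ℤ × ℤ × ℤ →+ Γ) (γ : Γ) {f : Lau k} (hf : f ∈ polST k) : proj w γ f ∈ polST k :=
  mem_polST.2 fun m hm => mem_polST.1 hf m (coeff_proj_ne_zero hm)

/-- The leading coefficient in `x⁻¹` of an element of the ring is divisible by the appropriate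
power of `s ^ d + t ^ r`. -/
theorem exists_leading (hm : 1 ≤ m) (hn : 1 ≤ n) (hq : q ∈ polX k) {b : Lau k}
    (hb : b ∈ Bsub d r m n e q) (h0 : b ≠ 0) :
    ∃ (j : ℤ) (a α : ℕ) (g : Lau k), g ∈ polST k ∧ g ≠ 0 ∧ (wt m n e a : ℤ) = α + j ∧
      b ∈ wle k wx j ∧ proj wx j b = mon (-j, 0, 0) * hh k d r ^ a * g ∧ (j ≤ 0 → b ∈ polX k) := by
  have hpol : ∀ b ∈ polX k, b ≠ 0 → ∃ (j : ℤ) (a α : ℕ) (g : Lau k), g ∈ polST k ∧ g ≠ 0 ∧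
      (wt m n e a : ℤ) = α + j ∧ b ∈ wle k wx j ∧
      proj wx j b = mon (-j, 0, 0) * hh k d r ^ a * g ∧ (j ≤ 0 → b ∈ polX k) := by
    intro b hb h0
    obtain ⟨j, h1, h2⟩ := exists_top (w := wx) h0
    have hj : j ≤ 0 := by
      by_contra hj
      exact h2 (proj_of_mem_wle_lt (polX_wle hb) (not_le.1 hj))
    refine ⟨j, 0, (-j).toNat, mon (j, 0, 0) * proj wx j b,
      mon_mul_mem_polST (proj_mem_polX _ _ hb) (proj_mem_whom _ _ _),
      mul_ne_zero (mon_ne_zero _) h2, ?_, h1, ?_, fun _ => hb⟩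
    · rw [wt_zero, Int.toNat_of_nonneg (by omega)]
      simp
    · rw [pow_zero, mul_one, ← mul_assoc, mon_mul]
      simp [← Prod.zero_eq_mk, mon_zero]
  obtain ⟨J, hJ⟩ := (mem_filUnion hn).1 (Bsub_le_filUnion hm hn hq hb)
  have hwle : ∀ J, ∀ b ∈ fil d r m e hn q J, b ∈ wle k wx (J : ℤ) := by
    intro J
    induction J with
    | zero => exact fun b hb => polX_wle hb
    | succ J ih =>
      intro b hb
      obtain ⟨f1, h1, f2, h2, rfl⟩ := Submodule.mem_sup.1 hb
      obtain ⟨u, hu, rfl⟩ := Submodule.mem_map.1 h2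
      refine add_mem (wle_mono (by push_cast; omega) (ih _ h1)) ?_
      obtain ⟨a, α, h3, h4⟩ := exists_bas_eq (d := d) (r := r) (m := m) (e := e) (q := q) hn (J + 1)
      rw [LinearMap.mulLeft_apply, h4, vx_pow]
      refine wle_mono (le_of_eq ?_) (mul_mem_wle (mul_mem_wle (whom_le_wle (mon_whom wx _))
        (vv_leading hm hn hq a).1) (whom_le_wle (polST_whom hu)))
      rw [h3, wx_apply]
      push_cast
      ring
  induction J generalizing b with
  | zero => exact hpol b hJ h0
  | succ J ih =>
    obtain ⟨f1, h1, f2, h2, rfl⟩ := Submodule.mem_sup.1 hJ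
    obtain ⟨u, hu, rfl⟩ := Submodule.mem_map.1 h2
    by_cases hu0 : u = 0
    · simp only [hu0, map_zero, add_zero] at hb h0 ⊢
      exact ih hb h0 h1
    obtain ⟨a, α, h3, h4⟩ := exists_bas_eq (d := d) (r := r) (m := m) (e := e) (q := q) hn (J + 1)
    refine ⟨(J : ℤ) + 1, a, α, u, hu, hu0, by rw [h3]; push_cast; ring,
      by exact_mod_cast hwle (J + 1) _ hJ, ?_, fun h => by omega⟩
    -- There is one basis element for each pole order, so the terms of lower order cannot cancel the
    -- top one.
    rw [map_add, proj_of_mem_wle_lt (hwle J _ h1) (by omega), zero_add, LinearMap.mulLeft_apply, h4,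
      mul_comm, vx_pow]
    have h5 : (J : ℤ) + 1 = 0 + (wx ((α : ℤ), 0, 0) + (wt m n e a : ℤ)) := by
      rw [h3, wx_apply]; push_cast; ring
    rw [h5, proj_whom_mul (polST_whom hu), proj_whom_mul (mon_whom wx _),
      (vv_leading hm hn hq a).2, ← mul_assoc (mon _), mon_mul, mul_comm u]
    congr 3
    ext
    · rw [h3]; simp
    · simp
    · simp

end TheRing

/-! ### Leading forms for the lexicographic refinement of the pole order. -/

section LexWeight

variable {k : Type*} [Field k] {d r m n e : ℕ} {q : Lau k}

/-- The weight refining `-deg_x` by the weighted degree for which `s ^ d + t ^ r` is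
homogeneous. -/
def wl (d r : ℕ) : ℤ × ℤ × ℤ →+ ℤ ×ₗ ℤ :=
  AddMonoidHom.mk' (fun m => toLex (-m.1, r * m.2.1 + d * m.2.2)) fun a b => by
    rw [← toLex_add]
    congr 1
    ext
    · simp; ring
    · simp; ring

theorem wl_apply (m : ℤ × ℤ × ℤ) : wl d r m = toLex (-m.1, r * m.2.1 + d * m.2.2) := rfl

theorem hh_ne_zero (hd : 1 ≤ d) : hh k d r ≠ 0 := by
  intro h
  have h1 : (hh k d r).coeff (0, (d : ℤ), 0) = 1 := by
    rw [hh, AddMonoidAlgebra.coeff_add, Finsupp.add_apply, vs_pow, vt_pow, coeff_mon, coeff_mon,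
      if_pos rfl, if_neg, add_zero]
    intro h2
    have : (0 : ℤ) = d := congrArg (fun m : ℤ × ℤ × ℤ => m.2.1) h2
    omega
  rw [h] at h1
  exact zero_ne_one h1

theorem hh_whom : hh k d r ∈ whom k (wl d r) (toLex (0, (r : ℤ) * d)) := by
  rw [hh, vs_pow, vt_pow]
  refine add_mem ?_ ?_
  · have h := mon_whom (k := k) (wl d r) (0, (d : ℤ), 0)
    rwa [wl_apply, neg_zero, mul_zero, add_zero] at h
  · have h := mon_whom (k := k) (wl d r) (0, 0, (r : ℤ))
    rwa [wl_apply, neg_zero, mul_zero, zero_add, mul_comm] at h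

/-- Every monomial of `x * q` has negative first weight coordinate, so the arbitrary polynomial `Q`
disappears from the leading forms. -/
theorem wl_hyp (hq : q ∈ polX k) : vx k * q ∈ wle k (wl d r) (toLex (0, (r : ℤ) * d)) ∧
    proj (wl d r) (toLex (0, (r : ℤ) * d)) (vx k * q) = 0 := by
  have key : ∀ m, (vx k * q).coeff m ≠ 0 → wl d r m < toLex (0, (r : ℤ) * d) := by
    intro m hm
    rw [vx, coeff_mon_mul] at hm
    have := (mem_polX.1 hq _ hm).1
    simp only [Prod.fst_sub] at this
    rw [wl_apply, Prod.Lex.toLex_lt_toLex]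
    left
    change -m.1 < 0
    omega
  refine ⟨mem_wle.2 fun m hm => (key m hm).le, ?_⟩
  ext m
  rw [coeff_proj]
  split_ifs with h
  · by_contra h1
    exact (key m h1).ne h
  · rfl

theorem toLex_nsmul (N : ℕ) (a b : ℤ) : N • (toLex (a, b) : ℤ ×ₗ ℤ) = toLex (N * a, N * b) := by
  rw [← nsmul_eq_mul, ← nsmul_eq_mul]; rfl

theorem yy_leading_lex (hq : q ∈ polX k) : ∃ γ, yy d r n q ∈ wle k (wl d r) γ ∧
    proj (wl d r) γ (yy d r n q) = ybar k d r n :=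
  ⟨_, yy_leading hh_whom (wl_hyp hq).1 (wl_hyp hq).2⟩

theorem zz_leading_lex (hm : 1 ≤ m) (hn : 1 ≤ n) (hq : q ∈ polX k) :
    ∃ γ, zz d r m n e q ∈ wle k (wl d r) γ ∧
    proj (wl d r) γ (zz d r m n e q) = zbar k d r m n e := by
  refine ⟨_, zz_leading hh_whom (wl_hyp hq).1 (wl_hyp hq).2 ?_⟩
  rw [wl_apply, wl_apply, ← toLex_add, Prod.mk_add_mk, toLex_nsmul, Prod.Lex.toLex_lt_toLex]
  left
  simp only [neg_zero, neg_neg, add_zero]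
  positivity

/-- The leading forms of the elements of the ring, of weight `γ`. -/
noncomputable def leadForms (d r m n e : ℕ) (q : Lau k) (γ : ℤ ×ₗ ℤ) : Submodule k (Lau k) :=
  (Subalgebra.toSubmodule (Bsub d r m n e q) ⊓ wle k (wl d r) γ).map (proj (wl d r) γ)

/-- The graded ring of leading forms is generated by `x, s, t, ybar, zbar`. By `exists_leading` each
nonzero homogeneous element is even a single monomial in `x, ybar, zbar` times a quasi-homogeneous
polynomial in `s, t`. -/
theorem exists_leadForm (hd : 1 ≤ d) (hm : 1 ≤ m) (hn : 1 ≤ n) (hq : q ∈ polX k) {γ : ℤ ×ₗ ℤ}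
    {u : Lau k}
    (hu : u ∈ leadForms d r m n e q γ) (h0 : u ≠ 0) :
    ∃ (a α : ℕ) (G : Lau k) (γ' : ℤ ×ₗ ℤ), G ∈ polST k ∧ G ∈ whom k (wl d r) γ' ∧
      u = vx k ^ α * (ybar k d r n ^ (a % m) * zbar k d r m n e ^ (a / m)) * G ∧
      (0 < (ofLex γ).1 → 1 ≤ a) := by
  obtain ⟨b, ⟨hb, hbγ⟩, rfl⟩ := Submodule.mem_map.1 hu
  have hb0 : b ≠ 0 := by
    rintro rfl
    exact h0 (map_zero _)
  obtain ⟨j, a, α, g, hg, hg0, hj, hbj, hpj, -⟩ := exists_leading (e := e) hm hn hq hb hb0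
  have hex : ∀ {f : Lau k}, f ≠ 0 → ∃ m, f.coeff m ≠ 0 := by
    intro f hf
    by_contra h
    push Not at h
    exact hf (AddMonoidAlgebra.ext (Finsupp.ext h))
  have hjγ : j = (ofLex γ).1 := by
    apply le_antisymm
    · have : proj wx j b ≠ 0 := by
        rw [hpj]
        exact mul_ne_zero (mul_ne_zero (mon_ne_zero _) (pow_ne_zero _ (hh_ne_zero hd))) hg0
      obtain ⟨m', hm'⟩ := hex this
      have h1 := mem_wle.1 hbγ _ (coeff_proj_ne_zero hm')
      have h2 : wx m' = j := mem_whom.1 (proj_mem_whom wx j b) _ hm'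
      rw [wl_apply, Prod.Lex.le_iff] at h1
      change -m'.1 < (ofLex γ).1 ∨ -m'.1 = (ofLex γ).1 ∧ _ at h1
      rw [wx_apply] at h2
      omega
    · obtain ⟨m', hm'⟩ := hex h0
      have h1 := mem_wle.1 hbj _ (coeff_proj_ne_zero hm')
      have h2 : wl d r m' = γ := mem_whom.1 (proj_mem_whom _ _ b) _ hm'
      rw [← h2]
      exact h1
  -- The lexicographic weight refines `wx`, so its leading form can be taken inside the leading form
  -- for `wx`.
  have hproj : proj (wl d r) γ b = proj (wl d r) γ (proj wx j b) := by
    ext m'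
    rw [coeff_proj, coeff_proj, coeff_proj]
    split_ifs with h1 h2
    · rfl
    · exact absurd (by rw [hjγ, ← h1]; rfl) h2
    · rfl
  set γ0 := wl d r (-j, 0, 0) + a • toLex (0, (r : ℤ) * d) with hγ0
  have h1 : mon (-j, 0, 0) * hh k d r ^ a ∈ whom k (wl d r) γ0 :=
    mul_mem_whom (mon_whom _ _) (pow_mem_whom hh_whom a)
  refine ⟨a, α, proj (wl d r) (γ - γ0) g, γ - γ0, proj_mem_polST _ _ hg, proj_mem_whom _ _ _, ?_,
    fun h => ?_⟩
  · conv_lhs => rw [hproj, hpj, ← add_sub_cancel γ0 γ]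
    rw [proj_whom_mul h1]
    congr 1
    rw [ybar_pow_mul_zbar_pow, Nat.div_add_mod, vx_pow, ← mul_assoc, mon_mul]
    congr 2
    change _ = (((α : ℤ), 0, 0) : ℤ × ℤ × ℤ) + (-(wt m n e a : ℤ), 0, 0)
    rw [hj]
    ext <;> simp
  · by_contra ha
    obtain rfl : a = 0 := by omega
    rw [wt_zero] at hj
    push_cast at hj
    omega

end LexWeight

/-! ### Constraints on a derivation that is locally nilpotent on the leading forms. -/

section Core

variable {k : Type*} [Field k] [CharZero k] {d r m n e : ℕ} {E : Derivation k (Lau k) (Lau k)}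

theorem vx_pow_mul_ybar : vx k ^ n * ybar k d r n = hh k d r := by
  rw [ybar, ← mul_assoc, pow_mul_mon_neg, one_mul]

theorem vx_pow_mul_zbar : vx k ^ e * zbar k d r m n e = ybar k d r n ^ m := by
  rw [zbar, ← mul_assoc, pow_mul_mon_neg, one_mul]

theorem ybar_ne_zero (hd : 1 ≤ d) : ybar k d r n ≠ 0 :=
  mul_ne_zero (mon_ne_zero _) (hh_ne_zero hd)

theorem zbar_ne_zero (hd : 1 ≤ d) : zbar k d r m n e ≠ 0 :=
  mul_ne_zero (mon_ne_zero _) (pow_ne_zero _ (ybar_ne_zero hd))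

/-- A derivation that is locally nilpotent on `x` and `ybar` and kills `s ^ d + t ^ r`
kills `x`. -/
theorem map_vx_eq_zero (hd : 1 ≤ d) (hn : 1 ≤ n) (hx : vx k ∈ nil E) (hy : ybar k d r n ∈ nil E)
    (h : E (hh k d r) = 0) : E (vx k) = 0 := by
  rw [← vx_pow_mul_ybar (n := n)] at h
  refine map_eq_zero_of_pow hx (by omega : n ≠ 0) (map_eq_zero_of_mul (pow_mem hx n) hy ?_ h).1
  rw [vx_pow_mul_ybar]
  exact hh_ne_zero hd

theorem derivation_eq_zero (hd : 1 ≤ d) (hn : 1 ≤ n) (hx : vx k ∈ nil E)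
    (hy : ybar k d r n ∈ nil E) (hs : E (vs k) = 0) (ht : E (vt k) = 0) : E = 0 := by
  refine derivation_ext ?_ hs ht
  refine map_vx_eq_zero hd hn hx hy ?_
  rw [hh, map_add, map_pow_eq_zero hs, map_pow_eq_zero ht, add_zero]

/-- If the derivation kills `zbar` then the square of the image of `s ^ d + t ^ r` is divisible
by `s ^ d + t ^ r`. -/
theorem sq_map_hh (hd : 1 ≤ d) (hm : 1 ≤ m) (hn : 1 ≤ n) (hne : (n, e) ≠ (1, 0))
    (hx : vx k ∈ nil E) (hy : ybar k d r n ∈ nil E) (hz : E (zbar k d r m n e) = 0) :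
    ∃ p ∈ nil E, E (hh k d r) ^ 2 = hh k d r * p := by
  have : CharZero (Lau k) := charZero_of_injective_algebraMap (algebraMap k (Lau k)).injective
  set X := vx k with hX
  set Y := ybar k d r n with hY
  set Z := zbar k d r m n e with hZ
  have hX0 : X ≠ 0 := vx_ne_zero
  have hY0 : Y ≠ 0 := ybar_ne_zero hd
  have hZ0 : Z ≠ 0 := zbar_ne_zero hd
  have hm0 : (m : Lau k) ≠ 0 := Nat.cast_ne_zero.2 (by omega)
  have hinv : algebraMap k (Lau k) (m : k)⁻¹ * m = 1 := by
    rw [← map_natCast (algebraMap k (Lau k)) m, ← map_mul,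
      inv_mul_cancel₀ (Nat.cast_ne_zero.2 (by omega)), map_one]
  have halg : ∀ c, algebraMap k (Lau k) c ∈ nil E := fun c => (nil E).algebraMap_mem c
  have hpow : ∀ (f : Lau k) (N : ℕ), f * E (f ^ N) = N * f ^ N * E f := by
    intro f N
    rw [Derivation.leibniz_pow, nsmul_eq_mul, smul_eq_mul]
    rcases Nat.eq_zero_or_pos N with rfl | hN
    · simp
    · obtain ⟨M, rfl⟩ : ∃ M, N = M + 1 := ⟨N - 1, by omega⟩
      rw [Nat.add_sub_cancel]; ring
  -- logarithmic derivative of `X ^ e * Z = Y ^ m`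
  have h1 : (e : Lau k) * (Y * E X) = m * (X * E Y) := by
    have h2 : X ^ e * Z = Y ^ m := vx_pow_mul_zbar
    have h3 := congrArg E h2
    rw [Derivation.leibniz, hz, smul_zero, zero_add, smul_eq_mul] at h3
    have h4 : Y ^ m * (e * (Y * E X)) = Y ^ m * (m * (X * E Y)) := by
      have h5 := hpow X e
      have h6 := hpow Y m
      linear_combination (-(Z * Y)) * h5 + X * h6 + X * Y * h3 - e * Y * E X * h2
    exact mul_left_cancel₀ (pow_ne_zero _ hY0) h4
  have h7 : X ^ n * Y = hh k d r := vx_pow_mul_ybar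
  obtain ⟨N, rfl⟩ : ∃ N, n = N + 1 := ⟨n - 1, by omega⟩
  have h8 : E (hh k d r) = X ^ N * ((N + 1) * (Y * E X) + X * E Y) := by
    rw [← h7, Derivation.leibniz, Derivation.leibniz_pow, Nat.add_sub_cancel]
    simp only [smul_eq_mul, nsmul_eq_mul]
    push_cast
    ring
  have h9 : m * E (hh k d r) = X ^ N * ((m * (N + 1) + e) * (Y * E X)) := by
    rw [h8]
    linear_combination (-(X ^ N)) * h1
  set C : Lau k := algebraMap k (Lau k) (m : k)⁻¹ with hC
  have hCE : E (hh k d r) = C * (X ^ N * ((m * (N + 1) + e) * (Y * E X))) := by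
    rw [← h9, ← mul_assoc, hinv, one_mul]
  have hnat : ∀ N : ℕ, (N : Lau k) ∈ nil E := fun N => natCast_mem _ N
  -- `E (hh k d r) ^ 2` is a constant times `X ^ (2 * n - 2) * Y ^ 2 * E X ^ 2`, to be divided by `X
  -- ^ n * Y`. For `n ≥ 2` there are enough factors `X`. For `n = 1` one has `e ≠ 0`, and the
  -- missing `X` comes from `h1`, which rewrites `Y * E X` as `(m / e) * X * E Y`.
  rcases Nat.eq_zero_or_pos N with rfl | hN
  · have he : e ≠ 0 := by
      rintro rfl
      exact hne rfl
    have hinve : algebraMap k (Lau k) (e : k)⁻¹ * e = 1 := by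
      rw [← map_natCast (algebraMap k (Lau k)) e, ← map_mul,
        inv_mul_cancel₀ (Nat.cast_ne_zero.2 he), map_one]
    refine ⟨algebraMap k (Lau k) (e : k)⁻¹ * (C ^ 2 * (m + e) ^ 2 * m * E X * E Y), ?_, ?_⟩
    · exact mul_mem (halg _) (mul_mem (mul_mem (mul_mem (mul_mem (pow_mem (halg _) 2)
        (pow_mem (add_mem (hnat _) (hnat _)) 2)) (hnat _)) (map_mem_nil hx)) (map_mem_nil hy))
    · rw [hCE, ← h7]
      push_cast
      set I := algebraMap k (Lau k) (e : k)⁻¹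
      linear_combination (I * C ^ 2 * (m + e) ^ 2 * Y * E X) * h1 -
        (C ^ 2 * (m + e) ^ 2 * Y ^ 2 * E X ^ 2) * hinve
  · obtain ⟨M, rfl⟩ : ∃ M, N = M + 1 := ⟨N - 1, by omega⟩
    refine ⟨C ^ 2 * (X ^ M * ((m * (M + 1 + 1 : ℕ) + e : ℕ) ^ 2 * Y * E X ^ 2)), ?_, ?_⟩
    · exact mul_mem (pow_mem (halg _) 2) (mul_mem (pow_mem hx _) (mul_mem (mul_mem
        (pow_mem (hnat _) 2) hy) (pow_mem (map_mem_nil hx) 2)))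
    · rw [hCE, ← h7]
      push_cast
      ring

/-- If one of `s, t` is killed, `s ^ d + t ^ r` is a power of the other plus a kernel element, and
`map_eq_zero_of_pow_add` kills the other one too. -/
theorem derivation_eq_zero_of_vs_or_vt (hd : 2 ≤ d) (hr : 2 ≤ r) (hm : 1 ≤ m) (hn : 1 ≤ n)
    (hne : (n, e) ≠ (1, 0))
    (hx : vx k ∈ nil E) (hs : vs k ∈ nil E) (ht : vt k ∈ nil E) (hy : ybar k d r n ∈ nil E)
    (hz : E (zbar k d r m n e) = 0) (h : E (vs k) = 0 ∨ E (vt k) = 0) : E = 0 := by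
  obtain ⟨p, hp, h1⟩ := sq_map_hh (by omega) hm hn hne hx hy hz
  rcases h with h | h
  · refine derivation_eq_zero (by omega) hn hx hy h ?_
    rw [hh, add_comm] at h1
    exact map_eq_zero_of_pow_add hr ht (map_pow_eq_zero h d) (pow_ne_zero _ vs_ne_zero) hp h1
  · refine derivation_eq_zero (by omega) hn hx hy ?_ h
    rw [hh] at h1
    exact map_eq_zero_of_pow_add hd hs (map_pow_eq_zero h r) (pow_ne_zero _ vt_ne_zero) hp h1

theorem vs_pow_mul_mon_neg (N : ℕ) : (vs k ^ N * mon (0, -(N : ℤ), 0) : Lau k) = 1 := by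
  rw [vs_pow, mon_mul, ← mon_zero]; congr 1; ext <;> simp

theorem vt_pow_mul_mon_neg (N : ℕ) : (vt k ^ N * mon (0, 0, -(N : ℤ)) : Lau k) = 1 := by
  rw [vt_pow, mon_mul, ← mon_zero]; congr 1; ext <;> simp

theorem exists_eq_vs_pow_mul {f : Lau k} (hf : f ∈ polST k) {N : ℕ}
    (h : ∀ m, f.coeff m ≠ 0 → (N : ℤ) ≤ m.2.1) : ∃ g ∈ polST k, f = vs k ^ N * g := by
  refine ⟨mon (0, -(N : ℤ), 0) * f, mem_polST.2 fun m hm => ?_, ?_⟩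
  · rw [coeff_mon_mul] at hm
    have h1 := h _ hm
    have h2 := mem_polST.1 hf _ hm
    simp only [Prod.fst_sub, Prod.snd_sub] at h1 h2
    refine ⟨?_, ?_, ?_⟩ <;> omega
  · rw [← mul_assoc, vs_pow_mul_mon_neg, one_mul]

theorem exists_eq_vt_pow_mul {f : Lau k} (hf : f ∈ polST k) {N : ℕ}
    (h : ∀ m, f.coeff m ≠ 0 → (N : ℤ) ≤ m.2.2) : ∃ g ∈ polST k, f = vt k ^ N * g := by
  refine ⟨mon (0, 0, -(N : ℤ)) * f, mem_polST.2 fun m hm => ?_, ?_⟩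
  · rw [coeff_mon_mul] at hm
    have h1 := h _ hm
    have h2 := mem_polST.1 hf _ hm
    simp only [Prod.fst_sub, Prod.snd_sub] at h1 h2
    refine ⟨?_, ?_, ?_⟩ <;> omega
  · rw [← mul_assoc, vt_pow_mul_mon_neg, one_mul]

/-- A locally nilpotent derivation killing a nonconstant quasi-homogeneous polynomial in
`s, t` kills `s` or `t`. -/
theorem map_vs_or_vt_eq_zero (hd : 2 ≤ d) (hr : 2 ≤ r) (hdr : Nat.Coprime d r)
    (hs : vs k ∈ nil E) (ht : vt k ∈ nil E) {G : Lau k} (hG : G ∈ polST k) (hG0 : G ≠ 0)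
    {γ : ℤ ×ₗ ℤ} (hGγ : G ∈ whom k (wl d r) γ) (hEG : E G = 0) :
    (E (vs k) = 0 ∨ E (vt k) = 0) ∨ ∃ c : k, G = AddMonoidAlgebra.single 0 c := by
  have hcz : CharZero (Lau k) := charZero_of_injective_algebraMap (algebraMap k (Lau k)).injective
  have hle : polST k ≤ nil E := polST_le hs ht
  set W := (ofLex γ).2 with hW
  have hsupp : ∀ m, G.coeff m ≠ 0 → (m.1 = 0 ∧ 0 ≤ m.2.1 ∧ 0 ≤ m.2.2) ∧
      r * m.2.1 + d * m.2.2 = W := fun m hm => ⟨mem_polST.1 hG m hm, by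
    rw [hW, ← mem_whom.1 hGγ m hm]; rfl⟩
  have hd0 : (0 : ℤ) < d := by omega
  have hr0 : (0 : ℤ) < r := by omega
  by_cases hW0 : W = 0
  · right
    refine ⟨G.coeff 0, ?_⟩
    ext m
    rw [AddMonoidAlgebra.coeff_single, Finsupp.single_apply]
    split_ifs with h
    · rw [← h]
    · by_contra hm
      obtain ⟨⟨h1, h2, h3⟩, h4⟩ := hsupp m hm
      rw [hW0] at h4
      apply h
      have h5 := mul_nonneg hr0.le h2
      have h6 := mul_nonneg hd0.le h3
      have h7 : m.2.1 = 0 := (mul_eq_zero.1 (by omega : (r : ℤ) * m.2.1 = 0)).resolve_left hr0.ne'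
      have h8 : m.2.2 = 0 := (mul_eq_zero.1 (by omega : (d : ℤ) * m.2.2 = 0)).resolve_left hd0.ne'
      ext
      · exact h1.symm
      · exact h7.symm
      · exact h8.symm
  left
  by_cases hds : ∀ m, G.coeff m ≠ 0 → ((1 : ℕ) : ℤ) ≤ m.2.1
  · obtain ⟨g, hg, rfl⟩ := exists_eq_vs_pow_mul hG hds
    rw [pow_one] at hG0 hEG
    exact Or.inl (map_eq_zero_of_mul hs (hle hg) hG0 hEG).1
  by_cases hdt : ∀ m, G.coeff m ≠ 0 → ((1 : ℕ) : ℤ) ≤ m.2.2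
  · obtain ⟨g, hg, rfl⟩ := exists_eq_vt_pow_mul hG hdt
    rw [pow_one] at hG0 hEG
    exact Or.inr (map_eq_zero_of_mul ht (hle hg) hG0 hEG).1
  push Not at hds hdt
  obtain ⟨m₁, hm₁, hm₁'⟩ := hds
  obtain ⟨m₂, hm₂, hm₂'⟩ := hdt
  -- Since neither `s` nor `t` divides `G`, pure powers of both occur in it, so `d` and `r` divide
  -- the weight `W`. By coprimality all exponents of `s` are multiples of `d` and all exponents of
  -- `t` multiples of `r`. Hence `s * G_s` is divisible by `s ^ d` and `t * G_t` by `t ^ r`.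
  have hcop : IsCoprime (d : ℤ) (r : ℤ) := Nat.isCoprime_iff_coprime.2 hdr
  have hdW : (d : ℤ) ∣ W := by
    obtain ⟨⟨-, h2, -⟩, h4⟩ := hsupp m₁ hm₁
    have : m₁.2.1 = 0 := by omega
    rw [← h4, this, mul_zero, zero_add]
    exact dvd_mul_right _ _
  have hrW : (r : ℤ) ∣ W := by
    obtain ⟨⟨-, -, h3⟩, h4⟩ := hsupp m₂ hm₂
    have : m₂.2.2 = 0 := by omega
    rw [← h4, this, mul_zero, add_zero]
    exact dvd_mul_right _ _
  have heul : ∀ χ : ℤ × ℤ × ℤ →+ k, euler χ G ∈ polST k := fun χ => euler_mem_supported χ hG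
  obtain ⟨G₁, hG₁, h₁⟩ := exists_eq_vs_pow_mul (N := d) (heul (chi2 k)) <| by
    intro m hm
    rw [coeff_euler, chi2_apply] at hm
    obtain ⟨⟨-, h2, -⟩, h4⟩ := hsupp m (right_ne_zero_of_mul hm)
    have h5 : m.2.1 ≠ 0 := fun h => left_ne_zero_of_mul hm (by rw [h, Int.cast_zero])
    have h6 : (d : ℤ) ∣ m.2.1 := by
      refine hcop.dvd_of_dvd_mul_left ?_
      have : (r : ℤ) * m.2.1 = W - d * m.2.2 := by omega
      rw [this]
      exact dvd_sub hdW (dvd_mul_right _ _)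
    exact Int.le_of_dvd (by omega) h6
  obtain ⟨G₂, hG₂, h₂⟩ := exists_eq_vt_pow_mul (N := r) (heul (chi3 k)) <| by
    intro m hm
    rw [coeff_euler, chi3_apply] at hm
    obtain ⟨⟨-, -, h3⟩, h4⟩ := hsupp m (right_ne_zero_of_mul hm)
    have h5 : m.2.2 ≠ 0 := fun h => left_ne_zero_of_mul hm (by rw [h, Int.cast_zero])
    have h6 : (r : ℤ) ∣ m.2.2 := by
      refine hcop.symm.dvd_of_dvd_mul_left ?_
      have : (d : ℤ) * m.2.2 = W - r * m.2.1 := by omega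
      rw [this]
      exact dvd_sub hrW (dvd_mul_right _ _)
    exact Int.le_of_dvd (by omega) h6
  -- Euler's identity
  have heuler : r * (vs k ^ d * G₁) + d * (vt k ^ r * G₂) = (W : Lau k) * G := by
    rw [← h₁, ← h₂]
    have hc : ∀ (N : ℤ) (f : Lau k), (N : Lau k) * f = (N : k) • f := by
      intro N f
      rw [Algebra.smul_def, map_intCast]
    have e1 := hc r (euler (chi2 k) G)
    have e2 := hc d (euler (chi3 k) G)
    rw [Int.cast_natCast] at e1 e2
    rw [e1, e2, hc]
    ext m
    rw [AddMonoidAlgebra.coeff_add, AddMonoidAlgebra.coeff_smul, AddMonoidAlgebra.coeff_smul,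
      AddMonoidAlgebra.coeff_smul, Finsupp.add_apply, Finsupp.smul_apply, Finsupp.smul_apply,
      Finsupp.smul_apply, coeff_euler, coeff_euler, smul_eq_mul, smul_eq_mul, smul_eq_mul]
    by_cases hm : G.coeff m = 0
    · rw [hm]; ring
    · have := (hsupp m hm).2
      rw [← this, chi2_apply, chi3_apply]
      push_cast
      ring
  obtain ⟨a, b, c, hE⟩ : ∃ a b c, E = logDer a b c := ⟨_, _, _, eq_logDer E⟩
  have hEs : E (vs k) = b * vs k := by rw [hE, logDer_vs]
  have hEt : E (vt k) = c * vt k := by rw [hE, logDer_vt]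
  have hx0 : euler (chi1 k) G = 0 := by
    ext m
    rw [coeff_euler]
    by_cases hm : G.coeff m = 0
    · rw [hm, mul_zero]; rfl
    · rw [chi1_apply, (hsupp m hm).1.1, Int.cast_zero, zero_mul]; rfl
  rw [hE, logDer_apply, hx0, mul_zero, zero_add, h₁, h₂] at hEG
  obtain ⟨d', rfl⟩ : ∃ d', d = d' + 1 := ⟨d - 1, by omega⟩
  obtain ⟨r', rfl⟩ : ∃ r', r = r' + 1 := ⟨r - 1, by omega⟩
  have hker : vs k ^ d' * G₁ * E (vs k) + vt k ^ r' * G₂ * E (vt k) = 0 := by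
    rw [hEs, hEt, ← hEG]; ring
  -- The relation `E G = 0` and Euler's identity are linear equations in `G₁` and `G₂`; Cramer's
  -- rule expresses `W * G * E t` and `W * G * E s` through `ω`.
  set ω := (r' + 1 : ℕ) * vs k * E (vt k) - (d' + 1 : ℕ) * vt k * E (vs k) with hω
  have k1 : vs k ^ d' * G₁ * ω = W * G * E (vt k) := by
    rw [hω, ← heuler]
    linear_combination (-((d' + 1 : ℕ) * vt k)) * hker
  have k2 : vt k ^ r' * G₂ * (-ω) = W * G * E (vs k) := by
    rw [hω, ← heuler]
    linear_combination (-((r' + 1 : ℕ) * vs k)) * hker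
  by_contra hne
  push Not at hne
  have hωn : ω ∈ nil E := sub_mem (mul_mem (mul_mem (natCast_mem _ _) hs) (map_mem_nil ht))
    (mul_mem (mul_mem (natCast_mem _ _) ht) (map_mem_nil hs))
  obtain ⟨α, hα⟩ := exists_hasDeg (map_mem_nil hs) hne.1
  obtain ⟨β, hβ⟩ := exists_hasDeg (map_mem_nil ht) hne.2
  have hWG0 : (W : Lau k) * G ≠ 0 := mul_ne_zero (Int.cast_ne_zero.2 hW0) hG0
  have hEWG : E ((W : Lau k) * G) = 0 := by
    rw [map_mul_eq_zero (by rw [Derivation.map_intCast])]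
    rw [hE, logDer_apply, hx0, mul_zero, zero_add, h₁, h₂]
    exact hEG
  have r1 := hasDeg_algebraMap_mul hβ hEWG hWG0
  have r2 := hasDeg_algebraMap_mul hα hEWG hWG0
  rw [← k1] at r1
  rw [← k2] at r2
  obtain ⟨g1, hg1⟩ := exists_hasDeg (hle hG₁)
    (right_ne_zero_of_mul (left_ne_zero_of_mul r1.ne_zero))
  obtain ⟨g2, hg2⟩ := exists_hasDeg (hle hG₂)
    (right_ne_zero_of_mul (left_ne_zero_of_mul r2.ne_zero))
  obtain ⟨w1, hw1⟩ := exists_hasDeg hωn (right_ne_zero_of_mul r1.ne_zero)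
  obtain ⟨w2, hw2⟩ := exists_hasDeg (neg_mem hωn) (right_ne_zero_of_mul r2.ne_zero)
  -- As `G` has degree `0` and `d - 1, r - 1 ≥ 1`, the two identities give `deg s ≤ deg t - 1` and
  -- `deg t ≤ deg s - 1`.
  have u1 := (((hα.map_iff.pow d').mul hg1).mul hw1).unique r1
  have u2 := (((hβ.map_iff.pow r').mul hg2).mul hw2).unique r2
  have v1 : 1 * (α + 1) ≤ d' * (α + 1) := Nat.mul_le_mul_right _ (by omega)
  have v2 : 1 * (β + 1) ≤ r' * (β + 1) := Nat.mul_le_mul_right _ (by omega)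
  omega

end Core

/-! ### Kernels of locally nilpotent derivations lie in `k[x, s, t]`. -/

section KernelPolynomial

variable {k : Type*} [Field k] [CharZero k] {d r m n e : ℕ} {q : Lau k}
  {D : Derivation k (Lau k) (Lau k)}

theorem one_mem_leadForms : (1 : Lau k) ∈ leadForms d r m n e q 0 :=
  Submodule.mem_map.2 ⟨1, ⟨one_mem (Bsub d r m n e q), whom_le_wle one_mem_whom⟩,
    proj_of_mem_whom one_mem_whom⟩

theorem mul_mem_leadForms {γ γ' : ℤ ×ₗ ℤ} {u v : Lau k} (hu : u ∈ leadForms d r m n e q γ)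
    (hv : v ∈ leadForms d r m n e q γ') : u * v ∈ leadForms d r m n e q (γ + γ') := by
  obtain ⟨b, ⟨hb, hbγ⟩, rfl⟩ := Submodule.mem_map.1 hu
  obtain ⟨c, ⟨hc, hcγ⟩, rfl⟩ := Submodule.mem_map.1 hv
  exact Submodule.mem_map.2 ⟨b * c, ⟨(Bsub d r m n e q).mul_mem hb hc, mul_mem_wle hbγ hcγ⟩,
    proj_mul hbγ hcγ⟩

theorem mon_mem_leadForms {μ : ℤ × ℤ × ℤ} (h : mon μ ∈ Bsub d r m n e q) :
    mon μ ∈ leadForms d r m n e q (wl d r μ) :=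
  Submodule.mem_map.2 ⟨mon μ, ⟨h, whom_le_wle (mon_whom _ _)⟩, proj_of_mem_whom (mon_whom _ _)⟩

theorem hh_ne_single (hd : 1 ≤ d) (c : k) : hh k d r ≠ AddMonoidAlgebra.single 0 c := by
  intro h
  have h1 : (hh k d r).coeff (0, (d : ℤ), 0) = 1 := by
    rw [hh, AddMonoidAlgebra.coeff_add, Finsupp.add_apply, vs_pow, vt_pow, coeff_mon, coeff_mon,
      if_pos rfl, if_neg, add_zero]
    intro h2
    have : (0 : ℤ) = d := congrArg (fun m : ℤ × ℤ × ℤ => m.2.1) h2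
    omega
  rw [h, AddMonoidAlgebra.coeff_single, Finsupp.single_apply, if_neg] at h1
  · exact zero_ne_one h1
  · intro h2
    have : (0 : ℤ) = d := congrArg (fun m : ℤ × ℤ × ℤ => m.2.1) h2
    omega

/-- The derivation `h_t ∂_s - h_s ∂_t` for `h = s ^ d + t ^ r`. -/
noncomputable def hamil (k : Type*) [Field k] (d r : ℕ) : Derivation k (Lau k) (Lau k) :=
  logDer 0 ((r : Lau k) * vt k ^ (r - 1) * mon (-(0, 1, 0)))
    (-((d : Lau k) * vs k ^ (d - 1) * mon (-(0, 0, 1))))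

theorem hamil_vs : hamil k d r (vs k) = r * vt k ^ (r - 1) := by
  rw [hamil, logDer_vs, mul_assoc, mul_comm (mon _), vs, mon_mul_neg, mul_one]

theorem hamil_vt : hamil k d r (vt k) = -(d * vs k ^ (d - 1)) := by
  rw [hamil, logDer_vt, neg_mul, mul_assoc, mul_comm (mon _), vt, mon_mul_neg, mul_one]

theorem logDer_mon_x (b c : Lau k) (i : ℤ) : logDer 0 b c (mon (i, 0, 0)) = 0 := by
  simp [logDer_apply, euler_mon]

theorem hamil_hh : hamil k d r (hh k d r) = 0 := by
  rw [hh, map_add, Derivation.leibniz_pow, Derivation.leibniz_pow, hamil_vs, hamil_vt]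
  simp only [smul_eq_mul, nsmul_eq_mul]
  ring

theorem hamil_ybar : hamil k d r (ybar k d r n) = 0 :=
  map_mul_eq_zero (logDer_mon_x _ _ _) hamil_hh

theorem hamil_zbar : hamil k d r (zbar k d r m n e) = 0 :=
  map_mul_eq_zero (logDer_mon_x _ _ _) (map_pow_eq_zero hamil_ybar _)

/-- The kernel of a nonzero locally nilpotent derivation of the ring consists of polynomials
in `x, s, t`. -/
theorem mem_polX_of_map_eq_zero (hd : 2 ≤ d) (hr : 2 ≤ r) (hdr : Nat.Coprime d r) (hm : 1 ≤ m)
    (hn : 1 ≤ n) (hne : (n, e) ≠ (1, 0)) (hq : q ∈ polX k) (hD : D ≠ 0)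
    (hst : ∀ b ∈ Bsub d r m n e q, D b ∈ Bsub d r m n e q) (hnil : Bsub d r m n e q ≤ nil D)
    {b : Lau k} (hb : b ∈ Bsub d r m n e q) (hDb : D b = 0) : b ∈ polX k := by
  by_contra hbp
  have hd1 : 1 ≤ d := by omega
  obtain ⟨E, δ, hE0, hlead⟩ := exists_isLeading (wl d r) hD
  have hmon : ∀ {μ}, (mon μ : Lau k) ∈ Bsub d r m n e q → mon μ ∈ nil E := fun {μ} h => by
    have := hlead.proj_mem_nil (whom_le_wle (mon_whom (wl d r) μ)) (hnil h)
    rwa [proj_of_mem_whom (mon_whom _ _)] at this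
  have hx : vx k ∈ nil E := hmon vx_mem
  have hs : vs k ∈ nil E := hmon vs_mem
  have ht : vt k ∈ nil E := hmon vt_mem
  have hy : ybar k d r n ∈ nil E := by
    obtain ⟨γ, h1, h2⟩ := yy_leading_lex (d := d) (r := r) (n := n) hq
    rw [← h2]
    exact hlead.proj_mem_nil h1 (hnil yy_mem)
  have hz : zbar k d r m n e ∈ nil E := by
    obtain ⟨γ, h1, h2⟩ := zz_leading_lex (d := d) (r := r) (e := e) hm hn hq
    rw [← h2]
    exact hlead.proj_mem_nil h1 (hnil zz_mem)
  have hGn : polST k ≤ nil E := polST_le hs ht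
  -- The leading form of the non-polynomial kernel element `b` contains a factor `ybar` or `zbar`.
  -- That factor is killed, and killing `ybar` kills `zbar` because `x ^ e * zbar = ybar ^ m`.
  have hEz : E (zbar k d r m n e) = 0 := by
    have hb0 : b ≠ 0 := by
      rintro rfl
      exact hbp (zero_mem _)
    obtain ⟨γ, hγ, hγ0⟩ := exists_top (w := wl d r) hb0
    have hu : proj (wl d r) γ b ∈ leadForms d r m n e q γ := Submodule.mem_map.2 ⟨b, ⟨hb, hγ⟩, rfl⟩
    have hEu : E (proj (wl d r) γ b) = 0 := by
      rw [← (hlead hγ).2, hDb, map_zero]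
    obtain ⟨a, α, G, γ', hG, -, hu', ha⟩ := exists_leadForm hd1 hm hn hq hu hγ0
    have hpos : 0 < (ofLex γ).1 := by
      by_contra hle
      apply hbp
      obtain ⟨j', a', α', g', hg', hg0', -, hbj', hp', hj'⟩ := exists_leading (e := e) hm hn hq hb hb0
      apply hj'
      by_contra hj0
      have hpj : proj wx j' b ≠ 0 := by
        rw [hp']
        exact mul_ne_zero (mul_ne_zero (mon_ne_zero _) (pow_ne_zero _ (hh_ne_zero hd1))) hg0'
      obtain ⟨μ, hμ⟩ : ∃ μ, (proj wx j' b).coeff μ ≠ 0 := by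
        by_contra h
        push Not at h
        exact hpj (AddMonoidAlgebra.ext (Finsupp.ext h))
      have h3 := mem_wle.1 hγ _ (coeff_proj_ne_zero hμ)
      have h4 : -μ.1 = j' := mem_whom.1 (proj_mem_whom wx j' b) _ hμ
      rw [wl_apply, Prod.Lex.le_iff] at h3
      change -μ.1 < (ofLex γ).1 ∨ -μ.1 = (ofLex γ).1 ∧ _ at h3
      omega
    have ha1 := ha hpos
    rw [hu'] at hEu hγ0
    have hyz := mul_mem (pow_mem hy (a % m)) (pow_mem hz (a / m))
    have h1 := (map_eq_zero_of_mul (mul_mem (pow_mem hx α) hyz) (hGn hG) hγ0 hEu).1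
    have h2 := left_ne_zero_of_mul hγ0
    have h3 := (map_eq_zero_of_mul (pow_mem hx α) hyz h2 h1).2
    obtain ⟨h4, h5⟩ := map_eq_zero_of_mul (pow_mem hy _) (pow_mem hz _) (right_ne_zero_of_mul h2) h3
    by_cases hc : a / m = 0
    · have hmod : a % m ≠ 0 := by
        intro h
        have := Nat.div_add_mod a m
        rw [hc, h] at this
        omega
      have h6 := map_eq_zero_of_pow hy hmod h4
      have h7 := map_pow_eq_zero h6 m
      rw [← vx_pow_mul_zbar (e := e)] at h7
      exact (map_eq_zero_of_mul (pow_mem hx e) hz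
        (mul_ne_zero (pow_ne_zero _ vx_ne_zero) (zbar_ne_zero hd1)) h7).2
    · exact map_eq_zero_of_pow hz hc h5
  have hst0 : ¬(E (vs k) = 0 ∨ E (vt k) = 0) := fun h =>
    hE0 (derivation_eq_zero_of_vs_or_vt hd hr hm hn hne hx hs ht hy hEz h)
  have hLnil : ∀ {γ u}, u ∈ leadForms d r m n e q γ → u ∈ nil E := by
    intro γ u hu
    obtain ⟨c, ⟨hc, hcγ⟩, rfl⟩ := Submodule.mem_map.1 hu
    exact hlead.proj_mem_nil hcγ (hnil hc)
  -- Homogeneous kernel elements of `E` are constant multiples of monomials in `x, ybar, zbar`, all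
  -- killed by `hamil`. Proportionality, evaluated on `x` and `s`, then gives `E x = 0`, since
  -- `hamil` kills `x` but not `s`.
  have hprop := proportional_of_kills_kernel (leadForms d r m n e q) one_mem_leadForms
    mul_mem_leadForms E (hamil k d r) δ
    (by
      intro γ u hu
      obtain ⟨c, ⟨hc, hcγ⟩, rfl⟩ := Submodule.mem_map.1 hu
      exact Submodule.mem_map.2 ⟨D c, ⟨hst c hc, (hlead hcγ).1⟩, (hlead hcγ).2⟩)
    hLnil
    (by
      intro γ u hu hEu
      by_cases hu0 : u = 0
      · rw [hu0, map_zero]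
      obtain ⟨a, α, G, γ', hG, hGγ, rfl, -⟩ := exists_leadForm hd1 hm hn hq hu hu0
      have hyz := mul_mem (pow_mem hx α) (mul_mem (pow_mem hy (a % m)) (pow_mem hz (a / m)))
      have hEG := (map_eq_zero_of_mul hyz (hGn hG) hu0 hEu).2
      obtain ⟨c, rfl⟩ := (map_vs_or_vt_eq_zero hd hr hdr hs ht hG (right_ne_zero_of_mul hu0) hGγ
        hEG).resolve_left hst0
      refine map_mul_eq_zero (map_mul_eq_zero (map_pow_eq_zero (logDer_mon_x _ _ _) _)
        (map_mul_eq_zero (map_pow_eq_zero hamil_ybar _) (map_pow_eq_zero hamil_zbar _))) ?_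
      rw [single_eq_smul_mon, mon_zero, Derivation.map_smul, Derivation.map_one_eq_zero, smul_zero])
    (mon_mem_leadForms vx_mem) (mon_mem_leadForms vs_mem)
  have hcz : CharZero (Lau k) := charZero_of_injective_algebraMap (algebraMap k (Lau k)).injective
  have hEx : E (vx k) = 0 := by
    change hamil k d r (vx k) * E (vs k) = hamil k d r (vs k) * E (vx k) at hprop
    rw [show hamil k d r (vx k) = 0 from logDer_mon_x _ _ _, zero_mul, hamil_vs] at hprop
    exact (mul_eq_zero.1 hprop.symm).resolve_left
      (mul_ne_zero (Nat.cast_ne_zero.2 (by omega)) (pow_ne_zero _ vt_ne_zero))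
  -- `hh ^ m = x ^ (n * m) * x ^ e * zbar` is a product of killed elements.
  have hEh : E (hh k d r) = 0 := by
    refine map_eq_zero_of_pow (hGn hh_mem_polST) (by omega : m ≠ 0) ?_
    rw [← vx_pow_mul_ybar (n := n), mul_pow, ← vx_pow_mul_zbar (e := e)]
    exact map_mul_eq_zero (map_pow_eq_zero (map_pow_eq_zero hEx _) _)
      (map_mul_eq_zero (map_pow_eq_zero hEx _) hEz)
  obtain ⟨c, hc⟩ := (map_vs_or_vt_eq_zero hd hr hdr hs ht hh_mem_polST (hh_ne_zero hd1) hh_whom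
    hEh).resolve_left hst0
  exact hh_ne_single hd1 c hc

end KernelPolynomial

/-! ### Every locally nilpotent derivation kills `x`. -/

section KernelX

variable {k : Type*} [Field k] [CharZero k] {d r m n e : ℕ} {q : Lau k}
  {D : Derivation k (Lau k) (Lau k)}

theorem proj_zero_mem_polST {f : Lau k} (hf : f ∈ polX k) : proj wx 0 f ∈ polST k := by
  have := mon_mul_mem_polST (proj_mem_polX wx 0 hf) (proj_mem_whom wx 0 f)
  rwa [show ((0, 0, 0) : ℤ × ℤ × ℤ) = 0 from rfl, mon_zero, one_mul] at this

theorem proj_aeval {ι : Type*} {f : ι → Lau k} (hf : ∀ i, f i ∈ polX k) (p : MvPolynomial ι k) :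
    MvPolynomial.aeval f p ∈ polX k ∧ proj wx 0 (MvPolynomial.aeval f p) =
      MvPolynomial.aeval (fun i => proj wx 0 (f i)) p := by
  induction p using MvPolynomial.induction_on with
  | C c =>
    rw [MvPolynomial.aeval_C, MvPolynomial.aeval_C]
    refine ⟨(polX k).algebraMap_mem c, ?_⟩
    rw [Algebra.algebraMap_eq_smul_one, map_smul, proj_of_mem_whom one_mem_whom]
  | add p p' h1 h2 =>
    rw [map_add, map_add, map_add, h1.2, h2.2]
    exact ⟨add_mem h1.1 h2.1, rfl⟩
  | mul_X p i h =>
    rw [map_mul, MvPolynomial.aeval_X, map_mul (MvPolynomial.aeval _) p, MvPolynomial.aeval_X]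
    refine ⟨mul_mem h.1 (hf i), ?_⟩
    have := proj_mul (polX_wle h.1) (polX_wle (hf i))
    rw [add_zero] at this
    rw [this, h.2]

/-- The upper bound suffices to make any two algebraically independent elements a transcendence
basis. -/
theorem trdeg_polST_le : Algebra.trdeg k (polST k) ≤ 2 := by
  classical
  let S : Set (polST k) := {⟨vs k, vs_mem_polST⟩, ⟨vt k, vt_mem_polST⟩}
  have htop : Algebra.adjoin k S = ⊤ := by
    rw [eq_top_iff]
    rintro ⟨f, hf⟩ -
    have h : polST k ≤ (Algebra.adjoin k S).map (polST k).val :=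
      polST_le ⟨_, Algebra.subset_adjoin (Or.inl rfl), rfl⟩
        ⟨_, Algebra.subset_adjoin (Or.inr rfl), rfl⟩
    obtain ⟨g, hg, hgf⟩ := h hf
    have : g = ⟨f, hf⟩ := Subtype.ext hgf
    rwa [← this]
  have : Algebra.IsAlgebraic (Algebra.adjoin k S) (polST k) := by
    refine ⟨fun f => ?_⟩
    have hf : f ∈ Algebra.adjoin k S := by rw [htop]; trivial
    exact isAlgebraic_algebraMap (⟨f, hf⟩ : Algebra.adjoin k S)
  refine (Algebra.IsAlgebraic.trdeg_le_cardinalMk k S).trans ?_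
  have h2 := Cardinal.mk_insert_le (s := {(⟨vt k, vt_mem_polST⟩ : polST k)})
    (a := ⟨vs k, vs_mem_polST⟩)
  rw [Cardinal.mk_singleton] at h2
  exact h2.trans (le_of_eq one_add_one_eq_two)

/-- A pair of elements as a family indexed by `Option Unit`. -/
def pair {A : Type*} (f g : A) : Option Unit → A := fun o => o.elim g fun _ => f

/-- A derivation killing two algebraically independent elements of `k[s, t]` kills `s` and `t`. -/
theorem map_eq_zero_of_algebraicIndependent {E : Derivation k (Lau k) (Lau k)} {f g : Lau k}
    (hf : f ∈ polST k) (hg : g ∈ polST k) (hfg : AlgebraicIndependent k (pair f g))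
    (hEf : E f = 0) (hEg : E g = 0) : E (vs k) = 0 ∧ E (vt k) = 0 := by
  let p : Option Unit → polST k := pair ⟨f, hf⟩ ⟨g, hg⟩
  have hp : AlgebraicIndependent k p := by
    refine AlgebraicIndependent.of_comp (polST k).val ?_
    convert hfg using 1
    ext1 o
    cases o <;> rfl
  have htb : IsTranscendenceBasis k p := by
    refine hp.isTranscendenceBasis_of_lift_trdeg_le_of_finite ?_
    rw [Cardinal.mk_fintype]
    refine (Cardinal.lift_le.2 trdeg_polST_le).trans ?_
    simp
  have halg := htb.isAlgebraic
  have hker : ∀ c ∈ Algebra.adjoin k (Set.range p), E (c : Lau k) = 0 := by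
    intro c hc
    induction hc using Algebra.adjoin_induction with
    | mem c hc =>
      obtain ⟨o, rfl⟩ := hc
      cases o
      · exact hEg
      · exact hEf
    | algebraMap z => exact E.map_algebraMap z
    | add a b _ _ h1 h2 => exact (map_add E (a : Lau k) b).trans (by rw [h1, h2, add_zero])
    | mul a b _ _ h1 h2 => exact map_mul_eq_zero h1 h2
  have key : ∀ u : polST k, E u = 0 := by
    intro u
    refine derivation_eq_zero_of_isAlgebraic (R := polST k) (A := Lau k) ?_
      (E.compAlgebraMap (polST k)) (Algebra.adjoin k (Set.range p)) hker (halg.isAlgebraic u)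
    intro c a h
    have h : (c : Lau k) * a = 0 := h
    exact (mul_eq_zero.1 h).imp_left fun h => Subtype.ext h
  exact ⟨key ⟨_, vs_mem_polST⟩, key ⟨_, vt_mem_polST⟩⟩

/-- A nonzero locally nilpotent derivation of the ring kills `x`. -/
theorem map_vx_eq_zero_of_nil (hd : 2 ≤ d) (hr : 2 ≤ r) (hdr : Nat.Coprime d r) (hm : 1 ≤ m)
    (hn : 1 ≤ n) (hne : (n, e) ≠ (1, 0)) (hq : q ∈ polX k) (hD : D ≠ 0)
    (hst : ∀ b ∈ Bsub d r m n e q, D b ∈ Bsub d r m n e q) (hnil : Bsub d r m n e q ≤ nil D) :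
    D (vx k) = 0 := by
  by_contra hDx
  have hker : ∀ b ∈ Bsub d r m n e q, D b = 0 → b ∈ polX k := fun b hb hDb =>
    mem_polX_of_map_eq_zero hd hr hdr hm hn hne hq hD hst hnil hb hDb
  have hd1 : 1 ≤ d := by omega
  obtain ⟨E, δ, hE0, hlead⟩ := exists_isLeading wx hD
  have hx : vx k ∈ nil E := by
    have := hlead.proj_mem_nil (whom_le_wle (mon_whom wx (1, 0, 0))) (hnil vx_mem)
    rwa [proj_of_mem_whom (mon_whom _ _)] at this
  have hy : ybar k d r n ∈ nil E := by
    obtain ⟨h1, h2, h3⟩ := wx_hyp (d := d) (r := r) hq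
    obtain ⟨h4, h5⟩ := yy_leading (n := n) h1 h2 h3
    rw [← h5]
    exact hlead.proj_mem_nil h4 (hnil yy_mem)
  -- Reduction modulo `x` is injective on the kernel: a nonzero kernel element divisible by `x` in
  -- `k[x, s, t]` would force `D x = 0`.
  have hinj : ∀ b ∈ Bsub d r m n e q, D b = 0 → proj wx 0 b = 0 → b = 0 := by
    intro b hb hDb hb0
    by_contra hbne
    have hbp := hker b hb hDb
    have hc : mon (-1, 0, 0) * b ∈ polX k := by
      rw [mem_polX]
      intro μ hμ
      rw [coeff_mon_mul] at hμ
      have h1 := mem_polX.1 hbp _ hμ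
      have h2 : (μ - (-1, 0, 0)).1 ≠ 0 := by
        intro h
        have h3 := coeff_proj wx 0 b (μ - (-1, 0, 0))
        rw [hb0, wx_apply, h, if_pos neg_zero] at h3
        exact hμ h3.symm
      simp only [Prod.fst_sub, Prod.snd_sub] at h1 h2
      refine ⟨?_, ?_, ?_⟩ <;> omega
    have hb' : b = vx k * (mon (-1, 0, 0) * b) := by
      rw [← mul_assoc, vx, mon_mul]
      exact (one_mul b).symm
    rw [hb'] at hDb hbne
    exact hDx (map_eq_zero_of_mul (hnil vx_mem) (hnil (polX_le_Bsub hc)) hbne hDb).1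
  -- The reductions of two algebraically independent kernel elements would be algebraically
  -- independent in `k[s, t]` and killed by `E`; then `E` kills `s` and `t`, hence `E = 0`.
  have hdep : ∀ b ∈ Bsub d r m n e q, ∀ c ∈ Bsub d r m n e q, D b = 0 → D c = 0 →
      ¬AlgebraicIndependent k (pair b c) := by
    intro b hb c hc hDb hDc hind
    have hbp := hker b hb hDb
    have hcp := hker c hc hDc
    have hpp : ∀ o, pair b c o ∈ polX k := by rintro (_ | _) <;> assumption
    have hind0 : AlgebraicIndependent k (pair (proj wx 0 b) (proj wx 0 c)) := by
      rw [algebraicIndependent_iff] at hind ⊢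
      intro p hp
      apply hind
      have h1 := proj_aeval hpp p
      apply hinj _ (polX_le_Bsub h1.1)
      · refine MvPolynomial.induction_on (motive := fun p => D (MvPolynomial.aeval (pair b c) p) = 0)
          p ?_ ?_ ?_
        · intro z
          rw [MvPolynomial.aeval_C, Derivation.map_algebraMap]
        · intro p p' h1 h2
          rw [map_add, map_add, h1, h2, add_zero]
        · intro p i h
          rw [map_mul, MvPolynomial.aeval_X]
          refine map_mul_eq_zero h ?_
          cases i <;> assumption
      · rw [h1.2, ← hp]
        congr 2
        ext1 o
        cases o <;> rfl
    have hE : ∀ {f}, f ∈ polX k → D f = 0 → E (proj wx 0 f) = 0 := fun hf hDf => by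
      rw [← (hlead (polX_wle hf)).2, hDf, map_zero]
    obtain ⟨h1, h2⟩ := map_eq_zero_of_algebraicIndependent (proj_zero_mem_polST hbp)
      (proj_zero_mem_polST hcp) hind0 (hE hbp hDb) (hE hcp hDc)
    exact hE0 (derivation_eq_zero hd1 hn hx hy h1 h2)
  -- A derivation that kills the kernel of `D` is proportional to `D`; if it also kills `x`, while
  -- `D x ≠ 0`, it vanishes. The grading is trivial here. The rest of the proof constructs a nonzero
  -- derivation of this kind.
  have hprop : ∀ b c : Lau k, (∀ u ∈ Bsub d r m n e q, D u = 0 → logDer 0 b c u = 0) →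
      b = 0 ∧ c = 0 := by
    intro b c hT
    have h : ∀ v ∈ Bsub d r m n e q, logDer 0 b c v * D (vx k) = 0 := by
      intro v hv
      have := proportional_of_kills_kernel (Γ := Unit)
        (fun _ => Subalgebra.toSubmodule (Bsub d r m n e q)) (one_mem (Bsub d r m n e q))
        (fun hu hv => (Bsub d r m n e q).mul_mem hu hv) D (logDer 0 b c) ()
        (fun {_ u} hu => hst u hu) (fun {_ u} hu => hnil hu) (fun {_ u} hu h => hT u hu h)
        (γ := ()) (γ' := ()) (u := v) (v := vx k) hv vx_mem
      rw [this, logDer_vx, zero_mul, zero_mul]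
    have h1 := (mul_eq_zero.1 (h _ vs_mem)).resolve_right hDx
    have h2 := (mul_eq_zero.1 (h _ vt_mem)).resolve_right hDx
    rw [logDer_vs] at h1
    rw [logDer_vt] at h2
    exact ⟨(mul_eq_zero.1 h1).resolve_right vs_ne_zero, (mul_eq_zero.1 h2).resolve_right vt_ne_zero⟩
  by_cases hconst : ∀ f ∈ Bsub d r m n e q, D f = 0 → euler (chi2 k) f = 0
  · have := (hprop 1 0 fun u hu hDu => by
      rw [logDer_apply, hconst u hu hDu]; ring).1
    exact one_ne_zero this
  push Not at hconst
  obtain ⟨f, hf, hDf, hf0⟩ := hconst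
  have hann : ∀ (T : Derivation k (Lau k) (Lau k)) (K : Subalgebra k (Lau k)) (g : Lau k),
      (∀ c ∈ K, T c = 0) → IsAlgebraic K g → T g = 0 := fun T K g hK hg =>
    derivation_eq_zero_of_isAlgebraic (R := Lau k) (A := Lau k)
      (fun c a h => mul_eq_zero.1 (by rwa [smul_eq_mul] at h)) T K hK hg
  have htr : Transcendental k f := by
    intro halg
    apply hf0
    refine hann _ ⊥ f ?_ ?_
    · intro c hc
      obtain ⟨z, rfl⟩ := Algebra.mem_bot.1 hc
      exact Derivation.map_algebraMap _ z
    · exact halg.extendScalars (algebraMap k (⊥ : Subalgebra k (Lau k))).injective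
  -- The coefficients are chosen so that this derivation kills `f`. By `hdep` every kernel element
  -- is algebraic over `k[f]`, hence is killed as well.
  have hT := hprop (-euler (chi3 k) f) (euler (chi2 k) f) <| by
    intro g hg hDg
    have hfi : AlgebraicIndependent k (fun _ : Unit => f) :=
      (algebraicIndependent_unique_type_iff).2 htr
    have hnot := hdep f hf g hg hDf hDg
    have hopt := hfi.option_iff_transcendental g
    have hgalg : IsAlgebraic (Algebra.adjoin k (Set.range fun _ : Unit => f)) g := by
      by_contra h
      exact hnot (hopt.2 h)
    refine hann _ _ g ?_ hgalg
    intro c hc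
    refine Algebra.adjoin_induction
      (p := fun c _ => logDer 0 (-euler (chi3 k) f) (euler (chi2 k) f) c = 0) ?_ ?_ ?_ ?_ hc
    · rintro _ ⟨_, rfl⟩
      rw [logDer_apply]
      ring
    · intro z
      exact Derivation.map_algebraMap _ z
    · intro a b _ _ h1 h2
      rw [map_add, h1, h2, add_zero]
    · intro a b _ _ h1 h2
      exact map_mul_eq_zero h1 h2
  exact hf0 hT.2

end KernelX

/-! ### The derivations `f ∂_s + g ∂_t`, and which of them preserve the ring. -/

section ExplicitDerivations

variable {k : Type*} [Field k] {d r m n e : ℕ} {q : Lau k}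

/-- The derivation `f ∂_s + g ∂_t`. -/
noncomputable def dST (f g : Lau k) : Derivation k (Lau k) (Lau k) :=
  logDer 0 (f * mon (-(0, 1, 0))) (g * mon (-(0, 0, 1)))

theorem dST_mon_x (f g : Lau k) (i : ℤ) : dST f g (mon (i, 0, 0)) = 0 := by
  simp [dST, logDer_apply, euler_mon]

theorem dST_vx (f g : Lau k) : dST f g (vx k) = 0 := dST_mon_x _ _ _

theorem dST_vs (f g : Lau k) : dST f g (vs k) = f := by
  rw [dST, logDer_vs, mul_assoc, mul_comm (mon _), vs, mon_mul_neg, mul_one]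

theorem dST_vt (f g : Lau k) : dST f g (vt k) = g := by
  rw [dST, logDer_vt, mul_assoc, mul_comm (mon _), vt, mon_mul_neg, mul_one]

theorem dST_apply (f g p : Lau k) : dST f g p = f * dST 1 0 p + g * dST 0 1 p := by
  simp only [dST, logDer_apply]
  ring

theorem map_mem_of_generators {K : Subalgebra k (Lau k)} (D : Derivation k (Lau k) (Lau k))
    {S : Set (Lau k)} (hS : ∀ s ∈ S, D s ∈ K) (hSK : Algebra.adjoin k S ≤ K) {b : Lau k}
    (hb : b ∈ Algebra.adjoin k S) : D b ∈ K := by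
  induction hb using Algebra.adjoin_induction with
  | mem b hb => exact hS b hb
  | algebraMap z => rw [Derivation.map_algebraMap]; exact zero_mem _
  | add a b _ _ h1 h2 => rw [map_add]; exact add_mem h1 h2
  | mul a b ha hb h1 h2 =>
    rw [Derivation.leibniz, smul_eq_mul, smul_eq_mul]
    exact add_mem (mul_mem (hSK ha) h2) (mul_mem (hSK hb) h1)

theorem map_mem_Bsub (D : Derivation k (Lau k) (Lau k)) (hx : D (vx k) ∈ Bsub d r m n e q)
    (hy : D (yy d r n q) ∈ Bsub d r m n e q) (hz : D (zz d r m n e q) ∈ Bsub d r m n e q)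
    (ht : D (vt k) ∈ Bsub d r m n e q) {b : Lau k} (hb : b ∈ Bsub d r m n e q) :
    D b ∈ Bsub d r m n e q := by
  refine map_mem_of_generators D ?_ le_rfl hb
  rintro _ (rfl | rfl | rfl | rfl) <;> assumption

theorem dST_mem_polX {f g p : Lau k} (hf : f ∈ polX k) (hg : g ∈ polX k) (hp : p ∈ polX k) :
    dST f g p ∈ polX k := by
  have h : Algebra.adjoin k {vx k, vs k, vt k} ≤ polX k := by
    refine Algebra.adjoin_le ?_
    rintro _ (rfl | rfl | rfl)
    exacts [vx_mem_polX, vs_mem_polX, vt_mem_polX]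
  refine map_mem_of_generators (S := {vx k, vs k, vt k}) _ ?_ h
    (polX_le (Algebra.subset_adjoin (by simp)) (Algebra.subset_adjoin (by simp))
      (Algebra.subset_adjoin (by simp)) hp)
  rintro _ (rfl | rfl | rfl)
  · rw [dST_vx]; exact zero_mem _
  · rwa [dST_vs]
  · rwa [dST_vt]

theorem dST_yy (f g : Lau k) : dST f g (yy d r n q) =
    mon (-(n : ℤ), 0, 0) * dST f g (hh k d r + vx k * q) := by
  rw [yy, Derivation.leibniz, dST_mon_x, smul_zero, add_zero, smul_eq_mul]

theorem dST_zz (f g : Lau k) : dST f g (zz d r m n e q) =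
    mon (-(e : ℤ), 0, 0) * ((m : Lau k) * yy d r n q ^ (m - 1) * dST f g (yy d r n q) - f) := by
  rw [zz, Derivation.leibniz, dST_mon_x, smul_zero, add_zero, smul_eq_mul, map_sub, dST_vs,
    Derivation.leibniz_pow, nsmul_eq_mul, smul_eq_mul, mul_assoc]

/-- The multiples of `x ^ (n + e) ∂_s` and `x ^ (n + e) ∂_t` preserve the ring. -/
theorem dST_mem_Bsub (hq : q ∈ polX k) {f g : Lau k} (hf : f ∈ Bsub d r m n e q)
    (hg : g ∈ Bsub d r m n e q) {b : Lau k} (hb : b ∈ Bsub d r m n e q) :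
    dST (vx k ^ (n + e) * f) (vx k ^ (n + e) * g) b ∈ Bsub d r m n e q := by
  set F := hh k d r + vx k * q with hF
  have hFp : F ∈ polX k := add_mem (polST_le_polX hh_mem_polST) (mul_mem vx_mem_polX hq)
  set u := f * dST 1 0 F + g * dST 0 1 F with hu
  have huB : u ∈ Bsub d r m n e q :=
    add_mem (mul_mem hf (polX_le_Bsub (dST_mem_polX (one_mem _) (zero_mem _) hFp)))
      (mul_mem hg (polX_le_Bsub (dST_mem_polX (zero_mem _) (one_mem _) hFp)))
  have hn := pow_mul_mon_neg (k := k) n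
  have he := pow_mul_mon_neg (k := k) e
  have hy : dST (vx k ^ (n + e) * f) (vx k ^ (n + e) * g) (yy d r n q) = vx k ^ e * u := by
    rw [dST_yy, ← hF, dST_apply, hu, pow_add]
    linear_combination (vx k ^ e * (f * dST 1 0 F + g * dST 0 1 F)) * hn
  have hz : dST (vx k ^ (n + e) * f) (vx k ^ (n + e) * g) (zz d r m n e q) =
      (m : Lau k) * yy d r n q ^ (m - 1) * u - vx k ^ n * f := by
    rw [dST_zz, hy, pow_add]
    linear_combination ((m : Lau k) * yy d r n q ^ (m - 1) * u - vx k ^ n * f) * he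
  refine map_mem_Bsub _ ?_ ?_ ?_ ?_ hb
  · rw [dST_vx]; exact zero_mem _
  · rw [hy]; exact mul_mem (pow_mem vx_mem _) huB
  · rw [hz]
    exact sub_mem (mul_mem (mul_mem (natCast_mem _ _) (pow_mem yy_mem _)) huB)
      (mul_mem (pow_mem vx_mem _) hf)
  · rw [dST_vt]; exact mul_mem (pow_mem vx_mem _) hg

variable [CharZero k]

/-- A power of the kernel element `x` carries each element of the ring into `k[x, s, t]`, so local
nilpotency need only be tested on `s` and `t`. -/
theorem Bsub_le_nil (hq : q ∈ polX k) {D : Derivation k (Lau k) (Lau k)} (hx : D (vx k) = 0)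
    (hs : vs k ∈ nil D) (ht : vt k ∈ nil D) : Bsub d r m n e q ≤ nil D := by
  intro b hb
  obtain ⟨N, hN⟩ := exists_pow_mul_mem hq hb
  exact mem_nil_of_mul_mem (map_pow_eq_zero hx N) (pow_ne_zero _ vx_ne_zero)
    (polX_le (mem_nil_of_map_eq_zero hx) hs ht hN)

theorem Bsub_le_nil_dST (hq : q ∈ polX k) {f g : Lau k} (hf : f ∈ Algebra.adjoin k {vx k})
    (hg : g ∈ Algebra.adjoin k {vx k}) : Bsub d r m n e q ≤ nil (dST f g) := by
  have h : ∀ p ∈ Algebra.adjoin k {vx k}, dST f g p = 0 := by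
    intro p hp
    induction hp using Algebra.adjoin_induction with
    | mem b hb => rw [Set.mem_singleton_iff.1 hb, dST_vx]
    | algebraMap z => exact Derivation.map_algebraMap _ z
    | add a b _ _ h1 h2 => rw [map_add, h1, h2, add_zero]
    | mul a b _ _ h1 h2 => exact map_mul_eq_zero h1 h2
  refine Bsub_le_nil hq (dST_vx _ _) (mem_nil_of_map_mem ?_) (mem_nil_of_map_mem ?_)
  · rw [dST_vs]; exact mem_nil_of_map_eq_zero (h f hf)
  · rw [dST_vt]; exact mem_nil_of_map_eq_zero (h g hg)

theorem dST_one_zero_hh : dST 1 0 (hh k d r) = (d : Lau k) * vs k ^ (d - 1) := by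
  rw [hh, map_add, Derivation.leibniz_pow, Derivation.leibniz_pow, dST_vs, dST_vt]
  simp

theorem dST_zero_one_hh : dST 0 1 (hh k d r) = (r : Lau k) * vt k ^ (r - 1) := by
  rw [hh, map_add, Derivation.leibniz_pow, Derivation.leibniz_pow, dST_vs, dST_vt]
  simp

/-- `∂_t` kills the right-hand side, so by factorial closedness it would kill `s ^ d + t ^ r`. -/
theorem not_hh_mul_eq (hr : 1 ≤ r) {c g : Lau k} {N : ℕ} (hg : g ∈ polST k)
    (hc : dST 0 1 c = 0) (hc0 : c ≠ 0) : hh k d r * g ≠ c * vs k ^ N := by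
  intro h
  have hcz : CharZero (Lau k) := charZero_of_injective_algebraMap (algebraMap k (Lau k)).injective
  have hle : polST k ≤ nil (dST 0 1 : Derivation k (Lau k) (Lau k)) := by
    refine polST_le (mem_nil_of_map_eq_zero (dST_vs _ _)) (mem_nil_of_map_mem ?_)
    rw [dST_vt]; exact one_mem _
  have h0 : hh k d r * g ≠ 0 := by
    rw [h]; exact mul_ne_zero hc0 (pow_ne_zero _ vs_ne_zero)
  have h1 : dST 0 1 (hh k d r * g) = 0 := by
    rw [h]; exact map_mul_eq_zero hc (map_pow_eq_zero (dST_vs _ _) _)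
  have h2 := (map_eq_zero_of_mul (hle hh_mem_polST) (hle hg) h0 h1).1
  rw [dST_zero_one_hh] at h2
  exact mul_ne_zero (Nat.cast_ne_zero.2 (by omega)) (pow_ne_zero _ vt_ne_zero) h2

/-- If `x ^ N ∂_s` preserves the ring then `n + e ≤ N`. -/
theorem le_of_dST_mem (hd : 1 ≤ d) (hr : 1 ≤ r) (hm : 1 ≤ m) (hn : 1 ≤ n) (hq : q ∈ polX k) {N : ℕ}
    (h : ∀ b ∈ Bsub d r m n e q, dST (vx k ^ N) 0 b ∈ Bsub d r m n e q) : n + e ≤ N := by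
  by_contra hN
  have hcz : CharZero (Lau k) := charZero_of_injective_algebraMap (algebraMap k (Lau k)).injective
  set F := hh k d r + vx k * q with hF
  have hb := h _ zz_mem
  have hJ : (0 : ℤ) < n + e - N := by omega
  set J : ℤ := n + e - N with hJdef
  have hbeq : dST (vx k ^ N) 0 (zz d r m n e q) =
      mon (-J, 0, 0) * ((m : Lau k) * (yy d r n q ^ (m - 1) * dST 1 0 F) - vx k ^ n) := by
    have h1 : mon (-J, 0, 0) * vx k ^ n = (mon (-(e : ℤ), 0, 0) * vx k ^ N : Lau k) := by
      rw [vx_pow, vx_pow, mon_mul, mon_mul]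
      congr 1
      ext
      · simp only [Prod.fst_add]; omega
      · simp
      · simp
    have h2 : (mon (-J, 0, 0) : Lau k) =
        mon (-(e : ℤ), 0, 0) * (mon (-(n : ℤ), 0, 0) * vx k ^ N) := by
      rw [vx_pow, mon_mul, mon_mul]
      congr 1
      ext
      · simp only [Prod.fst_add]; omega
      · simp
      · simp
    rw [dST_zz, dST_yy, dST_apply, zero_mul, add_zero, ← hF]
    linear_combination h1 - (m : Lau k) * yy d r n q ^ (m - 1) * dST 1 0 F * h2
  obtain ⟨h1, h2, h3⟩ := wx_hyp (d := d) (r := r) hq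
  obtain ⟨h4, h5⟩ := yy_leading (n := n) h1 h2 h3
  have h6 : dST 1 0 F ∈ wle k wx 0 ∧ proj wx 0 (dST 1 0 F) = (d : Lau k) * vs k ^ (d - 1) := by
    have h7 : dST 1 0 F = (d : Lau k) * vs k ^ (d - 1) + vx k * dST 1 0 q := by
      rw [hF, map_add, dST_one_zero_hh, Derivation.leibniz, dST_vx, smul_zero, add_zero,
        smul_eq_mul]
    obtain ⟨-, h8, h9⟩ := wx_hyp (d := d) (r := r)
      (dST_mem_polX (one_mem (polX k)) (zero_mem _) hq)
    have h10 : (d : Lau k) * vs k ^ (d - 1) ∈ whom k wx 0 :=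
      polST_whom (mul_mem (natCast_mem _ _) (pow_mem vs_mem_polST _))
    rw [h7]
    refine ⟨add_mem (whom_le_wle h10) h8, ?_⟩
    rw [map_add, h9, add_zero, proj_of_mem_whom h10]
  have h7 := mul_mem_wle (pow_mem_wle h4 (m - 1)) h6.1
  have h8 := proj_mul (pow_mem_wle h4 (m - 1)) h6.1
  have hw : (m - 1) • (wx (-(n : ℤ), 0, 0) + 0) + 0 = ((n * (m - 1) : ℕ) : ℤ) := by
    rw [wx_apply]
    simp
    ring
  rw [proj_pow h4, h5, h6.2, hw] at h8
  rw [hw] at h7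
  have hmw : (m : Lau k) ∈ whom k wx 0 := polST_whom (natCast_mem _ _)
  have hxn : vx k ^ n ∈ whom k wx (-(n : ℤ)) := by
    rw [vx_pow]; exact mon_whom wx _
  have hlt : (-(n : ℤ)) < ((n * (m - 1) : ℕ) : ℤ) := by
    have : (0 : ℤ) ≤ ((n * (m - 1) : ℕ) : ℤ) := Int.natCast_nonneg _
    omega
  have h9 : (m : Lau k) * (yy d r n q ^ (m - 1) * dST 1 0 F) - vx k ^ n ∈
      wle k wx ((n * (m - 1) : ℕ) : ℤ) := by
    refine sub_mem ?_ (wle_mono hlt.le (whom_le_wle hxn))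
    have := mul_mem_wle (whom_le_wle hmw) h7
    rwa [zero_add] at this
  have h10 : proj wx ((n * (m - 1) : ℕ) : ℤ) ((m : Lau k) * (yy d r n q ^ (m - 1) * dST 1 0 F) -
      vx k ^ n) =
      (m : Lau k) * (ybar k d r n ^ (m - 1) * ((d : Lau k) * vs k ^ (d - 1))) := by
    rw [map_sub, proj_of_mem_whom_ne hxn hlt.ne, sub_zero]
    have := proj_whom_mul (γ' := ((n * (m - 1) : ℕ) : ℤ)) hmw (yy d r n q ^ (m - 1) * dST 1 0 F)
    rw [zero_add] at this
    rw [this, h8]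
  set b := dST (vx k ^ N) 0 (zz d r m n e q) with hbdef
  have hJw : (mon (-J, 0, 0) : Lau k) ∈ whom k wx J := by
    have := mon_whom (k := k) wx (-J, 0, 0)
    rwa [wx_apply, neg_neg] at this
  have hbw : b ∈ wle k wx (J + ((n * (m - 1) : ℕ) : ℤ)) := by
    rw [hbeq]; exact mul_mem_wle (whom_le_wle hJw) h9
  have hbp : proj wx (J + ((n * (m - 1) : ℕ) : ℤ)) b =
      mon (-J, 0, 0) * ((m : Lau k) * (ybar k d r n ^ (m - 1) * ((d : Lau k) * vs k ^ (d - 1)))) := by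
    rw [hbeq, proj_whom_mul hJw, h10]
  have hm0 : (m : Lau k) ≠ 0 := Nat.cast_ne_zero.2 (by omega)
  have hd0 : (d : Lau k) ≠ 0 := Nat.cast_ne_zero.2 (by omega)
  have hbp0 : proj wx (J + ((n * (m - 1) : ℕ) : ℤ)) b ≠ 0 := by
    rw [hbp]
    exact mul_ne_zero (mon_ne_zero _) (mul_ne_zero hm0 (mul_ne_zero
      (pow_ne_zero _ (ybar_ne_zero hd)) (mul_ne_zero hd0 (pow_ne_zero _ vs_ne_zero))))
  have hb0 : b ≠ 0 := by
    intro h0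
    rw [h0, map_zero] at hbp0
    exact hbp0 rfl
  obtain ⟨j, a, α, g, hg, hg0, hj, hbj, hpj, -⟩ := exists_leading hm hn hq hb hb0
  have hjJ : j = J + ((n * (m - 1) : ℕ) : ℤ) := by
    have hpj0 : proj wx j b ≠ 0 := by
      rw [hpj]
      exact mul_ne_zero (mul_ne_zero (mon_ne_zero _) (pow_ne_zero _ (hh_ne_zero hd))) hg0
    apply le_antisymm
    · by_contra hlt
      exact hpj0 (proj_of_mem_wle_lt hbw (not_le.1 hlt))
    · by_contra hlt
      exact hbp0 (proj_of_mem_wle_lt hbj (not_le.1 hlt))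
  -- The image of `z` has pole order greater than `n * (m - 1) = wt (m - 1)`, so its leading
  -- coefficient must be divisible by `hh ^ m`. It is a constant times `hh ^ (m - 1) * s ^ (d - 1)`,
  -- and `hh` does not divide `s ^ (d - 1)`.
  have ha : m - 1 < a := by
    rw [← (wt_strictMono (m := m) (e := e) hn).lt_iff_lt]
    have h1 := wt_eq (n := n) (e := e) (c := 0) (by omega : m - 1 < m)
    rw [mul_zero, zero_add, mul_zero, add_zero] at h1
    omega
  obtain ⟨c, rfl⟩ : ∃ c, a = (m - 1) + (c + 1) := ⟨a - (m - 1) - 1, by omega⟩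
  rw [← hjJ, hpj, ybar, mul_pow, mon_pow] at hbp
  have hmon : (mon (-j, 0, 0) : Lau k) = mon (-J, 0, 0) * mon ((m - 1) • (-(n : ℤ), 0, 0)) := by
    rw [mon_mul]
    congr 1
    ext
    · rw [hjJ]; simp; ring
    · simp
    · simp
  rw [hmon] at hbp
  have hcancel : (mon (-J, 0, 0) * mon ((m - 1) • (-(n : ℤ), 0, 0)) * hh k d r ^ (m - 1)) *
      (hh k d r * (hh k d r ^ c * g)) =
      (mon (-J, 0, 0) * mon ((m - 1) • (-(n : ℤ), 0, 0)) * hh k d r ^ (m - 1)) *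
      (((m : Lau k) * (d : Lau k)) * vs k ^ (d - 1)) := by
    rw [pow_add, pow_succ] at hbp
    linear_combination hbp
  have hfin := mul_left_cancel₀ (mul_ne_zero (mul_ne_zero (mon_ne_zero _) (mon_ne_zero _))
    (pow_ne_zero _ (hh_ne_zero hd))) hcancel
  refine not_hh_mul_eq hr (mul_mem (pow_mem hh_mem_polST c) hg) ?_ (mul_ne_zero hm0 hd0) hfin
  exact map_mul_eq_zero (Derivation.map_natCast _ _) (Derivation.map_natCast _ _)

end ExplicitDerivations

/-! ### Transfer of derivations between an embedded ring and the Laurent ring. -/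

section Embeddings

variable {k R : Type*} [Field k] [CharZero k] [CommRing R] [Algebra k R] {d r m n e : ℕ} {q : Lau k}
  {φ : R →ₐ[k] Lau k}

/-- A derivation of a ring embedded as `Bsub` extends to the Laurent polynomials. -/
theorem exists_extension (hq : q ∈ polX k) (hφ : Function.Injective φ)
    (hr : φ.range = Bsub d r m n e q) (E : Derivation k R R) :
    ∃ D : Derivation k (Lau k) (Lau k), ∀ b, D (φ b) = φ (E b) := by
  have hmem : ∀ {f}, f ∈ Bsub d r m n e q → ∃ b, φ b = f := fun {f} hf => by
    rw [← hr] at hf; exact hf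
  obtain ⟨x0, hx0⟩ := hmem vx_mem
  obtain ⟨s0, hs0⟩ := hmem vs_mem
  obtain ⟨t0, ht0⟩ := hmem vt_mem
  let D : Derivation k (Lau k) (Lau k) := logDer (φ (E x0) * mon (-(1, 0, 0)))
    (φ (E s0) * mon (-(0, 1, 0))) (φ (E t0) * mon (-(0, 0, 1)))
  have hDx : D (φ x0) = φ (E x0) := by
    rw [hx0, logDer_vx, mul_assoc, mul_comm (mon _), vx, mon_mul_neg, mul_one]
  have hDs : D (φ s0) = φ (E s0) := by
    rw [hs0, logDer_vs, mul_assoc, mul_comm (mon _), vs, mon_mul_neg, mul_one]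
  have hDt : D (φ t0) = φ (E t0) := by
    rw [ht0, logDer_vt, mul_assoc, mul_comm (mon _), vt, mon_mul_neg, mul_one]
  let K : Subalgebra k R :=
    { carrier := {b | D (φ b) = φ (E b)}
      mul_mem' := fun {a b} ha hb => by
        have ha : D (φ a) = φ (E a) := ha
        have hb : D (φ b) = φ (E b) := hb
        change D (φ (a * b)) = φ (E (a * b))
        rw [map_mul, Derivation.leibniz, Derivation.leibniz, ha, hb, map_add]
        simp only [smul_eq_mul, map_mul]
      add_mem' := fun {a b} ha hb => by
        have ha : D (φ a) = φ (E a) := ha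
        have hb : D (φ b) = φ (E b) := hb
        change D (φ (a + b)) = φ (E (a + b))
        rw [map_add, map_add, map_add, map_add, ha, hb]
      algebraMap_mem' := fun c => by
        change D (φ (algebraMap k R c)) = φ (E (algebraMap k R c))
        rw [φ.commutes, Derivation.map_algebraMap, Derivation.map_algebraMap, map_zero] }
  have hKpol : polX k ≤ K.map φ := polX_le ⟨x0, hDx, hx0⟩ ⟨s0, hDs, hs0⟩ ⟨t0, hDt, ht0⟩
  refine ⟨D, fun b => ?_⟩
  -- The two derivations agree on the preimage of `k[x, s, t]`; for other elements one multiplies by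
  -- a power of `x` and cancels it.
  obtain ⟨N, hN⟩ := exists_pow_mul_mem hq (b := φ b) (by rw [← hr]; exact ⟨b, rfl⟩)
  obtain ⟨c, hcK, hc⟩ := hKpol hN
  have hcK : D (φ c) = φ (E c) := hcK
  have hxN : D (φ (x0 ^ N)) = φ (E (x0 ^ N)) := K.pow_mem hDx N
  have hcb : c = x0 ^ N * b := hφ (by rw [map_mul, map_pow, hx0]; exact hc)
  rw [hcb, map_mul, Derivation.leibniz, Derivation.leibniz, map_add, hxN] at hcK
  simp only [smul_eq_mul, map_mul] at hcK
  have h1 := add_right_cancel hcK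
  rw [map_pow, hx0] at h1
  exact mul_left_cancel₀ (pow_ne_zero _ vx_ne_zero) h1

/-- A derivation of the Laurent polynomials preserving the image of `φ` restricts. -/
theorem exists_restriction (hφ : Function.Injective φ) {D : Derivation k (Lau k) (Lau k)}
    (hD : ∀ f ∈ φ.range, D f ∈ φ.range) : ∃ E : Derivation k R R, ∀ b, φ (E b) = D (φ b) := by
  choose E hE using fun b => hD (φ b) ⟨b, rfl⟩
  have hE : ∀ b, φ (E b) = D (φ b) := hE
  let l : R →ₗ[k] R :=
    { toFun := E
      map_add' := fun a b => hφ (by rw [hE, map_add, map_add, map_add, hE, hE])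
      map_smul' := fun c a => hφ (by
        rw [RingHom.id_apply, hE, map_smul φ, map_smul φ, Derivation.map_smul, hE]) }
  refine ⟨Derivation.mk' l fun a b => hφ ?_, hE⟩
  change φ (E (a * b)) = φ (a • E b + b • E a)
  rw [hE, map_mul, Derivation.leibniz, map_add]
  simp only [smul_eq_mul, map_mul, hE]

theorem iterate_extension {E : Derivation k R R} {D : Derivation k (Lau k) (Lau k)}
    (h : ∀ b, D (φ b) = φ (E b)) (N : ℕ) (b : R) : D^[N] (φ b) = φ (E^[N] b) := by
  induction N generalizing b with
  | zero => rfl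
  | succ N ih => rw [Function.iterate_succ_apply, h, ih, Function.iterate_succ_apply]

/-- The kernel of a locally nilpotent derivation, and the fact that it kills `x`. -/
theorem lnd_properties (hd : 2 ≤ d) (hr : 2 ≤ r) (hdr : Nat.Coprime d r) (hm : 1 ≤ m)
    (hn : 1 ≤ n) (hne : (n, e) ≠ (1, 0)) (hq : q ∈ polX k) (hφ : Function.Injective φ)
    (hrange : φ.range = Bsub d r m n e q) {E : Derivation k R R} (hE0 : E ≠ 0)
    (hE : ∀ b, ∃ N, E^[N] b = 0) :
    (∀ b, E b = 0 → φ b ∈ polX k) ∧ ∀ b, φ b = vx k → E b = 0 := by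
  obtain ⟨D, hD⟩ := exists_extension hq hφ hrange E
  have hmem : ∀ {f}, f ∈ Bsub d r m n e q → ∃ b, φ b = f := fun {f} hf => by
    rw [← hrange] at hf; exact hf
  have hφB : ∀ b, φ b ∈ Bsub d r m n e q := fun b => by rw [← hrange]; exact ⟨b, rfl⟩
  have hD0 : D ≠ 0 := by
    rintro rfl
    apply hE0
    ext b
    apply hφ
    rw [← hD]
    simp
  have hst : ∀ f ∈ Bsub d r m n e q, D f ∈ Bsub d r m n e q := by
    intro f hf
    obtain ⟨b, rfl⟩ := hmem hf
    rw [hD]; exact hφB _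
  have hnil : Bsub d r m n e q ≤ nil D := by
    intro f hf
    obtain ⟨b, rfl⟩ := hmem hf
    obtain ⟨N, hN⟩ := hE b
    exact ⟨N, by rw [iterate_extension hD, hN, map_zero]⟩
  refine ⟨fun b hb => ?_, fun b hb => ?_⟩
  · exact mem_polX_of_map_eq_zero hd hr hdr hm hn hne hq hD0 hst hnil (hφB b)
      (by rw [hD, hb, map_zero])
  · apply hφ
    rw [← hD, hb, map_zero]
    exact map_vx_eq_zero_of_nil hd hr hdr hm hn hne hq hD0 hst hnil

/-- A derivation of `k[x^±, s^±, t^±]` that preserves `Bsub` and is locally nilpotent there gives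
a locally nilpotent derivation of any ring embedded as `Bsub`. -/
theorem exists_lnd (hφ : Function.Injective φ) (hrange : φ.range = Bsub d r m n e q)
    {D : Derivation k (Lau k) (Lau k)} (hD : ∀ f ∈ Bsub d r m n e q, D f ∈ Bsub d r m n e q)
    (hnil : Bsub d r m n e q ≤ nil D) (h0 : ∃ f ∈ Bsub d r m n e q, D f ≠ 0) :
    ∃ E : Derivation k R R, (∀ b, φ (E b) = D (φ b)) ∧ E ≠ 0 ∧ ∀ b, ∃ N, E^[N] b = 0 := by
  rw [← hrange] at hD hnil h0
  obtain ⟨E, hE⟩ := exists_restriction hφ hD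
  refine ⟨E, hE, ?_, fun b => ?_⟩
  · rintro rfl
    obtain ⟨_, ⟨b, rfl⟩, hb⟩ := h0
    apply hb
    have := hE b
    rw [Derivation.coe_zero, Pi.zero_apply, map_zero] at this
    exact this.symm
  · obtain ⟨N, hN⟩ := hnil ⟨b, rfl⟩
    refine ⟨N, hφ ?_⟩
    rw [← iterate_extension (fun b => (hE b).symm), map_zero]
    exact hN

end Embeddings

/-! ### Polynomials in `x` alone, and poles along coprime divisors. -/

section Constants

variable {k : Type*} [Field k] [CharZero k] {d r m n e : ℕ} {q : Lau k}

theorem transcendental_vx : Transcendental k (vx k) := by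
  intro h
  have hbot : IsAlgebraic (⊥ : Subalgebra k (Lau k)) (vx k) :=
    h.extendScalars (algebraMap k (⊥ : Subalgebra k (Lau k))).injective
  have := derivation_eq_zero_of_isAlgebraic (fun _ _ => mul_eq_zero.1) (logDer (1 : Lau k) 0 0) ⊥
    (fun c hc => by
      obtain ⟨z, rfl⟩ := Algebra.mem_bot.1 hc
      exact Derivation.map_algebraMap _ z) hbot
  rw [logDer_vx, one_mul] at this
  exact vx_ne_zero this

theorem coeff_eq_zero_of_dST {f c : Lau k} (hc : c ≠ 0) (hs : dST c 0 f = 0)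
    (ht : dST 0 c f = 0) {i : ℤ × ℤ × ℤ} (hi : f.coeff i ≠ 0) : i.2.1 = 0 ∧ i.2.2 = 0 := by
  have h1 : euler (chi2 k) f = 0 := by
    simpa [dST, logDer_apply, hc, mon_ne_zero] using hs
  have h2 : euler (chi3 k) f = 0 := by
    simpa [dST, logDer_apply, hc, mon_ne_zero] using ht
  have h3 := coeff_euler (chi2 k) f i
  have h4 := coeff_euler (chi3 k) f i
  rw [h1] at h3
  rw [h2] at h4
  have h5 := (mul_eq_zero.1 h3.symm).resolve_right hi
  have h6 := (mul_eq_zero.1 h4.symm).resolve_right hi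
  rw [chi2_apply] at h5
  rw [chi3_apply] at h6
  exact ⟨by exact_mod_cast h5, by exact_mod_cast h6⟩

theorem exists_aeval_vx {f c : Lau k} (hf : f ∈ polX k) (hc : c ≠ 0) (hs : dST c 0 f = 0)
    (ht : dST 0 c f = 0) : ∃ p : Polynomial k, Polynomial.aeval (vx k) p = f := by
  change f ∈ (Polynomial.aeval (R := k) (vx k)).range
  have h : f ∈ supported k k {i : ℤ × ℤ × ℤ | 0 ≤ i.1 ∧ i.2.1 = 0 ∧ i.2.2 = 0} :=
    mem_supported_iff.2 fun i hi =>
      ⟨(mem_polX.1 hf i hi).1, coeff_eq_zero_of_dST hc hs ht hi⟩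
  refine supported_induction (p := fun f => f ∈ (Polynomial.aeval (R := k) (vx k)).range)
    (zero_mem _) (fun _ _ => add_mem) ?_ h
  rintro ⟨i, _, _⟩ ⟨hi, rfl, rfl⟩ z
  lift i to ℕ using hi
  rw [single_eq_smul_mon, ← vx_pow]
  exact Subalgebra.smul_mem _
    (pow_mem ((AlgHom.mem_range _).2 ⟨Polynomial.X, Polynomial.aeval_X _⟩) _) _

theorem yy_notMem_polX (hd : 1 ≤ d) (hn : 1 ≤ n) (hq : q ∈ polX k) : yy d r n q ∉ polX k := by
  intro h
  obtain ⟨h1, h2, h3⟩ := wx_hyp (d := d) (r := r) hq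
  obtain ⟨h4, h5⟩ := yy_leading (n := n) h1 h2 h3
  rw [proj_of_mem_wle_lt (polX_wle h) (by rw [wx_apply]; simp; omega)] at h5
  exact ybar_ne_zero hd h5.symm

/-- For `b ≠ 0` the powers of `x` and of `a * x + b` generate the unit ideal of `k[x, s, t]`; a
Bézout relation recovers `f`. -/
theorem mem_polX_of_coprime {f : Lau k} {a b : k} (hb : b ≠ 0) {M N : ℕ}
    (h1 : vx k ^ M * f ∈ polX k)
    (h2 : (a • vx k + algebraMap k (Lau k) b) ^ N * f ∈ polX k) : f ∈ polX k := by
  let u : polX k := ⟨vx k, vx_mem_polX⟩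
  have h : IsCoprime u (a • u + algebraMap k (polX k) b) := by
    refine ⟨-(b⁻¹ * a) • 1, b⁻¹ • 1, ?_⟩
    rw [smul_mul_assoc, smul_mul_assoc, one_mul, one_mul, smul_add, smul_smul, neg_smul,
      Algebra.algebraMap_eq_smul_one, smul_smul, inv_mul_cancel₀ hb, one_smul, neg_add_cancel_left]
  obtain ⟨v, w, hvw⟩ := h.pow (m := M) (n := N)
  have hvw : (v : Lau k) * vx k ^ M + w * (a • vx k + algebraMap k (Lau k) b) ^ N = 1 :=
    congrArg Subtype.val hvw
  have : f = v * (vx k ^ M * f) + w * ((a • vx k + algebraMap k (Lau k) b) ^ N * f) := by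
    linear_combination (-f) * hvw
  rw [this]
  exact add_mem (mul_mem v.2 h1) (mul_mem w.2 h2)

end Constants

/-! ### Comparison of two embeddings of the same ring. -/

section TwoEmbeddings

variable {k R : Type*} [Field k] [CharZero k] [CommRing R] [Algebra k R]

/-- The homomorphism `φ` identifies `R` with the subring `Bsub d r m n e q`. -/
structure IsEmb (d r m n e : ℕ) (q : Lau k) (φ : R →ₐ[k] Lau k) : Prop where
  mem : q ∈ polX k
  inj : Function.Injective φ
  range : φ.range = Bsub d r m n e q

variable {d r m n e n₁ e₁ n₂ e₂ : ℕ} {q q₁ q₂ : Lau k} {φ φ₁ φ₂ : R →ₐ[k] Lau k}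

theorem IsEmb.exists_eq (h : IsEmb d r m n e q φ) {f : Lau k} (hf : f ∈ Bsub d r m n e q) :
    ∃ b, φ b = f := by
  rw [← h.range] at hf; exact hf

theorem IsEmb.map_mem (h : IsEmb d r m n e q φ) (b : R) : φ b ∈ Bsub d r m n e q := by
  rw [← h.range]; exact ⟨b, rfl⟩

/-- If `φ b` is polynomial in `x, s, t`, then `b` is in any subalgebra containing the preimages of
`x`, `s` and `t`. -/
theorem IsEmb.mem_of_generators (h : IsEmb d r m n e q φ) {K : Subalgebra k R} {x s t : R}
    (hx : φ x = vx k) (hs : φ s = vs k) (ht : φ t = vt k) (hxK : x ∈ K) (hsK : s ∈ K) (htK : t ∈ K)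
    {b : R} (hb : φ b ∈ polX k) : b ∈ K := by
  obtain ⟨c, hc, hcb⟩ := polX_le (K := K.map φ) ⟨x, hxK, hx⟩ ⟨s, hsK, hs⟩ ⟨t, htK, ht⟩ hb
  exact h.inj hcb ▸ hc

/-- The factor `x ^ (n + e)` clears the denominators `x ^ n` of `y` and `x ^ e` of `z`. This
derivation and its analogue for `t` are the test derivations of the comparison. -/
theorem IsEmb.exists_lnd_s (h : IsEmb d r m n e q φ) :
    ∃ E : Derivation k R R, (∀ b, φ (E b) = dST (vx k ^ (n + e)) 0 (φ b)) ∧ E ≠ 0 ∧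
      ∀ b, ∃ N, E^[N] b = 0 := by
  refine exists_lnd h.inj h.range (fun f hf => ?_)
    (Bsub_le_nil_dST h.mem (pow_mem (Algebra.self_mem_adjoin_singleton k (vx k)) _) (zero_mem _))
    ⟨vs k, vs_mem, ?_⟩
  · have := dST_mem_Bsub h.mem (one_mem (Bsub d r m n e q)) (zero_mem _) hf
    rwa [mul_one, mul_zero] at this
  · rw [dST_vs]; exact pow_ne_zero _ vx_ne_zero

theorem IsEmb.exists_lnd_t (h : IsEmb d r m n e q φ) :
    ∃ E : Derivation k R R, (∀ b, φ (E b) = dST 0 (vx k ^ (n + e)) (φ b)) ∧ E ≠ 0 ∧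
      ∀ b, ∃ N, E^[N] b = 0 := by
  refine exists_lnd h.inj h.range (fun f hf => ?_)
    (Bsub_le_nil_dST h.mem (zero_mem _) (pow_mem (Algebra.self_mem_adjoin_singleton k (vx k)) _))
    ⟨vt k, vt_mem, ?_⟩
  · have := dST_mem_Bsub h.mem (zero_mem (Bsub d r m n e q)) (one_mem _) hf
    rwa [mul_one, mul_zero] at this
  · rw [dST_vt]; exact pow_ne_zero _ vx_ne_zero

/-- In the second embedding `x` and `t` are killed by the `∂_s` derivation and `s` by the `∂_t`
derivation. Each is thus in the kernel of a nonzero LND, hence polynomial in the first embedding. -/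
theorem IsEmb.mem_polX (hd : 2 ≤ d) (hr : 2 ≤ r) (hdr : Nat.Coprime d r) (hm : 1 ≤ m)
    (hn₁ : 1 ≤ n₁) (hne₁ : (n₁, e₁) ≠ (1, 0)) (h₁ : IsEmb d r m n₁ e₁ q₁ φ₁)
    (h₂ : IsEmb d r m n₂ e₂ q₂ φ₂) {b : R} (hb : φ₂ b ∈ polX k) : φ₁ b ∈ polX k := by
  obtain ⟨x, hx⟩ := h₂.exists_eq vx_mem
  obtain ⟨s, hs⟩ := h₂.exists_eq vs_mem
  obtain ⟨t, ht⟩ := h₂.exists_eq vt_mem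
  obtain ⟨S, hS, hS0, hSn⟩ := h₂.exists_lnd_s
  obtain ⟨T, hT, hT0, hTn⟩ := h₂.exists_lnd_t
  have kS := (lnd_properties hd hr hdr hm hn₁ hne₁ h₁.mem h₁.inj h₁.range hS0 hSn).1
  have kT := (lnd_properties hd hr hdr hm hn₁ hne₁ h₁.mem h₁.inj h₁.range hT0 hTn).1
  refine h₂.mem_of_generators (K := (polX k).comap φ₁) hx hs ht (kS x (h₂.inj ?_))
    (kT s (h₂.inj ?_)) (kS t (h₂.inj ?_)) hb
  · rw [hS, hx, dST_vx, map_zero]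
  · rw [hT, hs, dST_vs, map_zero]
  · rw [hS, ht, dST_vt, map_zero]

theorem IsEmb.dST_eq_zero (hd : 2 ≤ d) (hr : 2 ≤ r) (hdr : Nat.Coprime d r) (hm : 1 ≤ m)
    (hn₂ : 1 ≤ n₂) (hne₂ : (n₂, e₂) ≠ (1, 0)) (h₁ : IsEmb d r m n₁ e₁ q₁ φ₁)
    (h₂ : IsEmb d r m n₂ e₂ q₂ φ₂) {x : R} (hx : φ₂ x = vx k) :
    dST (vx k ^ (n₁ + e₁)) 0 (φ₁ x) = 0 ∧ dST 0 (vx k ^ (n₁ + e₁)) (φ₁ x) = 0 := by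
  obtain ⟨S, hS, hS0, hSn⟩ := h₁.exists_lnd_s
  obtain ⟨T, hT, hT0, hTn⟩ := h₁.exists_lnd_t
  rw [← hS, ← hT,
    (lnd_properties hd hr hdr hm hn₂ hne₂ h₂.mem h₂.inj h₂.range hS0 hSn).2 x hx,
    (lnd_properties hd hr hdr hm hn₂ hne₂ h₂.mem h₂.inj h₂.range hT0 hTn).2 x hx, map_zero]
  exact ⟨rfl, rfl⟩

theorem IsEmb.exists_aeval (hd : 2 ≤ d) (hr : 2 ≤ r) (hdr : Nat.Coprime d r) (hm : 1 ≤ m)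
    (hn₁ : 1 ≤ n₁) (hne₁ : (n₁, e₁) ≠ (1, 0)) (hn₂ : 1 ≤ n₂) (hne₂ : (n₂, e₂) ≠ (1, 0))
    (h₁ : IsEmb d r m n₁ e₁ q₁ φ₁) (h₂ : IsEmb d r m n₂ e₂ q₂ φ₂) {x₁ x₂ : R}
    (hx₁ : φ₁ x₁ = vx k) (hx₂ : φ₂ x₂ = vx k) :
    ∃ p : Polynomial k, Polynomial.aeval x₁ p = x₂ := by
  obtain ⟨hs, ht⟩ := IsEmb.dST_eq_zero hd hr hdr hm hn₂ hne₂ h₁ h₂ hx₂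
  obtain ⟨p, hp⟩ := exists_aeval_vx (h₁.mem_polX hd hr hdr hm hn₁ hne₁ h₂
    (by rw [hx₂]; exact vx_mem_polX)) (pow_ne_zero _ vx_ne_zero) hs ht
  exact ⟨p, h₁.inj (by rw [← Polynomial.aeval_algHom_apply, hx₁, hp])⟩

theorem IsEmb.exists_smul (hd : 2 ≤ d) (hr : 2 ≤ r) (hdr : Nat.Coprime d r) (hm : 1 ≤ m)
    (hn₁ : 1 ≤ n₁) (hne₁ : (n₁, e₁) ≠ (1, 0)) (hn₂ : 1 ≤ n₂) (hne₂ : (n₂, e₂) ≠ (1, 0))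
    (h₁ : IsEmb d r m n₁ e₁ q₁ φ₁) (h₂ : IsEmb d r m n₂ e₂ q₂ φ₂) {x₁ : R}
    (hx₁ : φ₁ x₁ = vx k) : ∃ c : k, c ≠ 0 ∧ φ₂ x₁ = c • vx k := by
  obtain ⟨x₂, hx₂⟩ := h₂.exists_eq vx_mem
  obtain ⟨p, hp⟩ := IsEmb.exists_aeval hd hr hdr hm hn₂ hne₂ hn₁ hne₁ h₂ h₁ hx₂ hx₁
  obtain ⟨p', hp'⟩ := IsEmb.exists_aeval hd hr hdr hm hn₁ hne₁ hn₂ hne₂ h₁ h₂ hx₁ hx₂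
  -- Each `x` is a polynomial in the other and `x` is transcendental, so the two polynomials are
  -- mutually inverse and therefore of degree 1.
  have hcomp : p.comp p' = Polynomial.X := by
    refine transcendental_iff_injective.1 (transcendental_vx (k := k)) ?_
    rw [Polynomial.aeval_X, ← hx₁, Polynomial.aeval_algHom_apply, Polynomial.aeval_comp, hp', hp]
  have hdeg : p.natDegree * p'.natDegree = 1 := by
    rw [← Polynomial.natDegree_comp, hcomp, Polynomial.natDegree_X]
  have hdeg1 : p.natDegree = 1 := Nat.eq_one_of_mul_eq_one_right hdeg
  obtain ⟨a, b, hab⟩ := Polynomial.exists_eq_X_add_C_of_natDegree_le_one hdeg1.le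
  have ha : a ≠ 0 := by
    rintro rfl
    rw [hab] at hdeg1
    simp at hdeg1
  have hφx : φ₂ x₁ = a • vx k + algebraMap k (Lau k) b := by
    rw [← hp, ← Polynomial.aeval_algHom_apply, hx₂, hab, map_add, map_mul, Polynomial.aeval_C,
      Polynomial.aeval_C, Polynomial.aeval_X, ← Algebra.smul_def]
  by_cases hb : b = 0
  · exact ⟨a, ha, by rw [hφx, hb, map_zero, add_zero]⟩
  exfalso
  -- If `b ≠ 0`, the denominator of `φ₂ y` divides both a power of `x` and a power of `a * x + b`.
  -- So `φ₂ y`, hence also `φ₁ y`, is polynomial, contradicting the pole of `y`.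
  obtain ⟨y, hy⟩ := h₁.exists_eq (yy_mem (m := m) (e := e₁))
  obtain ⟨M, hM⟩ := exists_pow_mul_mem h₂.mem (h₂.map_mem y)
  have h3 : φ₂ (x₁ ^ n₁ * y) ∈ polX k := h₂.mem_polX hd hr hdr hm hn₂ hne₂ h₁ <| by
    rw [map_mul, map_pow, hx₁, hy, vx_pow_mul_yy]
    exact add_mem (polST_le_polX hh_mem_polST) (mul_mem vx_mem_polX h₁.mem)
  rw [map_mul, map_pow, hφx] at h3
  have h4 := h₁.mem_polX hd hr hdr hm hn₁ hne₁ h₂ (mem_polX_of_coprime hb hM h3)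
  rw [hy] at h4
  exact yy_notMem_polX (by omega) hn₁ h₁.mem h4

theorem IsEmb.le_of_smul (hd : 2 ≤ d) (hr : 2 ≤ r) (hdr : Nat.Coprime d r) (hm : 1 ≤ m)
    (hn₁ : 1 ≤ n₁) (hne₁ : (n₁, e₁) ≠ (1, 0)) (hn₂ : 1 ≤ n₂) (hne₂ : (n₂, e₂) ≠ (1, 0))
    (h₁ : IsEmb d r m n₁ e₁ q₁ φ₁) (h₂ : IsEmb d r m n₂ e₂ q₂ φ₂) {x₁ : R}
    (hx₁ : φ₁ x₁ = vx k) {c : k} (hc : c ≠ 0) (hcx : φ₂ x₁ = c • vx k) :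
    n₂ + e₂ ≤ n₁ + e₁ := by
  obtain ⟨s₁, hs₁⟩ := h₁.exists_eq vs_mem
  obtain ⟨t₁, ht₁⟩ := h₁.exists_eq vt_mem
  obtain ⟨x₂, hx₂⟩ := h₂.exists_eq vx_mem
  obtain ⟨s₂, hs₂⟩ := h₂.exists_eq vs_mem
  obtain ⟨t₂, ht₂⟩ := h₂.exists_eq vt_mem
  -- The field `∂_s` of the second embedding acts on the common subalgebra `k[x, s, t]`. Its values
  -- `a, b` on `s₁, t₁` express it as `a ∂_{s₁} + b ∂_{t₁}`, and multiplication by `x₁ ^ (n₁ + e₁)`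
  -- makes it preserve the whole ring.
  have hpar : ∀ b, φ₁ b ∈ polX k → ∃ a, φ₂ a = dST 1 0 (φ₂ b) := fun b hb =>
    h₂.exists_eq (polX_le_Bsub (dST_mem_polX (one_mem _) (zero_mem _)
      (h₂.mem_polX hd hr hdr hm hn₂ hne₂ h₁ hb)))
  obtain ⟨a, ha⟩ := hpar s₁ (by rw [hs₁]; exact vs_mem_polX)
  obtain ⟨b, hb⟩ := hpar t₁ (by rw [ht₁]; exact vt_mem_polX)
  obtain ⟨E, hE⟩ := exists_restriction h₁.inj
    (D := dST (vx k ^ (n₁ + e₁) * φ₁ a) (vx k ^ (n₁ + e₁) * φ₁ b)) <| by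
      rw [h₁.range]
      exact fun f hf => dST_mem_Bsub h₁.mem (h₁.map_mem a) (h₁.map_mem b) hf
  obtain ⟨G, hG⟩ := exists_extension h₂.mem h₂.inj h₂.range E
  have hEx : E x₁ = 0 := h₁.inj (by rw [hE, hx₁, dST_vx, map_zero])
  have hEs : E s₁ = x₁ ^ (n₁ + e₁) * a := h₁.inj (by rw [hE, hs₁, dST_vs, map_mul, map_pow, hx₁])
  have hEt : E t₁ = x₁ ^ (n₁ + e₁) * b := h₁.inj (by rw [hE, ht₁, dST_vt, map_mul, map_pow, hx₁])
  set H : Derivation k (Lau k) (Lau k) := dST ((c • vx k) ^ (n₁ + e₁)) 0 with hH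
  have hHapp : ∀ f, H f = (c • vx k) ^ (n₁ + e₁) * dST 1 0 f := fun f => by
    rw [hH, dST_apply, zero_mul, add_zero]
  let K : Subalgebra k R :=
    { carrier := {b | G (φ₂ b) = H (φ₂ b)}
      mul_mem' := fun {a b} ha hb => by
        have ha : G (φ₂ a) = H (φ₂ a) := ha
        have hb : G (φ₂ b) = H (φ₂ b) := hb
        change G (φ₂ (a * b)) = H (φ₂ (a * b))
        rw [map_mul, Derivation.leibniz, Derivation.leibniz, ha, hb]
      add_mem' := fun {a b} ha hb => by
        have ha : G (φ₂ a) = H (φ₂ a) := ha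
        have hb : G (φ₂ b) = H (φ₂ b) := hb
        change G (φ₂ (a + b)) = H (φ₂ (a + b))
        rw [map_add, map_add, map_add, ha, hb]
      algebraMap_mem' := fun c => by
        change G (φ₂ (algebraMap k R c)) = H (φ₂ (algebraMap k R c))
        rw [φ₂.commutes, Derivation.map_algebraMap, Derivation.map_algebraMap] }
  have hK : ∀ b, φ₂ b ∈ polX k → G (φ₂ b) = H (φ₂ b) := fun u hu => by
    refine h₁.mem_of_generators (K := K) hx₁ hs₁ ht₁ ?_ ?_ ?_
      (h₁.mem_polX hd hr hdr hm hn₁ hne₁ h₂ hu)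
    · change G (φ₂ x₁) = H (φ₂ x₁)
      rw [hG, hEx, hcx, Derivation.map_smul, hH, dST_vx, map_zero, smul_zero]
    · change G (φ₂ s₁) = H (φ₂ s₁)
      rw [hG, hEs, hHapp, map_mul, map_pow, hcx, ha]
    · change G (φ₂ t₁) = H (φ₂ t₁)
      rw [hG, hEt, hHapp, map_mul, map_pow, hcx, hb]
  -- Seen in the second embedding, the derivation `E` is `(c * x) ^ (n₁ + e₁) ∂_s`. So `x ^ (n₁ +
  -- e₁) ∂_s` preserves the second ring, and `le_of_dST_mem` applies.
  have hGH : G = H := by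
    refine derivation_ext ?_ ?_ ?_
    · rw [← hx₂]; exact hK _ (by rw [hx₂]; exact vx_mem_polX)
    · rw [← hs₂]; exact hK _ (by rw [hs₂]; exact vs_mem_polX)
    · rw [← ht₂]; exact hK _ (by rw [ht₂]; exact vt_mem_polX)
  refine le_of_dST_mem (d := d) (r := r) (m := m) (q := q₂) (by omega) (by omega) hm
    hn₂ h₂.mem fun f hf => ?_
  have h3 : dST (vx k ^ (n₁ + e₁)) 0 f = (c⁻¹ ^ (n₁ + e₁)) • G f := by
    rw [hGH, hHapp, dST_apply, zero_mul, add_zero, smul_pow, smul_mul_assoc, smul_smul, ← mul_pow,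
      inv_mul_cancel₀ hc, one_pow, one_smul]
  obtain ⟨u, rfl⟩ := h₂.exists_eq hf
  rw [h3, hG]
  exact Subalgebra.smul_mem _ (h₂.map_mem _) _

theorem IsEmb.comparison (hd : 2 ≤ d) (hr : 2 ≤ r) (hdr : Nat.Coprime d r) (hm : 1 ≤ m)
    (hn₁ : 1 ≤ n₁) (hne₁ : (n₁, e₁) ≠ (1, 0)) (hn₂ : 1 ≤ n₂) (hne₂ : (n₂, e₂) ≠ (1, 0))
    (h₁ : IsEmb d r m n₁ e₁ q₁ φ₁) (h₂ : IsEmb d r m n₂ e₂ q₂ φ₂) {x₁ : R}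
    (hx₁ : φ₁ x₁ = vx k) : (∃ c : k, c ≠ 0 ∧ φ₂ x₁ = c • vx k) ∧ n₁ + e₁ = n₂ + e₂ := by
  obtain ⟨x₂, hx₂⟩ := h₂.exists_eq vx_mem
  obtain ⟨c, hc, hcx⟩ := IsEmb.exists_smul hd hr hdr hm hn₁ hne₁ hn₂ hne₂ h₁ h₂ hx₁
  obtain ⟨c', hc', hcx'⟩ := IsEmb.exists_smul hd hr hdr hm hn₂ hne₂ hn₁ hne₁ h₂ h₁ hx₂
  exact ⟨⟨c, hc, hcx⟩, le_antisymm
    (IsEmb.le_of_smul hd hr hdr hm hn₂ hne₂ hn₁ hne₁ h₂ h₁ hx₂ hc' hcx')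
    (IsEmb.le_of_smul hd hr hdr hm hn₁ hne₁ hn₂ hne₂ h₁ h₂ hx₁ hc hcx)⟩

/-- The derivation of `k[x^±, s^±, t^±]` killing `y = (s ^ d + t ^ r) / x` and `t`, with
`s ↦ y` and `x ↦ d * s ^ (d - 1)`. -/
noncomputable def flow (k : Type*) [Field k] (d r : ℕ) : Derivation k (Lau k) (Lau k) :=
  logDer (((d : Lau k) * vs k ^ (d - 1)) * mon (-(1, 0, 0))) (ybar k d r 1 * mon (-(0, 1, 0))) 0

theorem flow_vx : flow k d r (vx k) = (d : Lau k) * vs k ^ (d - 1) := by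
  rw [flow, logDer_vx, mul_assoc, mul_comm (mon _), vx, mon_mul_neg, mul_one]

theorem flow_vs : flow k d r (vs k) = ybar k d r 1 := by
  rw [flow, logDer_vs, mul_assoc, mul_comm (mon _), vs, mon_mul_neg, mul_one]

theorem flow_vt : flow k d r (vt k) = 0 := by
  rw [flow, logDer_vt, zero_mul]

theorem vx_mul_ybar : vx k * ybar k d r 1 = hh k d r := by
  rw [ybar, ← mul_assoc, ← pow_one (vx k), pow_mul_mon_neg, one_mul]

theorem flow_ybar : flow k d r (ybar k d r 1) = 0 := by
  have h1 : flow k d r (hh k d r) = (d : Lau k) * vs k ^ (d - 1) * ybar k d r 1 := by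
    rw [hh, map_add, Derivation.leibniz_pow, Derivation.leibniz_pow, flow_vs, flow_vt]
    simp [mul_assoc]
  rw [← vx_mul_ybar, Derivation.leibniz, flow_vx, smul_eq_mul, smul_eq_mul] at h1
  have h2 : vx k * flow k d r (ybar k d r 1) = 0 := by linear_combination h1
  exact (mul_eq_zero.1 h2).resolve_left vx_ne_zero

/-- For `n = 1` the term `x * q` is absorbed by the change of variable `y - q`, so the ring is
generated by `x, s, t, ybar`, on which `flow` is explicit. -/
theorem yy_one : yy d r 1 q = ybar k d r 1 + q := by
  refine mul_left_cancel₀ (vx_ne_zero (k := k)) ?_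
  rw [mul_add, vx_mul_ybar, ← pow_one (vx k), vx_pow_mul_yy, pow_one]

theorem zz_zero : zz d r m 1 0 q = yy d r 1 q ^ m - vs k := by
  rw [← vx_pow_mul_zz (e := 0), pow_zero, one_mul]

theorem flow_mem_of_mem_polX (hq : q ∈ polX k) {p : Lau k} (hp : p ∈ polX k) :
    flow k d r p ∈ Bsub d r m 1 0 q := by
  have h : Algebra.adjoin k {vx k, vs k, vt k} ≤ Bsub d r m 1 0 q := by
    refine Algebra.adjoin_le ?_
    rintro _ (rfl | rfl | rfl)
    exacts [vx_mem, vs_mem, vt_mem]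
  refine map_mem_of_generators (S := {vx k, vs k, vt k}) _ ?_ h
    (polX_le (Algebra.subset_adjoin (by simp)) (Algebra.subset_adjoin (by simp))
      (Algebra.subset_adjoin (by simp)) hp)
  rintro _ (rfl | rfl | rfl)
  · rw [flow_vx]; exact mul_mem (natCast_mem _ _) (pow_mem vs_mem _)
  · rw [flow_vs, eq_sub_of_add_eq (yy_one (d := d) (r := r) (q := q)).symm]
    exact sub_mem yy_mem (polX_le_Bsub hq)
  · rw [flow_vt]; exact zero_mem _

theorem flow_mem (hq : q ∈ polX k) {f : Lau k} (hf : f ∈ Bsub d r m 1 0 q) :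
    flow k d r f ∈ Bsub d r m 1 0 q := by
  have hy : flow k d r (yy d r 1 q) ∈ Bsub d r m 1 0 q := by
    rw [yy_one, map_add, flow_ybar, zero_add]; exact flow_mem_of_mem_polX hq hq
  refine map_mem_Bsub _ (flow_mem_of_mem_polX hq vx_mem_polX) hy ?_
    (flow_mem_of_mem_polX hq vt_mem_polX) hf
  rw [zz_zero, map_sub, Derivation.leibniz_pow, nsmul_eq_mul, smul_eq_mul]
  exact sub_mem (mul_mem (natCast_mem _ _) (mul_mem (pow_mem yy_mem _) hy))
    (flow_mem_of_mem_polX hq vs_mem_polX)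

theorem Bsub_le_nil_flow (hq : q ∈ polX k) : Bsub d r m 1 0 q ≤ nil (flow k d r) := by
  have hy : ybar k d r 1 ∈ nil (flow k d r) := mem_nil_of_map_eq_zero flow_ybar
  have hs : vs k ∈ nil (flow k d r) := mem_nil_of_map_mem (by rw [flow_vs]; exact hy)
  have hx : vx k ∈ nil (flow k d r) := mem_nil_of_map_mem <| by
    rw [flow_vx]; exact mul_mem (natCast_mem _ _) (pow_mem hs _)
  have ht : vt k ∈ nil (flow k d r) := mem_nil_of_map_eq_zero flow_vt
  have hyy : yy d r 1 q ∈ nil (flow k d r) := by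
    rw [yy_one]; exact add_mem hy (polX_le hx hs ht hq)
  refine Bsub_le hx hyy ?_ ht
  rw [zz_zero]
  exact sub_mem (pow_mem hyy _) hs

/-- The ring with `(n, e) = (1, 0)` is not isomorphic to any of the others. -/
theorem IsEmb.not_one_zero (hd : 2 ≤ d) (hr : 2 ≤ r) (hdr : Nat.Coprime d r) (hm : 1 ≤ m)
    (hn₂ : 1 ≤ n₂) (hne₂ : (n₂, e₂) ≠ (1, 0))
    (h₁ : IsEmb d r m 1 0 q₁ φ₁) (h₂ : IsEmb d r m n₂ e₂ q₂ φ₂) : False := by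
  obtain ⟨x, hx⟩ := h₂.exists_eq vx_mem
  obtain ⟨hs, ht⟩ := IsEmb.dST_eq_zero hd hr hdr hm hn₂ hne₂ h₁ h₂ hx
  have hd0 : (d : Lau k) ≠ 0 := by
    have hcz : CharZero (Lau k) :=
      charZero_of_injective_algebraMap (algebraMap k (Lau k)).injective
    exact Nat.cast_ne_zero.2 (by omega)
  obtain ⟨E, hE, hE0, hEn⟩ := exists_lnd h₁.inj h₁.range (fun f hf => flow_mem h₁.mem hf)
    (Bsub_le_nil_flow h₁.mem) ⟨vx k, vx_mem, by
      rw [flow_vx]; exact mul_ne_zero hd0 (pow_ne_zero _ vs_ne_zero)⟩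
  have hf := hE x
  rw [(lnd_properties hd hr hdr hm hn₂ hne₂ h₂.mem h₂.inj h₂.range hE0 hEn).2 x hx, map_zero] at hf
  set f := φ₁ x with hfdef
  have hsupp := fun i => coeff_eq_zero_of_dST (pow_ne_zero _ vx_ne_zero) hs ht (i := i)
  have h2 : euler (chi2 k) f = 0 := by
    simpa [dST, logDer_apply, vx_ne_zero, mon_ne_zero] using hs
  have h1 : euler (chi1 k) f = 0 := by
    rw [flow, logDer_apply, h2, mul_zero, zero_mul, add_zero, add_zero] at hf
    exact (mul_eq_zero.1 hf.symm).resolve_left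
      (mul_ne_zero (mul_ne_zero hd0 (pow_ne_zero _ vs_ne_zero)) (mon_ne_zero _))
  -- The `x` of the second embedding is killed by the `∂_s`, `∂_t` and `flow` derivations of the
  -- first. So all three exponents of its monomials vanish and it is a constant, against
  -- transcendence.
  have hconst : f ∈ (⊥ : Subalgebra k (Lau k)) := by
    have h : f ∈ supported k k {(0 : ℤ × ℤ × ℤ)} := mem_supported_iff.2 fun i hi => by
      have h3 := coeff_euler (chi1 k) f i
      rw [h1] at h3
      have h4 := (mul_eq_zero.1 h3.symm).resolve_right hi
      rw [chi1_apply] at h4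
      exact Prod.ext (by exact_mod_cast h4) (Prod.ext (hsupp i hi).1 (hsupp i hi).2)
    refine supported_induction (p := fun f => f ∈ (⊥ : Subalgebra k (Lau k)))
      (zero_mem _) (fun _ _ => add_mem) ?_ h
    rintro _ rfl z
    rw [single_eq_smul_mon, mon_zero]
    exact Subalgebra.smul_mem _ (one_mem _) _
  obtain ⟨z, hz⟩ := Algebra.mem_bot.1 hconst
  have hxz : x = algebraMap k R z := h₁.inj (by rw [φ₁.commutes, hz])
  apply transcendental_vx (k := k)
  rw [← hx, hxz, φ₂.commutes]
  exact isAlgebraic_algebraMap z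

end TwoEmbeddings

/-! ### Identification of the quotient rings with the subalgebras `Bsub`. -/

section Presentations

variable {k : Type*} [Field k]

theorem coeff_aeval_lau (p : MvPolynomial (Fin 3) k) (u : Fin 3 →₀ ℕ) :
    (MvPolynomial.aeval ![vx k, vs k, vt k] p).coeff ((u 0 : ℤ), (u 1 : ℤ), (u 2 : ℤ)) =
      p.coeff u := by
  classical
  induction p using MvPolynomial.induction_on' with
  | monomial v a =>
    rw [MvPolynomial.aeval_monomial, Finsupp.prod_fintype _ _ fun _ => pow_zero _,
      Fin.prod_univ_three, ← Algebra.smul_def, MvPolynomial.coeff_monomial, mul_assoc]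
    change (a • (vx k ^ v 0 * (vs k ^ v 1 * vt k ^ v 2)) : Lau k).coeff _ = _
    rw [← mon_eq, AddMonoidAlgebra.coeff_smul, Finsupp.smul_apply, coeff_mon, smul_eq_mul, mul_ite,
      mul_one, mul_zero]
    refine if_congr ?_ rfl rfl
    simp only [Prod.mk.injEq, Nat.cast_inj]
    constructor
    · rintro ⟨h0, h1, h2⟩
      ext i
      fin_cases i <;> assumption
    · rintro rfl
      exact ⟨rfl, rfl, rfl⟩
  | add p q hp hq =>
    rw [map_add, AddMonoidAlgebra.coeff_add, Finsupp.add_apply, hp, hq, MvPolynomial.coeff_add]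

theorem aeval_lau_injective :
    Function.Injective (MvPolynomial.aeval (R := k) ![vx k, vs k, vt k]) := by
  rw [injective_iff_map_eq_zero]
  intro p hp
  ext u
  rw [← coeff_aeval_lau, hp]
  rfl

theorem aeval_lau_mem_polX (p : MvPolynomial (Fin 3) k) :
    MvPolynomial.aeval ![vx k, vs k, vt k] p ∈ polX k := by
  have h : MvPolynomial.aeval ![vx k, vs k, vt k] p ∈
      Algebra.adjoin k (Set.range ![vx k, vs k, vt k]) := by
    rw [Algebra.adjoin_range_eq_range_aeval]
    exact ⟨p, rfl⟩
  refine Algebra.adjoin_le ?_ h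
  rintro _ ⟨i, rfl⟩
  fin_cases i
  exacts [vx_mem_polX, vs_mem_polX, vt_mem_polX]

variable {R : Type*} [CommRing R] [Algebra k R]

/-- A homomorphism to the Laurent polynomials is injective if `x` is not a zero divisor and the
source becomes `k[x, s, t]` after inverting `x`. -/
theorem injective_of_generators (φ : R →ₐ[k] Lau k) {x s t : R} (hx : φ x = vx k) (hs : φ s = vs k)
    (ht : φ t = vt k) (hx0 : ∀ b, x * b = 0 → b = 0) {S : Set R} (hS : Algebra.adjoin k S = ⊤)
    (h : ∀ g ∈ S, ∃ N, x ^ N * g ∈ (MvPolynomial.aeval (R := k) ![x, s, t]).range) :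
    Function.Injective φ := by
  set C := (MvPolynomial.aeval (R := k) ![x, s, t]).range with hC
  have hxC : x ∈ C := ⟨MvPolynomial.X 0, MvPolynomial.aeval_X _ _⟩
  have key : ∀ b : R, ∃ N, x ^ N * b ∈ C := by
    intro b
    have hb : b ∈ Algebra.adjoin k S := by rw [hS]; trivial
    induction hb using Algebra.adjoin_induction with
    | mem b hb => exact h b hb
    | algebraMap z => exact ⟨0, by rw [pow_zero, one_mul]; exact C.algebraMap_mem z⟩
    | add a b _ _ h1 h2 =>
      obtain ⟨N, hN⟩ := h1
      obtain ⟨M, hM⟩ := h2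
      refine ⟨N + M, ?_⟩
      have : x ^ (N + M) * (a + b) = x ^ M * (x ^ N * a) + x ^ N * (x ^ M * b) := by ring
      rw [this]
      exact add_mem (mul_mem (pow_mem hxC _) hN) (mul_mem (pow_mem hxC _) hM)
    | mul a b _ _ h1 h2 =>
      obtain ⟨N, hN⟩ := h1
      obtain ⟨M, hM⟩ := h2
      refine ⟨N + M, ?_⟩
      rw [pow_add, mul_mul_mul_comm]
      exact mul_mem hN hM
  have hpow : ∀ N b, x ^ N * b = 0 → b = 0 := by
    intro N
    induction N with
    | zero => intro b hb; rwa [pow_zero, one_mul] at hb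
    | succ N ih =>
      intro b hb
      rw [pow_succ, mul_assoc] at hb
      exact hx0 b (ih _ hb)
  rw [injective_iff_map_eq_zero]
  intro b hb
  obtain ⟨N, p, hp⟩ := key b
  have hp : MvPolynomial.aeval ![x, s, t] p = x ^ N * b := hp
  have h1 : φ (MvPolynomial.aeval ![x, s, t] p) = MvPolynomial.aeval ![vx k, vs k, vt k] p := by
    rw [MvPolynomial.comp_aeval_apply]
    congr 2
    ext1 i
    fin_cases i <;> assumption
  rw [hp, map_mul, hb, mul_zero] at h1
  have h2 : p = 0 := aeval_lau_injective (by rw [← h1, map_zero])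
  rw [h2, map_zero] at hp
  exact hpow N b hp.symm

/-- `x` is not a zero divisor modulo a polynomial that is not divisible by `X`. -/
theorem eq_zero_of_mk_X_mul_eq_zero {σ : Type*} {i : σ} {f : MvPolynomial σ k} {v : σ → k}
    (hv : v i = 0) (hf : MvPolynomial.eval v f ≠ 0) (b : MvPolynomial σ k ⧸ Ideal.span {f})
    (hb : Ideal.Quotient.mk (Ideal.span {f}) (MvPolynomial.X i) * b = 0) : b = 0 := by
  obtain ⟨b, rfl⟩ := Ideal.Quotient.mk_surjective b
  rw [← map_mul, Ideal.Quotient.eq_zero_iff_mem, Ideal.mem_span_singleton] at hb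
  rw [Ideal.Quotient.eq_zero_iff_mem, Ideal.mem_span_singleton]
  obtain ⟨g, hg⟩ := hb
  have hX : Prime (MvPolynomial.X i : MvPolynomial σ k) := MvPolynomial.X_prime
  rcases hX.dvd_or_dvd ⟨b, hg.symm⟩ with ⟨f', h⟩ | ⟨g', rfl⟩
  · exact absurd (by rw [h, map_mul, MvPolynomial.eval_X, hv, zero_mul]) hf
  · exact ⟨g', mul_left_cancel₀ hX.ne_zero (by rw [hg]; ring)⟩

theorem adjoin_range_mk_X {σ : Type*} (I : Ideal (MvPolynomial σ k)) :
    Algebra.adjoin k (Set.range fun i : σ => Ideal.Quotient.mkₐ k I (MvPolynomial.X i)) = ⊤ := by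
  have h : (Set.range fun i : σ => Ideal.Quotient.mkₐ k I (MvPolynomial.X i)) =
      Ideal.Quotient.mkₐ k I '' Set.range MvPolynomial.X := by
    rw [← Set.range_comp]; rfl
  rw [h, ← AlgHom.map_adjoin, MvPolynomial.adjoin_range_X, Algebra.map_top, AlgHom.range_eq_top]
  exact Ideal.Quotient.mkₐ_surjective k I

theorem range_eq_adjoin {σ : Type*} {I : Ideal (MvPolynomial σ k)}
    (φ : (MvPolynomial σ k ⧸ I) →ₐ[k] Lau k) : φ.range = Algebra.adjoin k
      (Set.range fun i : σ => φ (Ideal.Quotient.mkₐ k I (MvPolynomial.X i))) := by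
  rw [← Algebra.map_top, ← adjoin_range_mk_X, AlgHom.map_adjoin, ← Set.range_comp]
  rfl

theorem map_aeval_of_fin {R' : Type*} [CommRing R'] [Algebra k R'] (φ : R →ₐ[k] R') (x s t : R)
    (Q : MvPolynomial (Fin 3) k) : φ (MvPolynomial.aeval ![x, s, t] Q) =
      MvPolynomial.aeval ![φ x, φ s, φ t] Q := by
  rw [MvPolynomial.comp_aeval_apply]
  congr 2
  ext1 i
  fin_cases i <;> rfl

theorem mem_range_of_fin {x s t : R} :
    x ∈ (MvPolynomial.aeval (R := k) ![x, s, t]).range ∧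
    s ∈ (MvPolynomial.aeval (R := k) ![x, s, t]).range ∧
    t ∈ (MvPolynomial.aeval (R := k) ![x, s, t]).range :=
  ⟨⟨MvPolynomial.X 0, MvPolynomial.aeval_X _ _⟩, ⟨MvPolynomial.X 1, MvPolynomial.aeval_X _ _⟩,
    ⟨MvPolynomial.X 2, MvPolynomial.aeval_X _ _⟩⟩

theorem BRing.exists_isEmb {d r m n e : ℕ} [CharZero k] (hd : 1 ≤ d) (hm : 1 ≤ m) (hn : 1 ≤ n)
    (Q : MvPolynomial (Fin 3) k) : ∃ φ : BRing m d r n e Q →ₐ[k] Lau k,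
      IsEmb d r m n e (MvPolynomial.aeval ![vx k, vs k, vt k] Q) φ ∧
      φ (BRing.x m d r n e Q) = vx k := by
  set q : Lau k := MvPolynomial.aeval ![vx k, vs k, vt k] Q with hq
  set I : Ideal (MvPolynomial (Fin 4) k) := Ideal.span {bPoly m d r n e Q} with hI
  have hs : yy d r n q ^ m - vx k ^ e * zz d r m n e q = vs k := by
    rw [vx_pow_mul_zz, sub_sub_cancel]
  let θ : MvPolynomial (Fin 4) k →ₐ[k] Lau k :=
    MvPolynomial.aeval ![vx k, yy d r n q, zz d r m n e q, vt k]
  have h0 : θ (MvPolynomial.X 0) = vx k := MvPolynomial.aeval_X _ _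
  have h1 : θ (MvPolynomial.X 1) = yy d r n q := MvPolynomial.aeval_X _ _
  have h2 : θ (MvPolynomial.X 2) = zz d r m n e q := MvPolynomial.aeval_X _ _
  have h3 : θ (MvPolynomial.X 3) = vt k := MvPolynomial.aeval_X _ _
  have hθ : θ (bPoly m d r n e Q) = 0 := by
    simp only [bPoly, map_sub, map_mul, map_pow, map_aeval_of_fin, h0, h1, h2, h3, hs,
      vx_pow_mul_yy]
    rw [← hq, hh]
    ring
  let φ : BRing m d r n e Q →ₐ[k] Lau k := Ideal.Quotient.liftₐ I θ fun a ha => by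
    obtain ⟨b, rfl⟩ := Ideal.mem_span_singleton.1 ha
    rw [map_mul, hθ, zero_mul]
  have hφ : ∀ p, φ (Ideal.Quotient.mkₐ k I p) = θ p := fun p => rfl
  set π := Ideal.Quotient.mkₐ k I with hπ
  set x := π (MvPolynomial.X 0) with hxdef
  set y := π (MvPolynomial.X 1)
  set z := π (MvPolynomial.X 2)
  set t := π (MvPolynomial.X 3)
  set s := y ^ m - x ^ e * z with hsdef
  have hφs : φ s = vs k := by
    rw [hsdef, map_sub, map_mul, map_pow, map_pow, hφ, hφ, hφ, h0, h1, h2, hs]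
  have hrel : x ^ n * y = s ^ d + t ^ r + x * MvPolynomial.aeval ![x, s, t] Q := by
    have h : π (bPoly m d r n e Q) = 0 :=
      Ideal.Quotient.eq_zero_iff_mem.2 (Ideal.mem_span_singleton_self _)
    simp only [bPoly, map_sub, map_mul, map_pow, map_aeval_of_fin] at h
    linear_combination h
  refine ⟨φ, ⟨aeval_lau_mem_polX Q, ?_, ?_⟩, (hφ _).trans h0⟩
  · refine injective_of_generators φ (x := x) (s := s) (t := t) ((hφ _).trans h0) hφs
      ((hφ _).trans h3) ?_ (adjoin_range_mk_X I) ?_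
    -- At `X = Y = Z = 0`, `T = 1` the defining polynomial equals `-1`, so `X` does not divide it.
    · refine eq_zero_of_mk_X_mul_eq_zero (v := ![0, 0, 0, 1]) rfl ?_
      simp [bPoly, show n ≠ 0 by omega, show d ≠ 0 by omega, show m ≠ 0 by omega]
    · set C := (MvPolynomial.aeval (R := k) ![x, s, t]).range
      obtain ⟨hx, hs, ht⟩ := mem_range_of_fin (k := k) (x := x) (s := s) (t := t)
      have hy : x ^ n * y ∈ C := by
        rw [hrel]
        exact add_mem (add_mem (pow_mem hs _) (pow_mem ht _)) (mul_mem hx ⟨Q, rfl⟩)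
      rintro _ ⟨i, rfl⟩
      fin_cases i
      · exact ⟨0, by rw [pow_zero, one_mul]; exact hx⟩
      · exact ⟨n, hy⟩
      · refine ⟨n * m + e, ?_⟩
        have h4 : x ^ (n * m + e) * z = (x ^ n * y) ^ m - x ^ (n * m) * s := by
          rw [hsdef]; ring
        exact h4 ▸ sub_mem (pow_mem hy _) (mul_mem (pow_mem hx _) hs)
      · exact ⟨0, by rw [pow_zero, one_mul]; exact ht⟩
  · rw [range_eq_adjoin, Bsub]
    congr 1
    ext f
    simp only [Set.mem_range, Set.mem_insert_iff, Set.mem_singleton_iff]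
    constructor
    · rintro ⟨i, rfl⟩
      fin_cases i
      exacts [Or.inl h0, Or.inr (Or.inl h1), Or.inr (Or.inr (Or.inl h2)),
        Or.inr (Or.inr (Or.inr h3))]
    · rintro (rfl | rfl | rfl | rfl)
      exacts [⟨0, h0⟩, ⟨1, h1⟩, ⟨2, h2⟩, ⟨3, h3⟩]

/-- With `e = 0` the generator `z = y ^ m - s` may be replaced by `s`, so the image does not depend
on `m`, which remains free. -/
theorem RussellDomain.exists_isEmb {d r m n : ℕ} [CharZero k] (hd : 1 ≤ d) (hn : 1 ≤ n)
    (Q : MvPolynomial (Fin 3) k) : ∃ φ : RussellDomain n (baseF d r Q) →ₐ[k] Lau k,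
      IsEmb d r m n 0 (MvPolynomial.aeval ![vx k, vs k, vt k] Q) φ ∧
      φ (RussellDomain.x n (baseF d r Q)) = vx k := by
  set q : Lau k := MvPolynomial.aeval ![vx k, vs k, vt k] Q with hq
  set I : Ideal (MvPolynomial (Fin 4) k) := Ideal.span {russellPoly n (baseF d r Q)} with hI
  let θ : MvPolynomial (Fin 4) k →ₐ[k] Lau k :=
    MvPolynomial.aeval ![vx k, yy d r n q, vs k, vt k]
  have h0 : θ (MvPolynomial.X 0) = vx k := MvPolynomial.aeval_X _ _
  have h1 : θ (MvPolynomial.X 1) = yy d r n q := MvPolynomial.aeval_X _ _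
  have h2 : θ (MvPolynomial.X 2) = vs k := MvPolynomial.aeval_X _ _
  have h3 : θ (MvPolynomial.X 3) = vt k := MvPolynomial.aeval_X _ _
  have hF : ∀ {R' : Type _} [CommRing R'] [Algebra k R'] (x s t : R'),
      MvPolynomial.aeval ![x, s, t] (baseF d r Q) =
        s ^ d + t ^ r + x * MvPolynomial.aeval ![x, s, t] Q := by
    intro R' _ _ x s t
    simp [baseF]
  have hθ : θ (russellPoly n (baseF d r Q)) = 0 := by
    simp only [russellPoly, map_sub, map_mul, map_pow, map_aeval_of_fin, h0, h1, h2, h3,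
      vx_pow_mul_yy]
    rw [hF, ← hq, hh, sub_self]
  let φ : RussellDomain n (baseF d r Q) →ₐ[k] Lau k := Ideal.Quotient.liftₐ I θ fun a ha => by
    obtain ⟨b, rfl⟩ := Ideal.mem_span_singleton.1 ha
    rw [map_mul, hθ, zero_mul]
  have hφ : ∀ p, φ (Ideal.Quotient.mkₐ k I p) = θ p := fun p => rfl
  set π := Ideal.Quotient.mkₐ k I with hπ
  set x := π (MvPolynomial.X 0) with hxdef
  set y := π (MvPolynomial.X 1)
  set s := π (MvPolynomial.X 2)
  set t := π (MvPolynomial.X 3)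
  have hrel : x ^ n * y = MvPolynomial.aeval ![x, s, t] (baseF d r Q) := by
    have h : π (russellPoly n (baseF d r Q)) = 0 :=
      Ideal.Quotient.eq_zero_iff_mem.2 (Ideal.mem_span_singleton_self _)
    simp only [russellPoly, map_sub, map_mul, map_pow, map_aeval_of_fin] at h
    linear_combination h
  refine ⟨φ, ⟨aeval_lau_mem_polX Q, ?_, ?_⟩, (hφ _).trans h0⟩
  · refine injective_of_generators φ (x := x) (s := s) (t := t) ((hφ _).trans h0)
      ((hφ _).trans h2) ((hφ _).trans h3) ?_ (adjoin_range_mk_X I) ?_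
    · refine eq_zero_of_mk_X_mul_eq_zero (v := ![0, 0, 0, 1]) rfl ?_
      simp [russellPoly, baseF, show n ≠ 0 by omega, show d ≠ 0 by omega]
    · obtain ⟨hx, hs, ht⟩ := mem_range_of_fin (k := k) (x := x) (s := s) (t := t)
      rintro _ ⟨i, rfl⟩
      fin_cases i
      · exact ⟨0, by rw [pow_zero, one_mul]; exact hx⟩
      · exact ⟨n, _, hrel.symm⟩
      · exact ⟨0, by rw [pow_zero, one_mul]; exact hs⟩
      · exact ⟨0, by rw [pow_zero, one_mul]; exact ht⟩
  · rw [range_eq_adjoin]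
    apply le_antisymm
    · refine Algebra.adjoin_le ?_
      have hmem : ∀ i, θ (MvPolynomial.X i) ∈ Bsub d r m n 0 q := by
        intro i
        fin_cases i
        exacts [h0.symm ▸ vx_mem, h1.symm ▸ yy_mem, h2.symm ▸ vs_mem, h3.symm ▸ vt_mem]
      rintro _ ⟨i, rfl⟩
      exact hmem i
    · have hmem : ∀ i, θ (MvPolynomial.X i) ∈ Algebra.adjoin k
          (Set.range fun i : Fin 4 => φ (Ideal.Quotient.mkₐ k I (MvPolynomial.X i))) :=
        fun i => Algebra.subset_adjoin ⟨i, rfl⟩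
      refine Bsub_le (h0 ▸ hmem 0) (h1 ▸ hmem 1) ?_ (h3 ▸ hmem 3)
      have hz : zz d r m n 0 q = yy d r n q ^ m - vs k := by
        rw [← vx_pow_mul_zz (e := 0), pow_zero, one_mul]
      rw [hz]
      exact sub_mem (pow_mem (h1 ▸ hmem 1) _) (h2 ▸ hmem 2)

theorem IsEmb.comp_equiv {R R' : Type*} [CommRing R] [Algebra k R] [CommRing R'] [Algebra k R']
    [CharZero k] {d r m n e : ℕ} {q : Lau k} {φ : R' →ₐ[k] Lau k} (h : IsEmb d r m n e q φ)
    (Ψ : R ≃ₐ[k] R') : IsEmb d r m n e q (φ.comp (Ψ : R →ₐ[k] R')) where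
  mem := h.mem
  inj := h.inj.comp Ψ.injective
  range := by
    rw [← h.range]
    ext f
    constructor
    · rintro ⟨b, rfl⟩
      exact ⟨Ψ b, rfl⟩
    · rintro ⟨b, rfl⟩
      exact ⟨Ψ.symm b, congrArg φ (Ψ.apply_symm_apply b)⟩

end Presentations

end RussellExt

theorem mainTheorem7 {k : Type*} [Field k] [CharZero k] (d r : ℕ) (hd : 2 ≤ d) (hr : 2 ≤ r)
    (hdr : Nat.Coprime d r) :
    (∀ (m : ℕ), 2 ≤ m →
      ∀ (n₁ e₁ n₂ e₂ : ℕ), 1 ≤ n₁ → 1 ≤ n₂ → (n₁, e₁) ≠ (1, 0) → (n₂, e₂) ≠ (1, 0) →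
      ∀ (Q₁ Q₂ : MvPolynomial (Fin 3) k)
        (Ψ : RussellExt.BRing m d r n₁ e₁ Q₁ ≃ₐ[k] RussellExt.BRing m d r n₂ e₂ Q₂),
        (∃ c : k, c ≠ 0 ∧
          Ψ (RussellExt.BRing.x m d r n₁ e₁ Q₁) = c • RussellExt.BRing.x m d r n₂ e₂ Q₂) ∧
        n₁ + e₁ = n₂ + e₂) ∧
    (∀ (n₁ n₂ : ℕ), 1 ≤ n₁ → 1 ≤ n₂ →
      ∀ (Q₁ Q₂ : MvPolynomial (Fin 3) k)
        (Ψ : RussellExt.RussellDomain n₁ (RussellExt.baseF d r Q₁) ≃ₐ[k]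
          RussellExt.RussellDomain n₂ (RussellExt.baseF d r Q₂)),
        n₁ = n₂ ∧
        ((n₁, n₂) ≠ (1, 1) → ∃ c : k, c ≠ 0 ∧
          Ψ (RussellExt.RussellDomain.x n₁ (RussellExt.baseF d r Q₁)) =
            c • RussellExt.RussellDomain.x n₂ (RussellExt.baseF d r Q₂))) := by
  constructor
  · intro m hm n₁ e₁ n₂ e₂ hn₁ hn₂ hne₁ hne₂ Q₁ Q₂ Ψ
    obtain ⟨φ₁, h₁, hx₁⟩ := RussellExt.BRing.exists_isEmb (d := d) (r := r) (m := m) (e := e₁)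
      (by omega) (by omega) hn₁ Q₁
    obtain ⟨φ₂, h₂, hx₂⟩ := RussellExt.BRing.exists_isEmb (d := d) (r := r) (m := m) (e := e₂)
      (by omega) (by omega) hn₂ Q₂
    -- Composing the second embedding with `Ψ` gives two embeddings of the same ring.
    obtain ⟨⟨c, hc, hcx⟩, h⟩ := RussellExt.IsEmb.comparison hd hr hdr (by omega) hn₁ hne₁ hn₂ hne₂
      h₁ (h₂.comp_equiv Ψ) hx₁
    exact ⟨⟨c, hc, h₂.inj (by rw [map_smul, hx₂]; exact hcx)⟩, h⟩
  · intro n₁ n₂ hn₁ hn₂ Q₁ Q₂ Ψ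
    obtain ⟨φ₁, h₁, hx₁⟩ := RussellExt.RussellDomain.exists_isEmb (d := d) (r := r) (m := 1)
      (by omega) hn₁ Q₁
    obtain ⟨φ₂, h₂, hx₂⟩ := RussellExt.RussellDomain.exists_isEmb (d := d) (r := r) (m := 1)
      (by omega) hn₂ Q₂
    have h₂' := h₂.comp_equiv Ψ
    -- Here `e = 0`, so `n = 1` is precisely the exceptional pair `(1, 0)`.
    by_cases h1 : n₁ = 1 <;> by_cases h2 : n₂ = 1
    · subst h1 h2
      exact ⟨rfl, fun h => absurd rfl h⟩
    · subst h1
      exact (RussellExt.IsEmb.not_one_zero hd hr hdr le_rfl hn₂ (by simp [h2]) h₁ h₂').elim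
    · subst h2
      exact (RussellExt.IsEmb.not_one_zero hd hr hdr le_rfl hn₁ (by simp [h1]) h₂' h₁).elim
    · obtain ⟨⟨c, hc, hcx⟩, h⟩ := RussellExt.IsEmb.comparison hd hr hdr le_rfl hn₁ (by simp [h1])
        hn₂ (by simp [h2]) h₁ h₂' hx₁
      exact ⟨h, fun _ => ⟨c, hc, h₂.inj (by rw [map_smul, hx₂]; exact hcx)⟩⟩
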